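/- Let $M$ be a compact connected smooth manifold of dimension $d$, without or with boundary $\partial M$, equipped with a smooth Riemannian metric $g$; write $\nabla$ for the gradient, $\langle\cdot,\cdot\rangle$ for the inner product of tangent vectors, and integrate with respect to the Riemannian volume. Let $H^1(M)$ be the Sobolev space of functions $u\in L^2(M)$ with weak gradient in $L^2$, with norm $\|u\|^2=\int_M \langle\nabla u,\nabla u\rangle+u^2$, and let $H^1_0(M)$ be the closure in $H^1(M)$ of the smooth functions with compact support in $M\setminus\partial M$. Let $M=\bigcup_{i=1}^m \operatorname{Int} M_i$, where each $M_i$ is a closed subdomain of $M$ (of codimension $0$) with Lipschitz boundary and $\operatorname{Int} M_i$ is its topological interior in $M$. Let $H^1_0(M_i)\subseteq H^1_0(M)$ be the closure in $H^1(M)$ of the smooth functions with compact support in $\operatorname{Int}M_i\setminus\partial M$ (functions on $M_i$ being extended by zero). Let $b\ge 0$ be a constant, with $b>0$ if $\partial M=\emptyset$, and let $f\in L^2(M)$. Then there is exactly one weak solution $u$ of $-\Delta u+bu=f$, $u|_{\partial M}=0$, that is, exactly one $u\in H^1_0(M)$ with $$\int_M \langle\nabla u,\nabla v\rangle+buv=\int_M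 fv\qquad\text{for all } v\in H^1_0(M).$$ Moreover, for every $u^0\in H^1_0(M)$ there is exactly one sequence $(u^n)_{n\ge 0}$ starting with $u^0$ that is produced by the following multiplicative Schwarz iteration: for each $n>0$ put $u^{n,0}=u^{n-1}$; for $i=1,\dots,m$ let $u^{n,i}\in H^1_0(M)$ satisfy $$\int_{M_i}\langle\nabla u^{n,i},\nabla v\rangle+bu^{n,i}v=\int_{M_i}fv\quad\text{for all } v\in H^1_0(M_i),\qquad u^{n,i}=u^{n,i-1}\ \text{ a.e. on } M\setminus\operatorname{Int}M_i;$$ and put $u^n=u^{n,m}$. Finally, there exist constants $C_0>0$ and $L\in[0,1)$ such that for all $u^0\in H^1_0(M)$ and all $n>0$ $$\|u-u^n\|_{H^1_0(M)}\le C_0L^n\|u-u^0\|_{H^1_0(M)},$$ where $\|\cdot\|_{H^1_0(M)}$ is the norm of $H^1(M)$, $u$ is the weak solution and $(u^n)$ is the sequence with initial guess $u^0$. -/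

import Mathlib

open Set MeasureTheory Topology
open scoped Manifold ContDiff ENNReal

noncomputable section

namespace SchwarzManifold

/-! The model `I` may be `𝓡 d` (manifolds without boundary) or `𝓡∂ d` (manifolds with boundary). -/

section Riemannian

variable {d : ℕ} {H : Type*} [TopologicalSpace H]
  {I : ModelWithCorners ℝ (EuclideanSpace ℝ (Fin d)) H}
  {M : Type*} [TopologicalSpace M] [ChartedSpace H M] [IsManifold I ∞ M]

variable (I M) in
/-- Smooth Riemannian metrics on `M`. -/
abbrev Metric : Type _ :=
  Bundle.ContMDiffRiemannianMetric I ∞ (EuclideanSpace ℝ (Fin d))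
    (fun p : M => TangentSpace I p)

variable (I) in
/-- The coordinate vector field `∂/∂x_α` of the chart `e`, at the point of `M` with
coordinates `y`. -/
def coordVector (e : OpenPartialHomeomorph M H) (y : EuclideanSpace ℝ (Fin d)) (α : Fin d) :
    TangentSpace I ((e.extend I).symm y) :=
  mfderivWithin 𝓘(ℝ, EuclideanSpace ℝ (Fin d)) I (e.extend I).symm (range I) y
    (EuclideanSpace.single α (1 : ℝ))

/-- The matrix `(g_{αβ})` of the metric in the chart `e`, at the point with coordinates `y`. -/
def metricMatrix (g : Metric I M) (e : OpenPartialHomeomorph M H)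
    (y : EuclideanSpace ℝ (Fin d)) : Matrix (Fin d) (Fin d) ℝ :=
  Matrix.of fun α β =>
    g.inner ((e.extend I).symm y) (coordVector I e y α) (coordVector I e y β)

/-- The measure `√G dx₁ ⋯ dx_d` of the chart `e`, transported to the chart domain in `M`. -/
def chartVolume [MeasurableSpace M] (g : Metric I M) (e : OpenPartialHomeomorph M H) :
    Measure M :=
  (((volume : Measure (EuclideanSpace ℝ (Fin d))).restrict (e.extend I).target).withDensity
    fun y => ENNReal.ofReal (Real.sqrt (metricMatrix g e y).det)).map (e.extend I).symm

/-- The Riemannian volume measure: the least measure on `M` that dominates `√G dx₁ ⋯ dx_d` on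
every chart domain. (The chart measures agree on overlaps, so on each chart domain
it is equal to `√G dx₁ ⋯ dx_d`.) -/
def vol [MeasurableSpace M] (g : Metric I M) : Measure M :=
  ⨆ e ∈ atlas H M, chartVolume g e

/-- `X` is the weak gradient of `u`: in the interior of each chart the functions
`⟨X, ∂/∂x_α⟩` are the weak partial derivatives `∂u/∂x_α`. -/
def HasWeakGrad (g : Metric I M) (u : M → ℝ) (X : ∀ p : M, TangentSpace I p) : Prop :=
  ∀ e ∈ atlas H M,
    LocallyIntegrableOn (fun y => u ((e.extend I).symm y)) (interior (e.extend I).target) ∧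
    ∀ α : Fin d,
      LocallyIntegrableOn
        (fun y => g.inner ((e.extend I).symm y) (X ((e.extend I).symm y)) (coordVector I e y α))
        (interior (e.extend I).target) ∧
      ∀ ψ : EuclideanSpace ℝ (Fin d) → ℝ, ContDiff ℝ ∞ ψ → HasCompactSupport ψ →
        tsupport ψ ⊆ interior (e.extend I).target →
        ∫ y, u ((e.extend I).symm y) * fderiv ℝ ψ y (EuclideanSpace.single α (1 : ℝ)) =
          - ∫ y, g.inner ((e.extend I).symm y) (X ((e.extend I).symm y))
              (coordVector I e y α) * ψ y

open Classical in
/-- The weak gradient `∇u` (unique up to null sets where it exists; zero otherwise). -/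
def weakGrad (g : Metric I M) (u : M → ℝ) : ∀ p : M, TangentSpace I p :=
  if h : ∃ X, HasWeakGrad g u X then h.choose else 0

/-- The function `⟨∇u, ∇v⟩` on `M`. -/
def gradInner (g : Metric I M) (u v : M → ℝ) (p : M) : ℝ :=
  g.inner p (weakGrad g u p) (weakGrad g v p)

variable [MeasurableSpace M]

/-- The Sobolev space `H¹(M)`: square integrable functions (modulo equality almost everywhere)
with a square integrable weak gradient. -/
def H1 (g : Metric I M) : Set (Lp ℝ 2 (vol g)) :=
  {u | (∃ X, HasWeakGrad g u X) ∧ Integrable (gradInner g u u) (vol g)}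

/-- The norm of `H¹(M)`: `‖u‖² = ∫ ⟨∇u, ∇u⟩ + u²`. -/
def h1Norm (g : Metric I M) (u : M → ℝ) : ℝ :=
  Real.sqrt (∫ p, (gradInner g u u p + u p ^ 2) ∂(vol g))

/-- The space `H¹₀(K)` of a subdomain `K` of `M`, its elements being extended by zero to `M`:
the closure in `H¹(M)` of the smooth functions with compact support in the manifold interior
of `K`, which consists of the points of the topological interior of `K` outside `∂M`.
In particular `H10 g univ` is `H¹₀(M)`. -/
def H10 (g : Metric I M) (K : Set M) : Set (Lp ℝ 2 (vol g)) :=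
  {u | u ∈ H1 g ∧ ∀ ε > (0 : ℝ), ∃ φ : M → ℝ, ContMDiff I 𝓘(ℝ, ℝ) ∞ φ ∧ HasCompactSupport φ ∧
    tsupport φ ⊆ interior K ∩ I.interior M ∧ h1Norm g (fun p => u p - φ p) < ε}

/-- `u` is a weak solution of `-Δu + bu = f`, `u = 0` on `∂M`. -/
def IsWeakSolution (g : Metric I M) (b : ℝ) (f u : Lp ℝ 2 (vol g)) : Prop :=
  u ∈ H10 g univ ∧ ∀ v ∈ H10 g univ,
    ∫ p, (gradInner g u v p + b * u p * v p) ∂(vol g) = ∫ p, f p * v p ∂(vol g)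

/-- The local problem on the subdomain `K`: `w ∈ H¹₀(M)` solves the equation weakly in `K` and
coincides with `w₀` on `M \ Int K`. -/
def IsLocalSolution (g : Metric I M) (b : ℝ) (f : Lp ℝ 2 (vol g)) (K : Set M)
    (w₀ w : Lp ℝ 2 (vol g)) : Prop :=
  w ∈ H10 g univ ∧
  (∀ v ∈ H10 g K,
    ∫ p in K, (gradInner g w v p + b * w p * v p) ∂(vol g) = ∫ p in K, f p * v p ∂(vol g)) ∧
  ∀ᵐ p ∂(vol g), p ∈ (interior K)ᶜ → w p = w₀ p

/-- One sweep `u^{n-1} = u^{n,0}, u^{n,1}, …, u^{n,m} = u^n` through the subdomains. -/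
def IsSweep (g : Metric I M) (b : ℝ) (f : Lp ℝ 2 (vol g)) {m : ℕ} (K : Fin m → Set M)
    (x y : Lp ℝ 2 (vol g)) : Prop :=
  ∃ w : Fin (m + 1) → Lp ℝ 2 (vol g), w 0 = x ∧
    (∀ i : Fin m, IsLocalSolution g b f (K i) (w i.castSucc) (w i.succ)) ∧ w (Fin.last m) = y

/-- `U 0, U 1, …` are the iterates of the multiplicative Schwarz method with
initial guess `u₀`. -/
def IsSchwarzIteration (g : Metric I M) (b : ℝ) (f : Lp ℝ 2 (vol g)) {m : ℕ}
    (K : Fin m → Set M) (u₀ : Lp ℝ 2 (vol g)) (U : ℕ → Lp ℝ 2 (vol g)) : Prop :=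
  U 0 = u₀ ∧ ∀ n, IsSweep g b f K (U n) (U (n + 1))

end Riemannian

section Lipschitz

variable {d : ℕ} {H : Type*} [TopologicalSpace H]
  (I : ModelWithCorners ℝ (EuclideanSpace ℝ (Fin d)) H)
  {M : Type*} [TopologicalSpace M] [ChartedSpace H M]

/-- `K` is a closed subdomain of `M` (of codimension zero) with Lipschitz boundary: near each
of its boundary points, in some smooth chart, `K` is the region above the graph of a Lipschitz
function `γ` of the variables orthogonal to a unit vector `ν`. The region is taken in `ℝ^d`
also at points of `∂M`, so that there `K` has a Lipschitz boundary as a subset of an extension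
of `M` across `∂M`. (At points of `∂M` in the interior of `K` nothing is to be required, since
there `K` coincides with `M`.) -/
def IsClosedLipschitzSubdomain (K : Set M) : Prop :=
  IsClosed K ∧ ∀ p ∈ frontier K, ∃ e ∈ IsManifold.maximalAtlas I ∞ M, p ∈ e.source ∧
    ∃ U ∈ 𝓝 (e.extend I p), ∃ ν : EuclideanSpace ℝ (Fin d), ‖ν‖ = 1 ∧
      ∃ (C : NNReal) (γ : EuclideanSpace ℝ (Fin d) → ℝ), LipschitzWith C γ ∧
        (e.extend I) '' (e.source ∩ K) ∩ U =
          {x | γ (x - inner ℝ ν x • ν) ≤ inner ℝ ν x} ∩ U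

end Lipschitz

end SchwarzManifold

end

/-! Put a(u, v) = ∫ ⟨∇u, ∇v⟩ + b u v. This form is bounded on H¹₀(M), and it is coercive there: for
b > 0 by inspection, and if ∂M is nonempty by the Poincaré inequality (`exists_poincare`). The
theorem of Lax and Milgram then solves the global problem and, on the closed subspaces H¹₀(M_i), the
local ones.

The iteration is a product of projections. A local step on M_i changes the error e = u - u^{n,i-1}
by an element of H¹₀(M_i) and makes it a-orthogonal to that space, so it projects e onto the
a-orthogonal complement of H¹₀(M_i). For this one has to know that agreement of two elements of
H¹₀(M) outside Int M_i means that their difference lies in H¹₀(M_i). Here the Lipschitz boundary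
enters (`mem_pairH10_of_ae_eq_zero`): near a boundary point small translations push M_i into its
interior, and they turn functions vanishing outside M_i into limits of test functions.

Because the interiors cover M, a smooth partition of unity splits e into pieces χ_i e in H¹₀(M_i)
with a(χ_i e, χ_i e) ≤ C a(e, e) (`exists_stable_decomposition`). If a sweep lost little energy, all
its corrections would be small, e would be almost orthogonal to every H¹₀(M_i), hence almost
orthogonal to the sum of its own pieces, which is e. In quantitative form
(`form_last_le_of_decomposition`) each sweep multiplies a(e, e) by at most some ρ < 1. Equivalence
of norms gives the estimate with L = √ρ.

The Sobolev space is realized as a closed subspace (`weakGraph`) of the Hilbert space of pairs (u,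
X) with u and X square integrable. The tangent spaces are identified with the model space by a chart
that jumps from point to point, so X is written in a measurable frame made of coordinate frames
(`AdaptedFrame`). The Poincaré inequality is obtained by spreading L² bounds from the boundary
through coordinate balls, using connectedness. -/

noncomputable section

namespace SchwarzManifold

set_option linter.unusedSectionVars false

/-! ### Coordinate frames and their behaviour under change of charts -/

section ChartFrames

variable {d : ℕ} {H : Type*} [TopologicalSpace H]
  {I : ModelWithCorners ℝ (EuclideanSpace ℝ (Fin d)) H}
  {M : Type*} [TopologicalSpace M] [ChartedSpace H M] [IsManifold I ∞ M]
  {e e' : OpenPartialHomeomorph M H}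

local notation "𝔼" => EuclideanSpace ℝ (Fin d)

/-- The metric at `p` as a bilinear form on the model space. -/
def metricAt (g : Metric I M) (p : M) : 𝔼 →L[ℝ] 𝔼 →L[ℝ] ℝ := g.inner p

variable (I) in
/-- The differential of the inverse of the chart `e`. -/
def chartDeriv (e : OpenPartialHomeomorph M H) (y : 𝔼) : 𝔼 →L[ℝ] 𝔼 :=
  mfderivWithin 𝓘(ℝ, 𝔼) I (e.extend I).symm (range I) y

theorem metricAt_comm (g : Metric I M) (p : M) (v w : 𝔼) :
    metricAt g p v w = metricAt g p w v := g.symm p v w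

theorem metricAt_self_pos (g : Metric I M) (p : M) {v : 𝔼} (hv : v ≠ 0) :
    0 < metricAt g p v v := g.pos p v hv

theorem metricAt_self_nonneg (g : Metric I M) (p : M) (v : 𝔼) :
    0 ≤ metricAt g p v v := by
  rcases eq_or_ne v 0 with rfl | hv
  · simp
  · exact (metricAt_self_pos g p hv).le

theorem mdifferentiableWithinAt_extend_symm (he : e ∈ IsManifold.maximalAtlas I ∞ M) {y : 𝔼}
    (hy : y ∈ (e.extend I).target) :
    MDifferentiableWithinAt 𝓘(ℝ, 𝔼) I (e.extend I).symm (range I) y := by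
  have h := (contMDiffOn_extend_symm he) y (by rwa [← e.extend_target'])
  have h2 := h.mdifferentiableWithinAt (by simp)
  refine h2.mono_of_mem_nhdsWithin ?_
  rw [← e.extend_target']
  have := e.extend_target_mem_nhdsWithin (I := I) (y := (e.extend I).symm y)
    (by simpa using (e.extend I).map_target hy)
  rwa [(e.extend I).right_inv hy] at this

theorem extend_target_mem_nhdsWithin_of_mem {y : 𝔼}
    (hy : y ∈ (e.extend I).target) : (e.extend I).target ∈ 𝓝[range I] y := by
  have := e.extend_target_mem_nhdsWithin (I := I) (y := (e.extend I).symm y)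
    (by simpa using (e.extend I).map_target hy)
  rwa [(e.extend I).right_inv hy] at this

theorem uniqueDiffOn_extend_target : UniqueDiffOn ℝ (e.extend I).target := by
  rw [e.extend_target]
  rw [inter_comm]
  intro y hy
  have := (I.uniqueDiffOn y hy.1)
  refine this.mono_nhds ?_
  have h2 := extend_target_mem_nhdsWithin_of_mem (I := I) (e := e) (y := y)
    (by rw [e.extend_target]; exact hy.symm)
  rw [e.extend_target, inter_comm] at h2
  exact nhdsWithin_le_of_mem h2

/-- Both sets have unique derivatives at `y`, and the target lies in `range I`. Chain rules are
applied within the target, whereas `coordVector` differentiates within `range I`. -/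
theorem chartDeriv_eq_target (he : e ∈ IsManifold.maximalAtlas I ∞ M) {y : 𝔼}
    (hy : y ∈ (e.extend I).target) :
    chartDeriv I e y = mfderivWithin 𝓘(ℝ, 𝔼) I (e.extend I).symm (e.extend I).target y := by
  refine (MDifferentiableWithinAt.mfderivWithin_mono
    (mdifferentiableWithinAt_extend_symm he hy) ?_ e.extend_target_subset_range).symm
  exact (uniqueDiffOn_extend_target y hy).uniqueMDiffWithinAt

/-- Change of charts for `chartDeriv`. -/
theorem chartDeriv_comp (he : e ∈ IsManifold.maximalAtlas I ∞ M)
    (he' : e' ∈ IsManifold.maximalAtlas I ∞ M) {p : M} (hp : p ∈ e.source) (hp' : p ∈ e'.source) :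
    chartDeriv I e (e.extend I p) = (chartDeriv I e' (e'.extend I p)).comp
      (fderivWithin ℝ (I.extendCoordChange e e') (I.extendCoordChange e e').source
        (e.extend I p)) := by
  have hps : e.extend I p ∈ (I.extendCoordChange e e').source := by
    rw [← OpenPartialHomeomorph.extend_image_source_inter]
    exact mem_image_of_mem _ ⟨hp, hp'⟩
  have hsub : (I.extendCoordChange e e').source ⊆ (e.extend I).target := by
    intro z hz; exact hz.1
  have hu := (I.uniqueDiffOn_extendCoordChange_source (e := e) (e' := e') _ hps)
  have hy : e.extend I p ∈ (e.extend I).target := hsub hps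
  have e1 : chartDeriv I e (e.extend I p) = mfderivWithin 𝓘(ℝ, 𝔼) I (e.extend I).symm
      (I.extendCoordChange e e').source (e.extend I p) :=
    (MDifferentiableWithinAt.mfderivWithin_mono
      (mdifferentiableWithinAt_extend_symm he hy) hu.uniqueMDiffWithinAt
      (hsub.trans e.extend_target_subset_range)).symm
  have hτp : I.extendCoordChange e e' (e.extend I p) = e'.extend I p := by
    simp [ModelWithCorners.extendCoordChange, hp]
  have hτd : DifferentiableWithinAt ℝ (I.extendCoordChange e e')
      (I.extendCoordChange e e').source (e.extend I p) :=
    ((I.contDiffOn_extendCoordChange he he') _ hps).differentiableWithinAt (by simp)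
  -- On the overlap the inverse of `e` is the inverse of `e'` after the transition map, so the claim
  -- is the chain rule. At boundary points the overlap is not open in the model space, hence
  -- derivatives within it.
  have e2 : mfderivWithin 𝓘(ℝ, 𝔼) I (e.extend I).symm
      (I.extendCoordChange e e').source (e.extend I p) =
      mfderivWithin 𝓘(ℝ, 𝔼) I ((e'.extend I).symm ∘ I.extendCoordChange e e')
      (I.extendCoordChange e e').source (e.extend I p) := by
    refine mfderivWithin_congr_of_mem (fun z hz => ?_) hps
    have hz2 : (e.extend I).symm z ∈ (e'.extend I).source := hz.2
    simp only [ModelWithCorners.extendCoordChange, Function.comp_apply, PartialEquiv.coe_trans]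
    rw [(e'.extend I).left_inv hz2]
  have hy' : e'.extend I p ∈ (e'.extend I).target :=
    (e'.extend I).map_source (by simpa using hp')
  have e3 := mfderivWithin_comp_of_eq (x := e.extend I p) (y := e'.extend I p)
    (s := (I.extendCoordChange e e').source) (u := range I)
    (f := I.extendCoordChange e e')
    (mdifferentiableWithinAt_extend_symm he' hy')
    hτd.mdifferentiableWithinAt
    (fun z hz => e'.extend_target_subset_range ((I.extendCoordChange e e').map_source hz).1)
    hu.uniqueMDiffWithinAt hτp
  rw [e1, e2]
  refine e3.trans ?_
  rw [mfderivWithin_eq_fderivWithin]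
  rfl

/-- The differential of the chart is a left inverse of the differential of its inverse. -/
theorem mfderiv_extend_comp_chartDeriv (he : e ∈ IsManifold.maximalAtlas I ∞ M) {y : 𝔼}
    (hy : y ∈ (e.extend I).target) :
    ∃ A : 𝔼 →L[ℝ] 𝔼, A.comp (chartDeriv I e y) = ContinuousLinearMap.id ℝ 𝔼 := by
  have hp : (e.extend I).symm y ∈ e.source := by simpa using (e.extend I).map_target hy
  have hd : MDifferentiableAt I 𝓘(ℝ, 𝔼) (e.extend I) ((e.extend I).symm y) :=
    (e.contMDiffAt_extend he hp).mdifferentiableAt (by simp)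
  have hs := (mdifferentiableWithinAt_extend_symm he hy).mono e.extend_target_subset_range
  have hu : UniqueMDiffWithinAt 𝓘(ℝ, 𝔼) (e.extend I).target y :=
    (uniqueDiffOn_extend_target y hy).uniqueMDiffWithinAt
  have h1 := mfderiv_comp_mfderivWithin (I' := I) (I'' := 𝓘(ℝ, 𝔼)) y hd hs hu
  refine ⟨mfderiv I 𝓘(ℝ, 𝔼) (e.extend I) ((e.extend I).symm y), ?_⟩
  rw [chartDeriv_eq_target he hy]
  refine Eq.trans h1.symm ?_
  have : mfderivWithin 𝓘(ℝ, 𝔼) 𝓘(ℝ, 𝔼) ((e.extend I) ∘ (e.extend I).symm)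
      (e.extend I).target y = mfderivWithin 𝓘(ℝ, 𝔼) 𝓘(ℝ, 𝔼) id (e.extend I).target y :=
    mfderivWithin_congr_of_mem (fun z hz => (e.extend I).right_inv hz) hy
  rw [this]
  exact mfderivWithin_id hu

theorem chartDeriv_injective (he : e ∈ IsManifold.maximalAtlas I ∞ M) {y : 𝔼}
    (hy : y ∈ (e.extend I).target) : Function.Injective (chartDeriv I e y) := by
  obtain ⟨A, hA⟩ := mfderiv_extend_comp_chartDeriv he hy
  intro v w hvw
  have := congrArg A hvw
  have h2 := fun v => congrArg (fun B : 𝔼 →L[ℝ] 𝔼 => B v) hA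
  simp only [ContinuousLinearMap.comp_apply, ContinuousLinearMap.id_apply] at h2
  rwa [h2, h2] at this

variable (I) in
/-- The coordinate frame of the chart `e` at the point `p`. -/
def chartFrame (e : OpenPartialHomeomorph M H) (p : M) : 𝔼 →L[ℝ] 𝔼 :=
  chartDeriv I e (e.extend I p)

theorem chartFrame_injective (he : e ∈ IsManifold.maximalAtlas I ∞ M) {p : M}
    (hp : p ∈ e.source) : Function.Injective (chartFrame I e p) :=
  chartDeriv_injective he ((e.extend I).map_source (by simpa using hp))

/-- The tangent map of the inverse chart, applied to the constant field `v` at the coordinates of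
`p`. Only continuity (order `0`) is needed. -/
theorem contMDiffOn_chartFrame (he : e ∈ IsManifold.maximalAtlas I ∞ M) (v : 𝔼) :
    ContMDiffOn I I.tangent 0 (fun p => (⟨p, chartFrame I e p v⟩ : TangentBundle I M))
      e.source := by
  have h1 : ContMDiffOn 𝓘(ℝ, 𝔼) I ∞ (e.extend I).symm (e.extend I).target := by
    have := contMDiffOn_extend_symm he
    rwa [← e.extend_target'] at this
  have h2 := h1.contMDiffOn_tangentMapWithin (m := 0) (by simp)
    (uniqueDiffOn_extend_target (I := I) (e := e)).uniqueMDiffOn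
  have h3 : ContMDiff 𝓘(ℝ, 𝔼) 𝓘(ℝ, 𝔼).tangent 0
      (fun y : 𝔼 => (⟨y, v⟩ : TangentBundle 𝓘(ℝ, 𝔼) 𝔼)) := by
    rw [← contMDiffOn_univ]
    exact (contMDiffOn_vectorSpace_iff_contDiffOn (V := fun _ : 𝔼 => v)).2 contDiffOn_const
  have h4 := h2.comp (h3.comp_contMDiffOn ((e.contMDiffOn_extend he).of_le zero_le))
    (fun p hp => (e.extend I).map_source (by simpa using hp))
  refine h4.congr fun p hp => ?_
  have hp' : p ∈ (e.extend I).source := by simpa using hp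
  -- The base points agree only propositionally; all tangent spaces are the same model space, so the
  -- vector is carried over unchanged.
  have key : ∀ (q : M) (w : 𝔼), q = p → (⟨p, w⟩ : TangentBundle I M) = ⟨q, w⟩ := by
    rintro q w rfl; rfl
  have hy := (e.extend I).map_source hp'
  rw [chartFrame, chartDeriv_eq_target he hy]
  exact key _ _ ((e.extend I).left_inv hp')

/-- The metric is a continuous section of bilinear forms, evaluated on continuous sections. For
fixed model vectors `metricAt g p v w` itself need not be continuous in `p`, which is why continuity
is always expressed through frames. -/
theorem continuousOn_metricAt_chartFrame (g : Metric I M)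
    (he : e ∈ IsManifold.maximalAtlas I ∞ M)
    (he' : e' ∈ IsManifold.maximalAtlas I ∞ M) (v w : 𝔼) :
    ContinuousOn (fun p => metricAt g p (chartFrame I e p v) (chartFrame I e' p w))
      (e.source ∩ e'.source) := by
  intro p hp
  have h1 := ((contMDiffOn_chartFrame he v).mono inter_subset_left) p hp
  have h2 := ((contMDiffOn_chartFrame he' w).mono inter_subset_right) p hp
  have hg : ContMDiffWithinAt I (I.prod 𝓘(ℝ, 𝔼 →L[ℝ] 𝔼 →L[ℝ] ℝ)) 0
    (fun b : M => Bundle.TotalSpace.mk' (𝔼 →L[ℝ] 𝔼 →L[ℝ] ℝ)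
      (E := fun x : M => (TangentSpace I x →L[ℝ] TangentSpace I x →L[ℝ] ℝ)) b (g.inner b))
      (e.source ∩ e'.source) p := ((g.contMDiff.of_le zero_le).contMDiffAt).contMDiffWithinAt
  have := ContMDiffWithinAt.clm_bundle_apply₂ (F₁ := 𝔼) (F₂ := 𝔼) (F₃ := ℝ)
    (E₁ := fun p : M => TangentSpace I p) (E₂ := fun p : M => TangentSpace I p)
    (E₃ := Bundle.Trivial M ℝ) (b := fun x => x)
    (v := fun p => chartFrame I e p v) (w := fun p => chartFrame I e' p w)
    (ψ := fun p => g.inner p) hg h1 h2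
  simp only [Bundle.contMDiffWithinAt_totalSpace] at this
  exact this.2.continuousWithinAt

end ChartFrames

end SchwarzManifold
end

/-! ### Gradients, interior points and the volume density in charts -/

noncomputable section

namespace SchwarzManifold

set_option linter.unusedSectionVars false

section ChartCalculus

variable {d : ℕ} {H : Type*} [TopologicalSpace H]
  {I : ModelWithCorners ℝ (EuclideanSpace ℝ (Fin d)) H}
  {M : Type*} [TopologicalSpace M] [ChartedSpace H M] [IsManifold I ∞ M]
  {e e' : OpenPartialHomeomorph M H}

local notation "𝔼" => EuclideanSpace ℝ (Fin d)

theorem metricAt_injective (g : Metric I M) (p : M) :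
    Function.Injective (metricAt g p) := by
  intro v w h
  by_contra hne
  have h1 := metricAt_self_pos g p (sub_ne_zero.2 hne)
  have h2 : metricAt g p (v - w) = 0 := by rw [map_sub, h, sub_self]
  rw [h2] at h1
  simp at h1

/-- The Riesz isomorphism of the tangent space at `p`. -/
def rieszEquiv (g : Metric I M) (p : M) : 𝔼 ≃ₗ[ℝ] (𝔼 →L[ℝ] ℝ) :=
  LinearEquiv.ofInjectiveOfFinrankEq (metricAt g p).toLinearMap (metricAt_injective g p) (by
    rw [← (LinearMap.toContinuousLinearMap (𝕜 := ℝ) (E := 𝔼) (F' := ℝ)).finrank_eq]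
    exact (Subspace.dual_finrank_eq (K := ℝ) (V := 𝔼)).symm)

theorem metricAt_rieszEquiv_symm (g : Metric I M) (p : M) (l : 𝔼 →L[ℝ] ℝ) (v : 𝔼) :
    metricAt g p ((rieszEquiv g p).symm l) v = l v := by
  have : rieszEquiv g p ((rieszEquiv g p).symm l) = l := (rieszEquiv g p).apply_symm_apply l
  exact congrArg (fun m : 𝔼 →L[ℝ] ℝ => m v) this

/-- The differential of a function, read in the model space. -/
def differential (I : ModelWithCorners ℝ 𝔼 H) [IsManifold I ∞ M] (φ : M → ℝ) (p : M) : 𝔼 →L[ℝ] ℝ :=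
  mfderiv I 𝓘(ℝ, ℝ) φ p

/-- The classical gradient. -/
def classicalGrad (g : Metric I M) (φ : M → ℝ) (p : M) : 𝔼 :=
  (rieszEquiv g p).symm (differential I φ p)

theorem metricAt_classicalGrad (g : Metric I M) (φ : M → ℝ) (p : M) (v : 𝔼) :
    metricAt g p (classicalGrad g φ p) v = differential I φ p v :=
  metricAt_rieszEquiv_symm g p _ v

theorem contDiffOn_comp_extend_symm (he : e ∈ IsManifold.maximalAtlas I ∞ M) {φ : M → ℝ}
    (hφ : ContMDiff I 𝓘(ℝ, ℝ) ∞ φ) :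
    ContDiffOn ℝ ∞ (fun y => φ ((e.extend I).symm y)) (e.extend I).target := by
  have h1 : ContMDiffOn 𝓘(ℝ, 𝔼) I ∞ (e.extend I).symm (e.extend I).target := by
    have := contMDiffOn_extend_symm he
    rwa [← e.extend_target'] at this
  exact (hφ.comp_contMDiffOn h1).contDiffOn

theorem differential_chartFrame (he : e ∈ IsManifold.maximalAtlas I ∞ M) {φ : M → ℝ}
    (hφ : ContMDiff I 𝓘(ℝ, ℝ) ∞ φ) {y : 𝔼} (hy : y ∈ interior (e.extend I).target) (v : 𝔼) :
    differential I φ ((e.extend I).symm y) (chartDeriv I e y v) =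
      fderiv ℝ (fun y => φ ((e.extend I).symm y)) y v := by
  have hyt := interior_subset hy
  have hu : UniqueMDiffWithinAt 𝓘(ℝ, 𝔼) (e.extend I).target y :=
    (uniqueDiffOn_extend_target y hyt).uniqueMDiffWithinAt
  have h1 := mfderiv_comp_mfderivWithin (I' := I) (I'' := 𝓘(ℝ, ℝ)) y
    (hφ.mdifferentiableAt (by simp))
    ((mdifferentiableWithinAt_extend_symm he hyt).mono e.extend_target_subset_range) hu
  rw [chartDeriv_eq_target he hyt]
  have h2 := congrArg (fun A : 𝔼 →L[ℝ] ℝ => A v) h1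
  refine h2.symm.trans ?_
  rw [mfderivWithin_eq_fderivWithin, fderivWithin_of_mem_nhds (mem_interior_iff_mem_nhds.1 hy)]
  rfl

/-- Interior points are mapped to interior points by all charts of the maximal atlas. -/
theorem mem_interior_target_of_mem_maximalAtlas (he : e ∈ IsManifold.maximalAtlas I ∞ M)
    (he' : e' ∈ IsManifold.maximalAtlas I ∞ M) {x : M} (hex : x ∈ e.source) (hex' : x ∈ e'.source)
    (hx : e.extend I x ∈ interior (e.extend I).target) :
    e'.extend I x ∈ interior (e'.extend I).target := by
  let φ := I.extendCoordChange e e'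
  have hφ : ContDiffOn ℝ ∞ φ φ.source := I.contDiffOn_extendCoordChange he he'
  have hsurj : Function.Surjective (fderivWithin ℝ φ φ.source (e.extend I x)) :=
    (I.isInvertible_fderivWithin_extendCoordChange (by simp) he he' <| by simp [hex, hex']).surjective
  suffices h : e'.extend I x ∈ interior (range I) from
    e'.mem_interior_extend_target (y := e' x) (e'.map_source hex') h
  have hφx : φ.source ∈ 𝓝 (e.extend I x) := by
    simp_rw [φ, ModelWithCorners.extendCoordChange, PartialEquiv.trans_source,
      PartialEquiv.symm_source,
      Filter.inter_mem_iff, mem_interior_iff_mem_nhds.1 hx, true_and, e'.extend_source]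
    exact e.extend_preimage_mem_nhds hex <| e'.open_source.mem_nhds hex'
  rw [fderivWithin_of_mem_nhds hφx] at hsurj
  rw [show e'.extend I x = φ (e.extend I x) by simp [φ, hex]]
  replace hφ := (hφ.differentiableOn (by simp)).differentiableAt hφx
  -- If the image were a boundary point of the convex set `range I`, a supporting functional
  -- composed with the transition map would have an extremum there with nonzero derivative.
  exact hφ.mem_interior_convex_of_surjective_fderiv hφx I.convex_range I.isClosed_range
    I.nonempty_interior (φ.mapsTo.mono_right <| by simp [φ, inter_assoc]) hsurj

theorem mem_interior_iff_of_mem_maximalAtlas (he : e ∈ IsManifold.maximalAtlas I ∞ M) {x : M}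
    (hx : x ∈ e.source) : x ∈ I.interior M ↔ e.extend I x ∈ interior (e.extend I).target := by
  have h0 := chart_mem_atlas H x
  have h1 : x ∈ I.interior M ↔ _ :=
    I.isInteriorPoint_iff_of_mem_atlas (n := ∞) (by simp) h0 (mem_chart_source H x)
  rw [h1]
  have h2 := IsManifold.subset_maximalAtlas (I := I) (n := ∞) h0
  exact ⟨mem_interior_target_of_mem_maximalAtlas h2 he (mem_chart_source H x) hx,
    mem_interior_target_of_mem_maximalAtlas he h2 hx (mem_chart_source H x)⟩

/-- The metric, pulled back to the target of the chart. -/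
def metricForm (g : Metric I M) (e : OpenPartialHomeomorph M H) (y : 𝔼) :
    LinearMap.BilinForm ℝ 𝔼 :=
  LinearMap.mk₂ ℝ
    (fun v w => metricAt g ((e.extend I).symm y) (chartDeriv I e y v) (chartDeriv I e y w))
    (by simp) (by simp) (by simp) (by simp)

theorem metricForm_apply (g : Metric I M) (e : OpenPartialHomeomorph M H) (y v w : 𝔼) :
    metricForm g e y v w =
      metricAt g ((e.extend I).symm y) (chartDeriv I e y v) (chartDeriv I e y w) := rfl

theorem metricMatrix_eq (g : Metric I M) (e : OpenPartialHomeomorph M H) (y : 𝔼) :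
    metricMatrix g e y = LinearMap.BilinForm.toMatrix (EuclideanSpace.basisFun (Fin d) ℝ).toBasis
      (metricForm g e y) := by
  ext α β
  refine Eq.trans ?_ (LinearMap.BilinForm.toMatrix_apply _ _ α β).symm
  simp only [OrthonormalBasis.coe_toBasis, EuclideanSpace.basisFun_apply]
  rfl

theorem metricForm_self_pos (g : Metric I M) (he : e ∈ IsManifold.maximalAtlas I ∞ M) {y : 𝔼}
    (hy : y ∈ (e.extend I).target) {v : 𝔼} (hv : v ≠ 0) : 0 < metricForm g e y v v := by
  refine metricAt_self_pos g _ fun h => hv ?_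
  exact chartDeriv_injective he hy (by simpa using h)

theorem metricMatrix_posDef (g : Metric I M) (he : e ∈ IsManifold.maximalAtlas I ∞ M) {y : 𝔼}
    (hy : y ∈ (e.extend I).target) : (metricMatrix g e y).PosDef := by
  rw [Matrix.posDef_iff_dotProduct_mulVec]
  refine ⟨?_, fun x hx => ?_⟩
  · ext α β
    exact g.symm _ _ _
  · have h := metricForm_self_pos g he hy (v := WithLp.toLp 2 x) (fun h => hx (by
      simpa using congrArg (WithLp.ofLp) h))
    rw [metricMatrix_eq]
    have h3 := LinearMap.BilinForm.apply_eq_dotProduct_toMatrix_mulVec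
      (EuclideanSpace.basisFun (Fin d) ℝ).toBasis (metricForm g e y) (WithLp.toLp 2 x)
        (WithLp.toLp 2 x)
    rw [h3] at h
    exact h

theorem continuousOn_metricForm (g : Metric I M) (he : e ∈ IsManifold.maximalAtlas I ∞ M)
    (v w : 𝔼) : ContinuousOn (fun y => metricForm g e y v w) (e.extend I).target := by
  have h := (continuousOn_metricAt_chartFrame g he he v w).comp e.continuousOn_extend_symm
    (fun y hy => by
      have := (e.extend I).map_target hy
      rw [e.extend_source] at this
      exact ⟨this, this⟩)
  refine h.congr fun y hy => ?_
  simp only [Function.comp_apply, chartFrame, (e.extend I).right_inv hy, metricForm_apply]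

theorem metricForm_comp (g : Metric I M) (he : e ∈ IsManifold.maximalAtlas I ∞ M)
    (he' : e' ∈ IsManifold.maximalAtlas I ∞ M) {p : M} (hp : p ∈ e.source) (hp' : p ∈ e'.source) :
    metricForm g e (e.extend I p) = (metricForm g e' (e'.extend I p)).comp
      (fderivWithin ℝ (I.extendCoordChange e e') (I.extendCoordChange e e').source
        (e.extend I p)).toLinearMap
      (fderivWithin ℝ (I.extendCoordChange e e') (I.extendCoordChange e e').source
        (e.extend I p)).toLinearMap := by
  ext v w
  rw [metricForm_apply, LinearMap.BilinForm.comp_apply, metricForm_apply,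
    e.extend_left_inv hp, e'.extend_left_inv hp', chartDeriv_comp he he' hp hp']
  rfl

/-- The density of the Riemannian volume in the chart `e`. -/
def chartDensity (g : Metric I M) (e : OpenPartialHomeomorph M H) (y : 𝔼) : ℝ :=
  Real.sqrt (metricMatrix g e y).det

theorem chartDensity_pos (g : Metric I M) (he : e ∈ IsManifold.maximalAtlas I ∞ M) {y : 𝔼}
    (hy : y ∈ (e.extend I).target) : 0 < chartDensity g e y :=
  Real.sqrt_pos.2 (metricMatrix_posDef g he hy).det_pos

theorem continuousOn_chartDensity (g : Metric I M) (he : e ∈ IsManifold.maximalAtlas I ∞ M) :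
    ContinuousOn (chartDensity g e) (e.extend I).target := by
  refine Real.continuous_sqrt.comp_continuousOn ?_
  refine Continuous.comp_continuousOn (g := Matrix.det) (by fun_prop) ?_
  refine continuousOn_pi.2 fun α => continuousOn_pi.2 fun β => ?_
  exact continuousOn_metricForm g he _ _

/-- Gram matrices transform as Jᵀ G J, so their determinants differ by (det J)², and the square root
leaves the Jacobian factor |det J| of the change of variables formula. -/
theorem chartDensity_comp (g : Metric I M) (he : e ∈ IsManifold.maximalAtlas I ∞ M)
    (he' : e' ∈ IsManifold.maximalAtlas I ∞ M) {p : M} (hp : p ∈ e.source) (hp' : p ∈ e'.source) :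
    chartDensity g e (e.extend I p) = |(fderivWithin ℝ (I.extendCoordChange e e')
      (I.extendCoordChange e e').source (e.extend I p)).det| *
        chartDensity g e' (e'.extend I p) := by
  rw [chartDensity, chartDensity, metricMatrix_eq, metricMatrix_eq, metricForm_comp g he he' hp hp',
    LinearMap.BilinForm.toMatrix_comp (EuclideanSpace.basisFun (Fin d) ℝ).toBasis
      (EuclideanSpace.basisFun (Fin d) ℝ).toBasis, Matrix.det_mul, Matrix.det_mul,
    Matrix.det_transpose, LinearMap.det_toMatrix, mul_right_comm, Real.sqrt_mul (mul_self_nonneg _),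
    Real.sqrt_mul_self_eq_abs]

end ChartCalculus

end SchwarzManifold
end

/-! ### The Riemannian volume in charts -/

noncomputable section

namespace SchwarzManifold

set_option linter.unusedSectionVars false

theorem _root_.ContinuousOn.measurableSet_inter_preimage {α β : Type*} [TopologicalSpace α]
    [MeasurableSpace α] [OpensMeasurableSpace α] [TopologicalSpace β] [MeasurableSpace β]
    [BorelSpace β] {f : α → β} {s : Set α} (hf : ContinuousOn f s) (hs : MeasurableSet s)
    {t : Set β} (ht : MeasurableSet t) : MeasurableSet (s ∩ f ⁻¹' t) := by
  have h1 : Measurable (s.domRestrict f) := (continuousOn_iff_continuous_domRestrict.1 hf).measurable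
  have h2 := (MeasurableEmbedding.subtype_coe hs).measurableSet_image.2 (h1 ht)
  convert h2 using 1
  ext x
  simp only [mem_inter_iff, mem_preimage, mem_image, Subtype.exists, Set.domRestrict_apply]
  constructor
  · rintro ⟨hx, hx'⟩
    exact ⟨x, hx, hx', rfl⟩
  · rintro ⟨y, hy, hy', rfl⟩
    exact ⟨hy, hy'⟩

section ChartMeasure

variable {d : ℕ} {H : Type*} [TopologicalSpace H]
  {I : ModelWithCorners ℝ (EuclideanSpace ℝ (Fin d)) H}
  {M : Type*} [TopologicalSpace M] [ChartedSpace H M] [IsManifold I ∞ M]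
  [MeasurableSpace M] [BorelSpace M]
  {e e' : OpenPartialHomeomorph M H}

local notation "𝔼" => EuclideanSpace ℝ (Fin d)

theorem measurableSet_extend_target : MeasurableSet (e.extend I).target := by
  rw [e.extend_target, inter_comm]
  exact I.isClosed_range.measurableSet.inter
    (e.open_target.preimage I.continuous_symm).measurableSet

theorem measurableSet_source : MeasurableSet e.source := e.open_source.measurableSet

theorem aemeasurable_extend_symm (μ : Measure 𝔼) :
    AEMeasurable (e.extend I).symm (μ.restrict (e.extend I).target) :=
  e.continuousOn_extend_symm.aemeasurable measurableSet_extend_target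

theorem measurableSet_target_inter {A : Set M} (hA : MeasurableSet A) :
    MeasurableSet ((e.extend I).target ∩ (e.extend I).symm ⁻¹' A) :=
  e.continuousOn_extend_symm.measurableSet_inter_preimage measurableSet_extend_target hA

/-- The volume in the target of the chart `e`. -/
def chartWeight (g : Metric I M) (e : OpenPartialHomeomorph M H) : Measure 𝔼 :=
  ((volume : Measure 𝔼).restrict (e.extend I).target).withDensity
    fun y => ENNReal.ofReal (chartDensity g e y)

theorem chartVolume_eq (g : Metric I M) :
    chartVolume g e = (chartWeight g e).map (e.extend I).symm := rfl

theorem aemeasurable_extend_symm_chartWeight (g : Metric I M) :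
    AEMeasurable (e.extend I).symm (chartWeight g e) :=
  (aemeasurable_extend_symm volume).mono_ac (withDensity_absolutelyContinuous _ _)

theorem aemeasurable_chartDensity (g : Metric I M) (he : e ∈ IsManifold.maximalAtlas I ∞ M) :
    AEMeasurable (fun y => ENNReal.ofReal (chartDensity g e y))
      ((volume : Measure 𝔼).restrict (e.extend I).target) :=
  ((continuousOn_chartDensity g he).aemeasurable measurableSet_extend_target).ennreal_ofReal

theorem chartVolume_apply (g : Metric I M) {A : Set M} (hA : MeasurableSet A) :
    chartVolume g e A = ∫⁻ y in (e.extend I).target ∩ (e.extend I).symm ⁻¹' A,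
      ENNReal.ofReal (chartDensity g e y) := by
  have hT : MeasurableSet (e.extend I).target := measurableSet_extend_target
  rw [chartVolume_eq, Measure.map_apply_of_aemeasurable (aemeasurable_extend_symm_chartWeight g) hA]
  have h1 : chartWeight g e ((e.extend I).symm ⁻¹' A) =
      chartWeight g e ((e.extend I).target ∩ (e.extend I).symm ⁻¹' A) := by
    refine (Measure.measure_inter_eq_of_ae ?_).symm
    refine (withDensity_absolutelyContinuous _ _).ae_le ?_
    exact ae_restrict_mem hT
  rw [h1, chartWeight, withDensity_apply _ (measurableSet_target_inter hA),
    Measure.restrict_restrict (measurableSet_target_inter hA)]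
  congr 2
  rw [inter_eq_left]
  exact inter_subset_left

theorem chartVolume_compl_source (g : Metric I M) : chartVolume g e e.sourceᶜ = 0 := by
  rw [chartVolume_apply g measurableSet_source.compl]
  have : (e.extend I).target ∩ (e.extend I).symm ⁻¹' e.sourceᶜ = ∅ := by
    ext y
    simp only [mem_inter_iff, mem_preimage, mem_compl_iff, mem_empty_iff_false, iff_false,
      not_and, not_not]
    intro hy
    simpa using (e.extend I).map_target hy
  rw [this, Measure.restrict_empty, lintegral_zero_measure]

/-- The chart measures agree on overlaps. -/
theorem chartVolume_overlap (g : Metric I M) (he : e ∈ IsManifold.maximalAtlas I ∞ M)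
    (he' : e' ∈ IsManifold.maximalAtlas I ∞ M) {A : Set M} (hA : MeasurableSet A)
    (hAs : A ⊆ e.source ∩ e'.source) : chartVolume g e A = chartVolume g e' A := by
  rw [chartVolume_apply g hA, chartVolume_apply g hA]
  have hS := measurableSet_target_inter (e := e) (I := I) hA
  set S := (e.extend I).target ∩ (e.extend I).symm ⁻¹' A
  set τ := I.extendCoordChange e e' with hτ
  have hSτ : S ⊆ τ.source := by
    rintro y ⟨hy, hyA⟩
    rw [hτ, ModelWithCorners.extendCoordChange, PartialEquiv.trans_source]
    refine ⟨hy, ?_⟩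
    simpa using (hAs hyA).2
  have himg : (e'.extend I).target ∩ (e'.extend I).symm ⁻¹' A = τ '' S := by
    ext z
    constructor
    · rintro ⟨hz, hzA⟩
      have hz1 := hAs hzA
      refine ⟨e.extend I ((e'.extend I).symm z), ⟨?_, ?_⟩, ?_⟩
      · exact (e.extend I).map_source (by simpa using hz1.1)
      · simp only [mem_preimage]
        rw [e.extend_left_inv hz1.1]
        exact hzA
      · change e'.extend I ((e.extend I).symm (e.extend I ((e'.extend I).symm z))) = z
        rw [e.extend_left_inv hz1.1, (e'.extend I).right_inv hz]
    · rintro ⟨y, ⟨hy, hyA⟩, rfl⟩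
      change e'.extend I ((e.extend I).symm y) ∈ _
      have hy1 := hAs hyA
      refine ⟨(e'.extend I).map_source (by simpa using hy1.2), ?_⟩
      simp only [mem_preimage]
      rw [e'.extend_left_inv hy1.2]
      exact hyA
  -- Change of variables for the injective transition map; its Jacobian is the factor by which the
  -- two densities differ.
  rw [himg, lintegral_image_eq_lintegral_abs_det_fderiv_mul volume hS (f' := fun y =>
    fderivWithin ℝ τ τ.source y) _ (τ.injOn.mono hSτ)]
  · refine setLIntegral_congr_fun hS fun y hy => ?_
    have hy1 := hAs hy.2
    have := chartDensity_comp g he he' hy1.1 hy1.2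
    rw [(e.extend I).right_inv hy.1] at this
    rw [this, ENNReal.ofReal_mul (abs_nonneg _)]
    rfl
  · intro y hy
    exact ((((I.contDiffOn_extendCoordChange he he') y (hSτ hy)).differentiableWithinAt
      (by simp)).hasFDerivWithinAt).mono hSτ

theorem chartVolume_restrict_overlap (g : Metric I M) (he : e ∈ IsManifold.maximalAtlas I ∞ M)
    (he' : e' ∈ IsManifold.maximalAtlas I ∞ M) :
    (chartVolume g e).restrict (e.source ∩ e'.source) =
      (chartVolume g e').restrict (e.source ∩ e'.source) := by
  have hm : MeasurableSet (e.source ∩ e'.source) := measurableSet_source.inter measurableSet_source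
  ext A hA
  rw [Measure.restrict_apply hA, Measure.restrict_apply hA]
  exact chartVolume_overlap g he he' (hA.inter hm) inter_subset_right

theorem chartVolume_restrict_source (g : Metric I M) :
    (chartVolume g e).restrict e.source = chartVolume g e := by
  refine Measure.restrict_eq_self_of_ae_mem ?_
  exact mem_ae_iff.2 (chartVolume_compl_source g)

theorem chartVolume_le_vol (g : Metric I M) (he : e ∈ atlas H M) : chartVolume g e ≤ vol g :=
  le_iSup₂_of_le e he le_rfl

/-- A supremum of measures could exceed each of them. Since the chart measures agree on overlaps,
`chartVolume g e` plus the part of `vol g` outside the chart dominates all of them, hence also `vol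
g`. -/
theorem vol_restrict_source_of_mem_atlas (g : Metric I M) (he : e ∈ atlas H M) :
    (vol g).restrict e.source = chartVolume g e := by
  have hem := IsManifold.subset_maximalAtlas (I := I) (n := ∞) he
  have hs : MeasurableSet e.source := measurableSet_source
  refine le_antisymm ?_ ?_
  · have h1 : vol g ≤ chartVolume g e + (vol g).restrict e.sourceᶜ := by
      refine iSup₂_le fun e' he' => ?_
      have hem' := IsManifold.subset_maximalAtlas (I := I) (n := ∞) he'
      rw [← Measure.restrict_add_restrict_compl (μ := chartVolume g e') hs]
      refine add_le_add ?_ (Measure.restrict_mono le_rfl (chartVolume_le_vol g he'))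
      have h2 : (chartVolume g e').restrict e.source =
          (chartVolume g e').restrict (e.source ∩ e'.source) := by
        conv_lhs => rw [← chartVolume_restrict_source g, Measure.restrict_restrict hs]
      rw [h2, ← chartVolume_restrict_overlap g hem hem']
      exact Measure.restrict_le_self
    refine (Measure.restrict_mono le_rfl h1).trans ?_
    rw [Measure.restrict_add, Measure.restrict_restrict hs, inter_compl_self,
      Measure.restrict_empty, add_zero]
    exact Measure.restrict_le_self
  · rw [← chartVolume_restrict_source g]
    exact Measure.restrict_mono le_rfl (chartVolume_le_vol g he)

/-- The supremum defining `vol` runs over the given atlas only, but Lipschitz subdomains use charts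
of the maximal atlas. Such a chart is cut into finitely many overlaps with charts of the atlas. -/
theorem vol_restrict_source [CompactSpace M] (g : Metric I M)
    (he : e ∈ IsManifold.maximalAtlas I ∞ M) :
    (vol g).restrict e.source = chartVolume g e := by
  obtain ⟨t, ht⟩ := isCompact_univ.elim_finite_subcover (fun x : M => (chartAt H x).source)
    (fun x => (chartAt H x).open_source) (fun x _ => mem_iUnion.2 ⟨x, mem_chart_source H x⟩)
  have hU : e.source = ⋃ x : t, e.source ∩ (chartAt H (x : M)).source := by
    rw [← inter_iUnion, eq_comm, inter_eq_left]
    intro x _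
    have := ht (mem_univ x)
    simpa using this
  rw [← chartVolume_restrict_source g, hU, Measure.restrict_iUnion_congr]
  intro x
  have hx := chart_mem_atlas H (x : M)
  rw [chartVolume_restrict_overlap g he (IsManifold.subset_maximalAtlas hx),
    ← vol_restrict_source_of_mem_atlas g hx, Measure.restrict_restrict, inter_assoc, inter_self]
  exact measurableSet_source.inter measurableSet_source

variable [CompactSpace M]

theorem chartWeight_ac (g : Metric I M) :
    chartWeight g e ≪ (volume : Measure 𝔼).restrict (e.extend I).target :=
  withDensity_absolutelyContinuous _ _

theorem ac_chartWeight (g : Metric I M) (he : e ∈ IsManifold.maximalAtlas I ∞ M) :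
    (volume : Measure 𝔼).restrict (e.extend I).target ≪ chartWeight g e := by
  refine withDensity_absolutelyContinuous' (aemeasurable_chartDensity g he) ?_
  filter_upwards [ae_restrict_mem measurableSet_extend_target] with y hy
  simpa using chartDensity_pos g he hy

theorem ae_chart_iff (g : Metric I M) (he : e ∈ IsManifold.maximalAtlas I ∞ M) {P : M → Prop} :
    (∀ᵐ p ∂(vol g).restrict e.source, P p) ↔
      ∀ᵐ y ∂(volume : Measure 𝔼).restrict (e.extend I).target, P ((e.extend I).symm y) := by
  rw [vol_restrict_source g he, chartVolume_eq]
  constructor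
  · intro h
    exact (ac_chartWeight g he).ae_le
      (ae_of_ae_map (aemeasurable_extend_symm_chartWeight g) h)
  · intro h
    have h1 : ∀ᵐ y ∂chartWeight g e, y ∈ (e.extend I).target :=
      (chartWeight_ac g).ae_le (ae_restrict_mem measurableSet_extend_target)
    have h2 : chartWeight g e {y | ¬ (P ((e.extend I).symm y))} = 0 := (chartWeight_ac g).ae_le h
    -- The exceptional set need not be measurable; its measurable hull is still null and can be
    -- pulled back by the chart.
    set Z := toMeasurable (chartWeight g e) {y | ¬ (P ((e.extend I).symm y))} with hZ
    have hZ0 : chartWeight g e Z = 0 := by rw [hZ, measure_toMeasurable, h2]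
    have hZm : MeasurableSet Z := measurableSet_toMeasurable _ _
    have hsub : {p | ¬ P p} ⊆ (e.source ∩ (e.extend I) ⁻¹' Z) ∪ e.sourceᶜ := by
      intro p hp
      by_cases hps : p ∈ e.source
      · left
        refine ⟨hps, subset_toMeasurable _ _ ?_⟩
        simp only [mem_ofPred_eq, e.extend_left_inv hps]
        exact hp
      · right; exact hps
    refine measure_mono_null hsub (measure_union_null ?_ ?_)
    · have hm : MeasurableSet (e.source ∩ (e.extend I) ⁻¹' Z) := by
        have := e.continuousOn_extend (I := I)
        rw [e.extend_source] at this
        exact this.measurableSet_inter_preimage measurableSet_source hZm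
      rw [Measure.map_apply_of_aemeasurable (aemeasurable_extend_symm_chartWeight g) hm]
      refine measure_mono_null (t := Z ∪ {y | ¬ y ∈ (e.extend I).target}) ?_
        (measure_union_null hZ0 h1)
      rintro y ⟨hy1, hy2⟩
      by_cases hyT : y ∈ (e.extend I).target
      · left
        simpa only [mem_preimage, (e.extend I).right_inv hyT] using hy2
      · right; exact hyT
    · exact chartVolume_compl_source g

theorem aestronglyMeasurable_chart_iff {F : Type*} [TopologicalSpace F]
    [TopologicalSpace.PseudoMetrizableSpace F]
    (g : Metric I M) (he : e ∈ IsManifold.maximalAtlas I ∞ M) {f : M → F} :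
    AEStronglyMeasurable f ((vol g).restrict e.source) ↔
      AEStronglyMeasurable (fun y => f ((e.extend I).symm y))
        ((volume : Measure 𝔼).restrict (e.extend I).target) := by
  constructor
  · intro h
    rw [vol_restrict_source g he, chartVolume_eq] at h
    exact (h.comp_aemeasurable (aemeasurable_extend_symm_chartWeight g)).mono_ac
      (ac_chartWeight g he)
  · intro h
    have hm : AEMeasurable (e.extend I) ((vol g).restrict e.source) := by
      have := e.continuousOn_extend (I := I)
      rw [e.extend_source] at this
      exact this.aemeasurable measurableSet_source
    have hq : (((vol g).restrict e.source).map (e.extend I)) ≪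
        (volume : Measure 𝔼).restrict (e.extend I).target := by
      refine Measure.AbsolutelyContinuous.mk fun s hs hs0 => ?_
      rw [Measure.map_apply_of_aemeasurable hm hs]
      have : ∀ᵐ p ∂(vol g).restrict e.source, e.extend I p ∉ s := by
        rw [ae_chart_iff g he]
        have h1 : ∀ᵐ y ∂(volume : Measure 𝔼).restrict (e.extend I).target, y ∉ s := by
          rw [ae_iff]; simpa using hs0
        filter_upwards [h1, ae_restrict_mem measurableSet_extend_target] with y hy hyT
        rwa [(e.extend I).right_inv hyT]
      rw [ae_iff] at this
      simp only [not_not] at this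
      exact this
    have h2 := (h.mono_ac hq).comp_aemeasurable hm
    refine h2.congr ?_
    filter_upwards [ae_restrict_mem measurableSet_source] with p hp
    simp only [Function.comp_apply]
    rw [e.extend_left_inv hp]

theorem lintegral_chart (g : Metric I M) (he : e ∈ IsManifold.maximalAtlas I ∞ M) {f : M → ℝ≥0∞}
    (hf : AEMeasurable f ((vol g).restrict e.source)) :
    ∫⁻ p in e.source, f p ∂(vol g) = ∫⁻ y in (e.extend I).target,
      ENNReal.ofReal (chartDensity g e y) * f ((e.extend I).symm y) := by
  rw [vol_restrict_source g he, chartVolume_eq] at hf ⊢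
  rw [lintegral_map' hf (aemeasurable_extend_symm_chartWeight g), chartWeight,
    lintegral_withDensity_eq_lintegral_mul₀ (aemeasurable_chartDensity g he)]
  · rfl
  · exact (hf.comp_aemeasurable (aemeasurable_extend_symm_chartWeight g)).mono_ac
      (ac_chartWeight g he)

/-- The part of a chart over a subset of its target. -/
def chartPart (I : ModelWithCorners ℝ 𝔼 H) (e : OpenPartialHomeomorph M H) (Q : Set 𝔼) : Set M :=
  e.source ∩ (e.extend I) ⁻¹' Q

theorem measurableSet_chartPart {Q : Set 𝔼} (hQ : MeasurableSet Q) :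
    MeasurableSet (chartPart I e Q) := by
  have := e.continuousOn_extend (I := I)
  rw [e.extend_source] at this
  exact this.measurableSet_inter_preimage measurableSet_source hQ

theorem lintegral_chartPart (g : Metric I M) (he : e ∈ IsManifold.maximalAtlas I ∞ M) {f : M → ℝ≥0∞}
    (hf : AEMeasurable f ((vol g).restrict e.source)) {Q : Set 𝔼} (hQ : MeasurableSet Q)
    (hQT : Q ⊆ (e.extend I).target) :
    ∫⁻ p in chartPart I e Q, f p ∂(vol g) = ∫⁻ y in Q,
      ENNReal.ofReal (chartDensity g e y) * f ((e.extend I).symm y) := by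
  have hm : MeasurableSet (chartPart I e Q) := measurableSet_chartPart hQ
  have h1 := lintegral_chart g he (hf.indicator hm)
  rw [lintegral_indicator hm, Measure.restrict_restrict hm,
    inter_eq_left.2 (show chartPart I e Q ⊆ e.source from inter_subset_left)] at h1
  rw [h1]
  conv_rhs => rw [← inter_eq_left.2 hQT, ← Measure.restrict_restrict hQ, ← lintegral_indicator hQ]
  refine setLIntegral_congr_fun measurableSet_extend_target fun y hy => ?_
  have hy' : (e.extend I).symm y ∈ e.source := by simpa using (e.extend I).map_target hy
  by_cases hyQ : y ∈ Q
  · rw [indicator_of_mem hyQ, indicator_of_mem]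
    exact ⟨hy', by simpa only [mem_preimage, (e.extend I).right_inv hy] using hyQ⟩
  · rw [indicator_of_notMem hyQ, indicator_of_notMem, mul_zero]
    rintro ⟨-, h⟩
    exact hyQ (by simpa only [mem_preimage, (e.extend I).right_inv hy] using h)

/-- On compact subsets of a chart the volume is comparable with Lebesgue measure. -/
theorem exists_lintegral_chartPart_bounds (g : Metric I M)
    (he : e ∈ IsManifold.maximalAtlas I ∞ M) {Q : Set 𝔼} (hQ : IsCompact Q)
    (hQT : Q ⊆ (e.extend I).target) :
    ∃ C : NNReal, 0 < C ∧ ∀ f : M → ℝ≥0∞, AEMeasurable f ((vol g).restrict e.source) →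
      (∫⁻ p in chartPart I e Q, f p ∂(vol g) ≤ C * ∫⁻ y in Q, f ((e.extend I).symm y)) ∧
      (∫⁻ y in Q, f ((e.extend I).symm y) ≤ C * ∫⁻ p in chartPart I e Q, f p ∂(vol g)) := by
  rcases Q.eq_empty_or_nonempty with rfl | hne
  · refine ⟨1, one_pos, fun f _ => ⟨?_, ?_⟩⟩ <;> simp [chartPart]
  have hc := (continuousOn_chartDensity g he).mono hQT
  obtain ⟨y0, hy0, hmin⟩ := hQ.exists_isMinOn hne hc
  obtain ⟨y1, hy1, hmax⟩ := hQ.exists_isMaxOn hne hc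
  have hpos0 := chartDensity_pos g he (hQT hy0)
  have hpos1 := chartDensity_pos g he (hQT hy1)
  set a := chartDensity g e y0
  set b := chartDensity g e y1
  -- With `a` and `b` the extreme values of the density on `Q`, the number `b + a⁻¹` bounds both the
  -- density and its reciprocal.
  refine ⟨Real.toNNReal (b + a⁻¹), by simp; positivity, fun f hf => ?_⟩
  rw [lintegral_chartPart g he hf hQ.measurableSet hQT]
  have hC : ((Real.toNNReal (b + a⁻¹) : NNReal) : ℝ≥0∞) = ENNReal.ofReal (b + a⁻¹) := rfl
  rw [hC]
  constructor
  · rw [← lintegral_const_mul' _ _ ENNReal.ofReal_ne_top]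
    refine setLIntegral_mono' hQ.measurableSet fun y hy => ?_
    gcongr
    have : chartDensity g e y ≤ b := hmax hy
    have : 0 < a⁻¹ := by positivity
    linarith
  · rw [← lintegral_const_mul' _ _ ENNReal.ofReal_ne_top]
    refine setLIntegral_mono' hQ.measurableSet fun y hy => ?_
    rw [← mul_assoc, ← ENNReal.ofReal_mul (by positivity)]
    refine le_mul_of_one_le_left (zero_le) ?_
    rw [ENNReal.one_le_ofReal]
    have h1 : a ≤ chartDensity g e y := hmin hy
    have : 1 = a⁻¹ * a := by field_simp
    have h2 : 0 < a⁻¹ := by positivity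
    nlinarith

theorem vol_chartPart_lt_top (g : Metric I M) (he : e ∈ IsManifold.maximalAtlas I ∞ M)
    {Q : Set 𝔼} (hQ : IsCompact Q) (hQT : Q ⊆ (e.extend I).target) :
    vol g (chartPart I e Q) < ⊤ := by
  obtain ⟨C, -, hC⟩ := exists_lintegral_chartPart_bounds g he hQ hQT
  have := (hC (fun _ => 1) aemeasurable_const).1
  rw [setLIntegral_one, setLIntegral_one] at this
  exact this.trans_lt (ENNReal.mul_lt_top (by simp) hQ.measure_lt_top)

/-- Every point has a neighbourhood over a compact convex subset of a given chart. -/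
theorem exists_chartPart_mem_nhds {p : M} (hp : p ∈ e.source) {U : Set 𝔼}
    (hU : U ∈ 𝓝 (e.extend I p)) :
    ∃ r > 0, Metric.closedBall (e.extend I p) r ⊆ U ∧
      Metric.closedBall (e.extend I p) r ∩ range I ⊆ (e.extend I).target ∧
      ∀ s > 0, chartPart I e (Metric.ball (e.extend I p) s) ∈ 𝓝 p := by
  have h1 := e.extend_target_mem_nhdsWithin (I := I) hp
  rw [mem_nhdsWithin_iff_exists_mem_nhds_inter] at h1
  obtain ⟨V, hV, hVT⟩ := h1
  obtain ⟨r, hr, hrV⟩ := Metric.nhds_basis_closedBall.mem_iff.1 (Filter.inter_mem hV hU)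
  refine ⟨r, hr, hrV.trans inter_subset_right,
    (inter_subset_inter_left _ (hrV.trans inter_subset_left)).trans hVT, fun s hs => ?_⟩
  refine Filter.inter_mem (e.open_source.mem_nhds hp) ?_
  exact (e.continuousAt_extend hp).preimage_mem_nhds (Metric.ball_mem_nhds _ hs)

instance isFiniteMeasure_vol (g : Metric I M) : IsFiniteMeasure (vol g) := by
  have key : ∀ p : M, ∃ V ∈ 𝓝 p, vol g V < ⊤ := by
    intro p
    have he := IsManifold.chart_mem_maximalAtlas (I := I) (n := ∞) p
    obtain ⟨r, hr, -, hrT, hnhds⟩ := exists_chartPart_mem_nhds (I := I) (mem_chart_source H p)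
      Filter.univ_mem
    refine ⟨_, hnhds r hr, ?_⟩
    refine lt_of_le_of_lt (measure_mono ?_) (vol_chartPart_lt_top g he
      ((isCompact_closedBall _ r).inter_right I.isClosed_range) hrT)
    rintro q ⟨hq, hq'⟩
    exact ⟨hq, Metric.ball_subset_closedBall hq', mem_range_self _⟩
  constructor
  refine isCompact_univ.measure_lt_top_of_nhdsWithin fun p _ => ?_
  obtain ⟨V, hV, h⟩ := key p
  exact ⟨V, mem_nhdsWithin_of_mem_nhds hV, h⟩

/-- The frontier of the convex set `range I` is Lebesgue null, and a point of the target interior to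
`range I` is interior to the target. Hence weak derivatives, tested only in the interior, determine
a field almost everywhere. -/
theorem volume_target_diff_interior :
    (volume : Measure 𝔼) ((e.extend I).target \ interior (e.extend I).target) = 0 := by
  refine measure_mono_null ?_ (I.convex_range.addHaar_frontier volume)
  rintro y ⟨hy, hy'⟩
  refine ⟨subset_closure (e.extend_target_subset_range hy), fun h => hy' ?_⟩
  have hp : (e.extend I).symm y ∈ e.source := by simpa using (e.extend I).map_target hy
  have := e.mem_interior_extend_target (I := I) (y := e ((e.extend I).symm y))
    (e.map_source hp)
    (by
      have h2 := (e.extend I).right_inv hy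
      rw [e.extend_coe] at h2
      simp only [Function.comp_apply] at h2
      rwa [h2])
  have h2 := (e.extend I).right_inv hy
  rw [e.extend_coe] at h2
  simp only [Function.comp_apply] at h2
  rwa [h2] at this

theorem restrict_interior_target :
    (volume : Measure 𝔼).restrict (interior (e.extend I).target) =
      (volume : Measure 𝔼).restrict (e.extend I).target := by
  refine Measure.restrict_congr_set ?_
  refine (interior_subset.eventuallyLE).antisymm ?_
  rw [ae_le_set]
  exact volume_target_diff_interior

end ChartMeasure

end SchwarzManifold
end

/-! ### Measurable frames adapted to the charts -/

noncomputable section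

namespace SchwarzManifold

set_option linter.unusedSectionVars false

section Frames

variable {d : ℕ} {H : Type*} [TopologicalSpace H]
  {I : ModelWithCorners ℝ (EuclideanSpace ℝ (Fin d)) H}
  {M : Type*} [TopologicalSpace M] [ChartedSpace H M] [IsManifold I ∞ M]
  {e e' : OpenPartialHomeomorph M H}

local notation "𝔼" => EuclideanSpace ℝ (Fin d)

theorem eq_sum_single (v : 𝔼) : v = ∑ α, v α • EuclideanSpace.single α (1 : ℝ) := by
  have := (EuclideanSpace.basisFun (Fin d) ℝ).sum_repr v
  simpa using this.symm

theorem metricAt_frame_expand (g : Metric I M) (p : M) (A B : 𝔼 →L[ℝ] 𝔼) (v w : 𝔼) :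
    metricAt g p (A v) (B w) = ∑ α, ∑ β, v α * w β *
      metricAt g p (A (EuclideanSpace.single α 1)) (B (EuclideanSpace.single β 1)) := by
  conv_lhs => rw [eq_sum_single v, eq_sum_single w]
  simp only [map_sum, map_smul, sum_apply, smul_apply,
    smul_eq_mul, Finset.mul_sum]
  rw [Finset.sum_comm]
  exact Finset.sum_congr rfl fun α _ => Finset.sum_congr rfl fun β _ => by ring

theorem metricAt_cauchy_schwarz (g : Metric I M) (p : M) (v w : 𝔼) :
    (metricAt g p v w) ^ 2 ≤ metricAt g p v v * metricAt g p w w := by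
  have h : ∀ t : ℝ, 0 ≤ metricAt g p v v * (t * t) + (2 * metricAt g p v w) * t +
      metricAt g p w w := by
    intro t
    have h1 := metricAt_self_nonneg g p (t • v + w)
    simp only [map_add, map_smul, add_apply, smul_apply,
      smul_eq_mul] at h1
    rw [metricAt_comm g p w v] at h1
    linarith
  have h2 := discrim_le_zero h
  rw [discrim] at h2
  nlinarith

/-- The metric is comparable with the Euclidean metric on compact subsets of a chart. -/
theorem exists_metricForm_bounds (g : Metric I M) (he : e ∈ IsManifold.maximalAtlas I ∞ M)
    {Q : Set 𝔼} (hQ : IsCompact Q) (hQT : Q ⊆ (e.extend I).target) :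
    ∃ K : ℝ, 0 < K ∧ ∀ y ∈ Q, ∀ v : 𝔼, ‖v‖ ^ 2 ≤ K * metricForm g e y v v ∧
      metricForm g e y v v ≤ K * ‖v‖ ^ 2 := by
  have hc : ContinuousOn (fun z : 𝔼 × 𝔼 => metricForm g e z.1 z.2 z.2)
      (Q ×ˢ Metric.sphere (0 : 𝔼) 1) := by
    have h1 : ∀ z : 𝔼 × 𝔼, metricForm g e z.1 z.2 z.2 = ∑ α, ∑ β, z.2 α * z.2 β *
        metricForm g e z.1 (EuclideanSpace.single α 1) (EuclideanSpace.single β 1) :=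
      fun z => metricAt_frame_expand g _ _ _ _ _
    simp only [h1]
    refine continuousOn_finsetSum _ fun α _ => continuousOn_finsetSum _ fun β _ => ?_
    refine ContinuousOn.mul (by fun_prop) ?_
    exact ((continuousOn_metricForm g he _ _).mono hQT).comp continuousOn_fst
      (fun z hz => hz.1)
  have hpos : ∀ z ∈ Q ×ˢ Metric.sphere (0 : 𝔼) 1, 0 < metricForm g e z.1 z.2 z.2 := by
    rintro z ⟨hz1, hz2⟩
    refine metricForm_self_pos g he (hQT hz1) fun h => ?_
    rw [h] at hz2
    simp at hz2
  -- By homogeneity it suffices to bound the form and its reciprocal on the compact set of points of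
  -- `Q` and unit vectors.
  have hcomp := hQ.prod (isCompact_sphere (0 : 𝔼) 1)
  obtain ⟨K1, hK1⟩ := hcomp.exists_bound_of_continuousOn hc
  obtain ⟨K2, hK2⟩ := hcomp.exists_bound_of_continuousOn (hc.inv₀ fun z hz => (hpos z hz).ne')
  have hK : 0 < |K1| + |K2| + 1 := by positivity
  refine ⟨|K1| + |K2| + 1, hK, fun y hy v => ?_⟩
  rcases eq_or_ne v 0 with rfl | hv
  · simp
  have hv' : 0 < ‖v‖ := norm_pos_iff.2 hv
  have hmem : (y, ‖v‖⁻¹ • v) ∈ Q ×ˢ Metric.sphere (0 : 𝔼) 1 := by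
    refine ⟨hy, ?_⟩
    simp [norm_smul, hv'.ne']
  have h1 := hK1 _ hmem
  have h2 := hK2 _ hmem
  have h3 := hpos _ hmem
  simp only [Pi.inv_apply, map_smul, LinearMap.smul_apply, smul_eq_mul] at h1 h2 h3
  set x := metricForm g e y v v with hx
  have hxv : ‖v‖⁻¹ * (‖v‖⁻¹ * x) = x / ‖v‖ ^ 2 := by field_simp
  rw [hxv] at h1 h2 h3
  have hx0 : 0 < x := metricForm_self_pos g he (hQT hy) hv
  rw [Real.norm_of_nonneg h3.le] at h1
  rw [norm_inv, Real.norm_of_nonneg h3.le, inv_div] at h2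
  rw [div_le_iff₀ (by positivity)] at h1
  rw [div_le_iff₀ (by positivity)] at h2
  have a1 := le_abs_self K1
  have a2 := le_abs_self K2
  have b1 := abs_nonneg K1
  have b2 := abs_nonneg K2
  have c1 : 0 ≤ ‖v‖ ^ 2 := by positivity
  constructor
  · refine h2.trans (mul_le_mul_of_nonneg_right (by linarith) hx0.le)
  · refine h1.trans (mul_le_mul_of_nonneg_right (by linarith) c1)

/-- Duality: with X = A x and q = ⟨X, X⟩ one has q = l x ≤ ‖l‖ ‖x‖ and ‖x‖² ≤ K q, so q² ≤ K ‖l‖² q.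
-/
theorem sq_norm_le_of_forall_metricAt (g : Metric I M) {p : M} {A : 𝔼 →L[ℝ] 𝔼} {K : ℝ}
    (hA : Function.Injective A)
    (hK : ∀ v, ‖v‖ ^ 2 ≤ K * metricAt g p (A v) (A v)) (X : 𝔼) {l : 𝔼 →L[ℝ] ℝ}
    (hl : ∀ v, metricAt g p X (A v) = l v) : metricAt g p X X ≤ K * ‖l‖ ^ 2 := by
  obtain ⟨x, rfl⟩ := (LinearMap.injective_iff_surjective (f := A.toLinearMap)).1 hA X
  change metricAt g p (A x) (A x) ≤ _
  have hl' : metricAt g p (A x) (A x) = l x := hl x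
  have h1 := hK x
  have h2 : l x ≤ ‖l‖ * ‖x‖ := (le_abs_self _).trans (l.le_opNorm x)
  set q := metricAt g p (A x) (A x) with hq
  have hq0 : 0 ≤ q := metricAt_self_nonneg g p _
  rw [hl'.symm] at h2
  rcases hq0.eq_or_lt with h0 | h0
  · rw [← h0] at h1 ⊢
    have hx : ‖x‖ = 0 := by nlinarith [norm_nonneg x]
    by_cases hK0 : 0 ≤ K
    · positivity
    -- The sign of `K` is not prescribed; a negative `K` is possible only if the model space is
    -- trivial.
    · have hK' : ∀ v : 𝔼, v = 0 := by
        intro v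
        have h3 := hK v
        have h4 := metricAt_self_nonneg g p (A v)
        have : ‖v‖ = 0 := by nlinarith [norm_nonneg v, not_le.1 hK0]
        exact norm_eq_zero.1 this
      have : l = 0 := by ext v; rw [hK' v]; simp
      simp [this]
  · have h3 : q ^ 2 ≤ ‖l‖ ^ 2 * (K * q) := by
      calc q ^ 2 ≤ (‖l‖ * ‖x‖) ^ 2 := by gcongr
        _ = ‖l‖ ^ 2 * ‖x‖ ^ 2 := by ring
        _ ≤ _ := by gcongr
    have h4 : q * q ≤ (K * ‖l‖ ^ 2) * q := by nlinarith
    exact le_of_mul_le_mul_right h4 h0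

variable [MeasurableSpace M] [BorelSpace M]

/-- A field of linear frames of the tangent spaces that is piecewise given by coordinate frames;
it is used to represent vector fields by vector-valued functions. -/
structure AdaptedFrame (g : Metric I M) where
  /-- The frame at a point. -/
  frame : M → 𝔼 ≃L[ℝ] 𝔼
  /-- The comparison constant. -/
  K : ℝ
  K_pos : 0 < K
  lower : ∀ p v, ‖v‖ ^ 2 ≤ K * metricAt g p (frame p v) (frame p v)
  upper : ∀ p v, metricAt g p (frame p v) (frame p v) ≤ K * ‖v‖ ^ 2
  -- A vector field counts as measurable if its components in this frame are. The remaining clauses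
  -- translate this to and from its pairings with coordinate fields, and to inner products.
  aesm_chart : ∀ e ∈ IsManifold.maximalAtlas I ∞ M, ∀ X : M → 𝔼,
    AEStronglyMeasurable (fun p => (frame p).symm (X p)) (vol g) → ∀ w : 𝔼,
      AEStronglyMeasurable (fun p => metricAt g p (X p) (chartFrame I e p w))
        ((vol g).restrict e.source)
  aesm_of_chart : ∀ X : M → 𝔼, (∀ e ∈ atlas H M, ∀ α : Fin d,
      AEStronglyMeasurable (fun p => metricAt g p (X p)
        (chartFrame I e p (EuclideanSpace.single α 1))) ((vol g).restrict e.source)) →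
    AEStronglyMeasurable (fun p => (frame p).symm (X p)) (vol g)
  aesm_inner : ∀ X Y : M → 𝔼, AEStronglyMeasurable (fun p => (frame p).symm (X p)) (vol g) →
    AEStronglyMeasurable (fun p => (frame p).symm (Y p)) (vol g) →
    AEStronglyMeasurable (fun p => metricAt g p (X p) (Y p)) (vol g)

/-- The Gram operator of a coordinate frame. -/
def gramOp (g : Metric I M) (e : OpenPartialHomeomorph M H) (p : M) : 𝔼 →L[ℝ] 𝔼 :=
  ∑ α, ((metricAt g p (chartFrame I e p (EuclideanSpace.single α 1))).comp
    (chartFrame I e p)).smulRight (EuclideanSpace.single α (1 : ℝ))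

theorem gramOp_apply (g : Metric I M) (e : OpenPartialHomeomorph M H) (p : M) (v : 𝔼) :
    gramOp g e p v = ∑ α, metricAt g p (chartFrame I e p v)
      (chartFrame I e p (EuclideanSpace.single α 1)) • EuclideanSpace.single α (1 : ℝ) := by
  simp only [gramOp, sum_apply, ContinuousLinearMap.smulRight_apply,
    ContinuousLinearMap.comp_apply]
  refine Finset.sum_congr rfl fun α _ => ?_
  rw [metricAt_comm]

theorem continuousOn_gramOp (g : Metric I M) (he : e ∈ IsManifold.maximalAtlas I ∞ M) :
    ContinuousOn (gramOp g e) e.source := by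
  rw [continuousOn_clm_apply]
  intro v
  simp only [gramOp_apply]
  refine continuousOn_finsetSum _ fun α _ => ContinuousOn.fun_smul ?_ continuousOn_const
  have := continuousOn_metricAt_chartFrame g he he v (EuclideanSpace.single α 1)
  rwa [inter_self] at this

theorem gramOp_injective (g : Metric I M) (he : e ∈ IsManifold.maximalAtlas I ∞ M) {p : M}
    (hp : p ∈ e.source) : Function.Injective (gramOp g e p) := by
  rw [injective_iff_map_eq_zero]
  intro v hv
  have h1 : ∀ α, metricAt g p (chartFrame I e p v)
      (chartFrame I e p (EuclideanSpace.single α 1)) = 0 := by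
    intro α
    have := congrArg (fun x : 𝔼 => x α) hv
    simpa [gramOp_apply, Pi.single_apply] using this
  have h2 : metricAt g p (chartFrame I e p v) (chartFrame I e p v) = 0 := by
    conv_lhs => rw [eq_sum_single v]
    rw [← eq_sum_single v]
    conv_lhs => enter [2]; rw [eq_sum_single v]
    simp [h1]
  by_contra hne
  have h3 : chartFrame I e p v ≠ 0 := fun h =>
    hne (chartFrame_injective he hp (by rw [h, map_zero]))
  exact (metricAt_self_pos g p h3).ne' h2

/-- Inversion of operators is continuous at invertible ones. The inverse Gram operator recovers the
components of a field from its pairings with the coordinate fields, and its continuity makes this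
recovery measurable. -/
theorem continuousOn_gramOp_inverse (g : Metric I M) (he : e ∈ IsManifold.maximalAtlas I ∞ M) :
    ContinuousOn (fun p => (gramOp g e p).inverse) e.source := by
  intro p hp
  have hbij : Function.Bijective (gramOp g e p).toLinearMap :=
    ⟨gramOp_injective g he hp,
      (LinearMap.injective_iff_surjective (f := (gramOp g e p).toLinearMap)).1
        (gramOp_injective g he hp)⟩
  set L : 𝔼 ≃L[ℝ] 𝔼 := (LinearEquiv.ofBijective _ hbij).toContinuousLinearEquiv
  have hL : (L : 𝔼 →L[ℝ] 𝔼) = gramOp g e p := by ext v; rfl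
  have h1 := (contDiffAt_map_inverse (𝕜 := ℝ) (n := 0) L).continuousAt
  rw [hL] at h1
  exact ContinuousAt.comp_continuousWithinAt (f := gramOp g e) h1 (continuousOn_gramOp g he p hp)

theorem eq_gramOp_inverse (g : Metric I M) (he : e ∈ IsManifold.maximalAtlas I ∞ M) {p : M}
    (hp : p ∈ e.source) (v : 𝔼) : v = (gramOp g e p).inverse (gramOp g e p v) := by
  have hbij : Function.Bijective (gramOp g e p).toLinearMap :=
    ⟨gramOp_injective g he hp,
      (LinearMap.injective_iff_surjective (f := (gramOp g e p).toLinearMap)).1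
        (gramOp_injective g he hp)⟩
  set L : 𝔼 ≃L[ℝ] 𝔼 := (LinearEquiv.ofBijective _ hbij).toContinuousLinearEquiv
  have hL : (L : 𝔼 →L[ℝ] 𝔼) = gramOp g e p := by ext v; rfl
  rw [← hL, ContinuousLinearMap.inverse_equiv]
  simp

/-- A continuous global frame need not exist, but a measurable one is enough: at each point use the
coordinate frame of the first of finitely many compact chart pieces that contains it. Compactness of
the pieces yields uniform comparison constants. -/
theorem exists_adaptedFrame [CompactSpace M] (g : Metric I M) : Nonempty (AdaptedFrame g) := by
  classical
  -- compact pieces of charts whose interiors cover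
  have key : ∀ p : M, ∃ Q : Set 𝔼, IsCompact Q ∧ Q ⊆ ((chartAt H p).extend I).target ∧
      chartPart I (chartAt H p) Q ∈ 𝓝 p := by
    intro p
    obtain ⟨r, hr, -, hrT, hnhds⟩ := exists_chartPart_mem_nhds (I := I) (mem_chart_source H p)
      Filter.univ_mem
    refine ⟨_, (isCompact_closedBall _ r).inter_right I.isClosed_range, hrT,
      Filter.mem_of_superset (hnhds r hr) ?_⟩
    rintro q ⟨hq, hq'⟩
    exact ⟨hq, Metric.ball_subset_closedBall hq', mem_range_self _⟩
  choose Q hQc hQT hQn using key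
  have hem : ∀ p : M, chartAt H p ∈ IsManifold.maximalAtlas I ∞ M := fun p =>
    IsManifold.chart_mem_maximalAtlas p
  choose K hK0 hK using fun p => exists_metricForm_bounds g (hem p) (hQc p) (hQT p)
  obtain ⟨t, ht⟩ := CompactSpace.elim_nhds_subcover (fun p => chartPart I (chartAt H p) (Q p)) hQn
  -- a measurable choice of the chart
  let P : M → ℕ → Prop := fun p n => ∃ h : n < t.card,
    p ∈ chartPart I (chartAt H (t.equivFin.symm ⟨n, h⟩ : M)) (Q (t.equivFin.symm ⟨n, h⟩ : M))
  have hP : ∀ p, ∃ n, P p n := by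
    intro p
    have : p ∈ ⋃ x ∈ t, chartPart I (chartAt H x) (Q x) := by rw [ht]; trivial
    simp only [mem_iUnion] at this
    obtain ⟨x, hx, hpx⟩ := this
    refine ⟨t.equivFin ⟨x, hx⟩, Fin.is_lt _, ?_⟩
    simpa using hpx
  have hPm : ∀ n, MeasurableSet {p | P p n} := by
    intro n
    by_cases hn : n < t.card
    · simp only [P, hn, exists_true_left]
      exact measurableSet_chartPart (hQc _).measurableSet
    · simp [P, hn]
  let j : M → ℕ := fun p => Nat.find (hP p)
  have hj : Measurable j := measurable_find hP hPm
  have hjP : ∀ p, P p (j p) := fun p => Nat.find_spec (hP p)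
  choose hjt hjQ using hjP
  let c : M → M := fun p => (t.equivFin.symm ⟨j p, hjt p⟩ : M)
  have hct : ∀ p, c p ∈ t := fun p => (t.equivFin.symm ⟨j p, hjt p⟩).2
  have hcs : ∀ p, p ∈ (chartAt H (c p)).source := fun p => (hjQ p).1
  have hcQ : ∀ p, (chartAt H (c p)).extend I p ∈ Q (c p) := fun p => (hjQ p).2
  have hinj : ∀ p, Function.Injective (chartFrame I (chartAt H (c p)) p).toLinearMap := fun p =>
    chartFrame_injective (hem _) (hcs p)
  let F : M → 𝔼 ≃L[ℝ] 𝔼 := fun p => (LinearEquiv.ofBijective _ ⟨hinj p,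
    LinearMap.injective_iff_surjective.1 (hinj p)⟩).toContinuousLinearEquiv
  have hF : ∀ p v, F p v = chartFrame I (chartAt H (c p)) p v := fun p v => rfl
  -- the pieces
  let D : ℕ → Set M := fun n => j ⁻¹' {n}
  have hDm : ∀ n, MeasurableSet (D n) := fun n => hj (measurableSet_singleton n)
  have hDU : ⋃ n, D n = univ := by
    ext p; simp [D]
  have hDc : ∀ n, (D n).Nonempty → ∃ x : M, ∀ p ∈ D n, c p = x := by
    rintro n ⟨p0, hp0⟩
    refine ⟨c p0, fun p hp => ?_⟩
    have h1 : j p = n := hp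
    have h2 : j p0 = n := hp0
    simp only [c, h1, h2]
  -- Measurability may be checked on each of the countably many sets `D n`, on which the frame is
  -- that of a single chart.
  have glue : ∀ {B : Type} [TopologicalSpace B] [TopologicalSpace.PseudoMetrizableSpace B]
      (f : M → B) (S : Set M),
      MeasurableSet S → (∀ n x, (∀ p ∈ D n, c p = x) → D n ⊆ (chartAt H x).source →
        AEStronglyMeasurable f ((vol g).restrict (S ∩ D n))) →
      AEStronglyMeasurable f ((vol g).restrict S) := by
    intro B _ _ f S hS h
    have : S = ⋃ n, S ∩ D n := by rw [← inter_iUnion, hDU, inter_univ]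
    rw [this, aestronglyMeasurable_iUnion_iff]
    intro n
    by_cases hne : (D n).Nonempty
    · obtain ⟨x, hx⟩ := hDc n hne
      exact h n x hx fun p hp => by rw [← hx p hp]; exact hcs p
    · rw [not_nonempty_iff_eq_empty.1 hne]
      simp
  have hcoord : ∀ {f : M → 𝔼} {μ : Measure M} (α : Fin d), AEStronglyMeasurable f μ →
      AEStronglyMeasurable (fun p => f p α) μ := fun α hf =>
    (EuclideanSpace.proj (𝕜 := ℝ) α).continuous.comp_aestronglyMeasurable hf
  -- The summand `1` keeps the constant positive even for an empty cover.
  refine ⟨⟨F, ∑ x ∈ t, K x + 1, ?_, ?_, ?_, ?_, ?_, ?_⟩⟩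
  · have : 0 ≤ ∑ x ∈ t, K x := Finset.sum_nonneg fun x _ => (hK0 x).le
    linarith
  · intro p v
    have h1 := (hK (c p) _ (hcQ p) v).1
    rw [metricForm_apply, OpenPartialHomeomorph.extend_left_inv _ (hcs p)] at h1
    have h2 : K (c p) ≤ ∑ x ∈ t, K x :=
      Finset.single_le_sum (f := K) (fun x _ => (hK0 x).le) (hct p)
    exact h1.trans (mul_le_mul_of_nonneg_right (by linarith) (metricAt_self_nonneg g p _))
  · intro p v
    have h1 := (hK (c p) _ (hcQ p) v).2
    rw [metricForm_apply, OpenPartialHomeomorph.extend_left_inv _ (hcs p)] at h1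
    have h2 : K (c p) ≤ ∑ x ∈ t, K x :=
      Finset.single_le_sum (f := K) (fun x _ => (hK0 x).le) (hct p)
    exact h1.trans (mul_le_mul_of_nonneg_right (by linarith) (by positivity))
  · intro e he X hX w
    refine glue _ _ measurableSet_source fun n x hx hxs => ?_
    have hm : MeasurableSet (e.source ∩ D n) := measurableSet_source.inter (hDm n)
    have h1 : ∀ p ∈ e.source ∩ D n, ∑ α, ((F p).symm (X p)) α *
        metricAt g p (chartFrame I (chartAt H x) p (EuclideanSpace.single α 1))
          (chartFrame I e p w) = metricAt g p (X p) (chartFrame I e p w) := by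
      rintro p ⟨-, hp⟩
      have h2 : X p = chartFrame I (chartAt H x) p ((F p).symm (X p)) := by
        rw [← hx p hp, ← hF, ContinuousLinearEquiv.apply_symm_apply]
      conv_rhs => rw [h2, eq_sum_single ((F p).symm (X p))]
      simp
    refine AEStronglyMeasurable.congr (f := fun p => ∑ α, ((F p).symm (X p)) α *
        metricAt g p (chartFrame I (chartAt H x) p (EuclideanSpace.single α 1))
          (chartFrame I e p w)) ?_ ((ae_restrict_mem hm).mono h1)
    refine Finset.aestronglyMeasurable_fun_sum _ fun α _ => ?_
    refine (hcoord α hX.restrict).mul ?_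
    refine ((continuousOn_metricAt_chartFrame g (hem x) he _ _).mono ?_).aestronglyMeasurable hm
    rintro p ⟨hp, hp'⟩
    exact ⟨hxs hp', hp⟩
  · intro X hX
    rw [← Measure.restrict_univ (μ := vol g)]
    refine glue _ _ MeasurableSet.univ fun n x hx hxs => ?_
    rw [univ_inter]
    -- The vector of pairings; it is the Gram operator applied to the components of `X p`.
    let η : M → 𝔼 := fun p => ∑ α, metricAt g p (X p)
      (chartFrame I (chartAt H x) p (EuclideanSpace.single α 1)) • EuclideanSpace.single α (1 : ℝ)
    have hη : AEStronglyMeasurable η ((vol g).restrict (D n)) := by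
      refine Finset.aestronglyMeasurable_fun_sum _ fun α _ => ?_
      refine AEStronglyMeasurable.smul_const ?_ _
      exact (hX _ (chart_mem_atlas H x) α).mono_measure (Measure.restrict_mono hxs le_rfl)
    have h1 : ∀ p ∈ D n, (gramOp g (chartAt H x) p).inverse (η p) = (F p).symm (X p) := by
      intro p hp
      rw [eq_gramOp_inverse g (hem x) (hxs hp) ((F p).symm (X p))]
      congr 1
      rw [gramOp_apply]
      have h2 : X p = chartFrame I (chartAt H x) p ((F p).symm (X p)) := by
        rw [← hx p hp, ← hF, ContinuousLinearEquiv.apply_symm_apply]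
      rw [← h2]
    refine AEStronglyMeasurable.congr (f := fun p => (gramOp g (chartAt H x) p).inverse (η p)) ?_
      ((ae_restrict_mem (hDm n)).mono h1)
    have h3 : AEStronglyMeasurable (fun p => (gramOp g (chartAt H x) p).inverse)
        ((vol g).restrict (D n)) :=
      ((continuousOn_gramOp_inverse g (hem x)).mono hxs).aestronglyMeasurable (hDm n)
    exact (isBoundedBilinearMap_apply (𝕜 := ℝ) (E := 𝔼) (F := 𝔼)).continuous.comp_aestronglyMeasurable
      (h3.prodMk hη)
  · intro X Y hX hY
    rw [← Measure.restrict_univ (μ := vol g)]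
    refine glue _ _ MeasurableSet.univ fun n x hx hxs => ?_
    rw [univ_inter]
    have h1 : ∀ p ∈ D n, ∑ α, ∑ β, ((F p).symm (X p)) α * ((F p).symm (Y p)) β *
        metricAt g p (chartFrame I (chartAt H x) p (EuclideanSpace.single α 1))
          (chartFrame I (chartAt H x) p (EuclideanSpace.single β 1)) =
        metricAt g p (X p) (Y p) := by
      intro p hp
      rw [← metricAt_frame_expand]
      have h2 : ∀ Z : 𝔼, chartFrame I (chartAt H x) p ((F p).symm Z) = Z := by
        intro Z
        rw [← hx p hp, ← hF, ContinuousLinearEquiv.apply_symm_apply]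
      rw [h2, h2]
    refine AEStronglyMeasurable.congr (f := fun p => ∑ α, ∑ β, ((F p).symm (X p)) α *
        ((F p).symm (Y p)) β *
        metricAt g p (chartFrame I (chartAt H x) p (EuclideanSpace.single α 1))
          (chartFrame I (chartAt H x) p (EuclideanSpace.single β 1))) ?_
      ((ae_restrict_mem (hDm n)).mono h1)
    refine Finset.aestronglyMeasurable_fun_sum _ fun α _ =>
      Finset.aestronglyMeasurable_fun_sum _ fun β _ => ?_
    refine ((hcoord α hX.restrict).mul (hcoord β hY.restrict)).mul ?_
    refine ((continuousOn_metricAt_chartFrame g (hem x) (hem x) _ _).mono ?_).aestronglyMeasurable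
      (hDm n)
    exact fun p hp => ⟨hxs hp, hxs hp⟩

end Frames

end SchwarzManifold
end

/-! ### Weak gradients: locality, linearity, uniqueness -/

noncomputable section

namespace SchwarzManifold

set_option linter.unusedSectionVars false

section WeakGradients

variable {d : ℕ} {H : Type*} [TopologicalSpace H]
  {I : ModelWithCorners ℝ (EuclideanSpace ℝ (Fin d)) H}
  {M : Type*} [TopologicalSpace M] [ChartedSpace H M] [IsManifold I ∞ M]
  [MeasurableSpace M] [BorelSpace M] [CompactSpace M]
  {e e' : OpenPartialHomeomorph M H}

local notation "𝔼" => EuclideanSpace ℝ (Fin d)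

/-- The chart representation of the pairing of a vector field with a coordinate field. -/
def chartCov (g : Metric I M) (e : OpenPartialHomeomorph M H) (X : M → 𝔼) (α : Fin d) (y : 𝔼) :
    ℝ :=
  metricAt g ((e.extend I).symm y) (X ((e.extend I).symm y))
    (chartDeriv I e y (EuclideanSpace.single α 1))

/-- `HasWeakGrad` for vector fields with values in the model space. -/
def IsWeakGrad (g : Metric I M) (u : M → ℝ) (X : M → 𝔼) : Prop := HasWeakGrad g u X

theorem isWeakGrad_iff {g : Metric I M} {u : M → ℝ} {X : M → 𝔼} :
    IsWeakGrad g u X ↔ ∀ e ∈ atlas H M,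
      LocallyIntegrableOn (fun y => u ((e.extend I).symm y)) (interior (e.extend I).target) ∧
      ∀ α : Fin d,
        LocallyIntegrableOn (chartCov g e X α) (interior (e.extend I).target) ∧
        ∀ ψ : 𝔼 → ℝ, ContDiff ℝ ∞ ψ → HasCompactSupport ψ →
          tsupport ψ ⊆ interior (e.extend I).target →
          ∫ y, u ((e.extend I).symm y) * fderiv ℝ ψ y (EuclideanSpace.single α (1 : ℝ)) =
            - ∫ y, chartCov g e X α y * ψ y := Iff.rfl

theorem chartCov_eq_on_target (g : Metric I M) (X : M → 𝔼) (α : Fin d) {y : 𝔼}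
    (hy : y ∈ (e.extend I).target) : chartCov g e X α y =
      (fun p => metricAt g p (X p) (chartFrame I e p (EuclideanSpace.single α 1)))
        ((e.extend I).symm y) := by
  simp only [chartCov, chartFrame, (e.extend I).right_inv hy]

/-- A statement that holds a.e. in each chart of the atlas holds a.e. -/
theorem ae_vol_of_forall_atlas (g : Metric I M) {P : M → Prop}
    (h : ∀ e ∈ atlas H M, ∀ᵐ p ∂(vol g).restrict e.source, P p) : ∀ᵐ p ∂(vol g), P p := by
  obtain ⟨t, ht⟩ := isCompact_univ.elim_finite_subcover (fun x : M => (chartAt H x).source)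
    (fun x => (chartAt H x).open_source) (fun x _ => mem_iUnion.2 ⟨x, mem_chart_source H x⟩)
  have hU : (univ : Set M) = ⋃ x : t, (chartAt H (x : M)).source := by
    rw [eq_comm, eq_univ_iff_forall]
    intro x
    have := ht (mem_univ x)
    simpa using this
  rw [← Measure.restrict_univ (μ := vol g), hU, ae_restrict_iUnion_iff]
  exact fun x => h _ (chart_mem_atlas H _)

theorem IsWeakGrad.aesm {g : Metric I M} (𝓕 : AdaptedFrame g) {u : M → ℝ} {X : M → 𝔼}
    (h : IsWeakGrad g u X) : AEStronglyMeasurable (fun p => (𝓕.frame p).symm (X p)) (vol g) := by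
  refine 𝓕.aesm_of_chart X fun e he α => ?_
  rw [aestronglyMeasurable_chart_iff g (IsManifold.subset_maximalAtlas he)]
  have h1 := ((isWeakGrad_iff.1 h e he).2 α).1.aestronglyMeasurable
  rw [restrict_interior_target] at h1
  refine h1.congr ?_
  filter_upwards [ae_restrict_mem measurableSet_extend_target] with y hy
  exact chartCov_eq_on_target g X α hy

/-- The weak gradient vanishes a.e. where the function vanishes on an open set. -/
theorem IsWeakGrad.ae_eq_zero_of_isOpen {g : Metric I M} {u : M → ℝ} {X : M → 𝔼}
    (h : IsWeakGrad g u X) {O : Set M} (hO : IsOpen O)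
    (hu : ∀ᵐ p ∂(vol g), p ∈ O → u p = 0) : ∀ᵐ p ∂(vol g), p ∈ O → X p = 0 := by
  refine ae_vol_of_forall_atlas g fun e he => ?_
  have hem := IsManifold.subset_maximalAtlas (I := I) (n := ∞) he
  rw [ae_chart_iff g hem]
  have hu' := (ae_chart_iff g hem).1 (ae_restrict_of_ae (s := e.source) hu)
  rw [← restrict_interior_target] at hu' ⊢
  have h1 := isWeakGrad_iff.1 h e he
  set U := interior (e.extend I).target ∩ (e.extend I).symm ⁻¹' O
  have hUo : IsOpen U :=
    (e.continuousOn_extend_symm.mono interior_subset).isOpen_inter_preimage isOpen_interior hO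
  -- The fundamental lemma of the calculus of variations: a test function supported in `U` meets `u`
  -- only where `u` vanishes, so the pairing of `X` with each coordinate field integrates to zero
  -- against it.
  have key : ∀ α : Fin d, ∀ᵐ y, y ∈ U → chartCov g e X α y = 0 := by
    intro α
    refine hUo.ae_eq_zero_of_integral_contDiff_smul_eq_zero
      ((h1.2 α).1.mono_set inter_subset_left) fun ψ hψ hψc hψU => ?_
    have h2 := (h1.2 α).2 ψ hψ hψc (hψU.trans inter_subset_left)
    have h3 : ∫ y, u ((e.extend I).symm y) * fderiv ℝ ψ y (EuclideanSpace.single α (1 : ℝ)) = 0 := by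
      refine integral_eq_zero_of_ae ?_
      rw [ae_restrict_iff' isOpen_interior.measurableSet] at hu'
      filter_upwards [hu'] with y hy
      by_cases hyψ : y ∈ tsupport ψ
      · have := hψU hyψ
        exact mul_eq_zero_of_left (hy this.1 this.2) _
      · have : fderiv ℝ ψ y = 0 :=
          image_eq_zero_of_notMem_tsupport (fun h => hyψ (tsupport_fderiv_subset ℝ h))
        simp [this]
    rw [h3, eq_comm, neg_eq_zero] at h2
    simpa only [smul_eq_mul, mul_comm] using h2
  rw [ae_restrict_iff' isOpen_interior.measurableSet]
  filter_upwards [ae_all_iff.2 key] with y hy hyT hyO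
  have hyt := interior_subset hyT
  set p := (e.extend I).symm y
  have hinj : Function.Injective (chartDeriv I e y).toLinearMap := chartDeriv_injective hem hyt
  obtain ⟨x, hx⟩ := LinearMap.injective_iff_surjective.1 hinj (X p)
  have hx' : chartDeriv I e y x = X p := hx
  have h0 : metricAt g p (X p) (X p) = 0 := by
    conv_lhs => enter [2]; rw [← hx', eq_sum_single x]
    simp only [map_sum, map_smul, smul_eq_mul]
    exact Finset.sum_eq_zero fun α _ => by
      have := hy α ⟨hyT, hyO⟩
      rw [chartCov] at this
      rw [this, mul_zero]
  by_contra hne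
  exact (metricAt_self_pos g p hne).ne' h0

theorem chartCov_add (g : Metric I M) (X Y : M → 𝔼) (α : Fin d) (y : 𝔼) :
    chartCov g e (fun p => X p + Y p) α y = chartCov g e X α y + chartCov g e Y α y := by
  simp [chartCov]

theorem chartCov_smul (g : Metric I M) (c : ℝ) (X : M → 𝔼) (α : Fin d) (y : 𝔼) :
    chartCov g e (fun p => c • X p) α y = c * chartCov g e X α y := by
  simp [chartCov]

theorem integrable_mul_of_locallyIntegrableOn {f ψ : 𝔼 → ℝ} {U : Set 𝔼}
    (hf : LocallyIntegrableOn f U) (hψ : Continuous ψ) (hc : HasCompactSupport ψ)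
    (hs : tsupport ψ ⊆ U) : Integrable (fun y => f y * ψ y) := by
  have h1 : IntegrableOn f (tsupport ψ) :=
    hf.integrableOn_compact_subset hs hc
  have h2 : IntegrableOn (fun y => f y * ψ y) (tsupport ψ) :=
    h1.mul_continuousOn hψ.continuousOn hc
  rw [← integrableOn_iff_integrable_of_support_subset (s := tsupport ψ)]
  · exact h2
  · intro y hy
    refine subset_tsupport _ fun h => hy ?_
    simp [h]

theorem continuous_fderiv_apply {ψ : 𝔼 → ℝ} (hψ : ContDiff ℝ ∞ ψ) (v : 𝔼) :
    Continuous (fun y => fderiv ℝ ψ y v) :=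
  (hψ.continuous_fderiv (by simp)).clm_apply continuous_const

theorem hasCompactSupport_fderiv_apply {ψ : 𝔼 → ℝ} (hc : HasCompactSupport ψ) (v : 𝔼) :
    HasCompactSupport (fun y => fderiv ℝ ψ y v) :=
  (hc.fderiv ℝ).comp_left (g := fun l : 𝔼 →L[ℝ] ℝ => l v) (by simp)

theorem tsupport_fderiv_apply_subset {ψ : 𝔼 → ℝ} (v : 𝔼) :
    tsupport (fun y => fderiv ℝ ψ y v) ⊆ tsupport ψ := by
  refine closure_minimal ?_ (isClosed_tsupport ψ)
  intro y hy
  refine tsupport_fderiv_subset ℝ (subset_tsupport _ fun h => hy ?_)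
  simp [h]

theorem IsWeakGrad.add {g : Metric I M} {u v : M → ℝ} {X Y : M → 𝔼} (hX : IsWeakGrad g u X)
    (hY : IsWeakGrad g v Y) : IsWeakGrad g (fun p => u p + v p) (fun p => X p + Y p) := by
  rw [isWeakGrad_iff] at hX hY ⊢
  intro e he
  refine ⟨(hX e he).1.add (hY e he).1, fun α => ⟨?_, fun ψ hψ hψc hψs => ?_⟩⟩
  · have := ((hX e he).2 α).1.add ((hY e he).2 α).1
    refine this.congr (Filter.Eventually.of_forall fun y => ?_)
    simp [chartCov_add]
  · have hx := ((hX e he).2 α).2 ψ hψ hψc hψs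
    have hy := ((hY e he).2 α).2 ψ hψ hψc hψs
    simp only [chartCov_add, add_mul]
    rw [integral_add, integral_add, hx, hy, neg_add]
    · exact integrable_mul_of_locallyIntegrableOn ((hX e he).2 α).1
        hψ.continuous hψc hψs
    · exact integrable_mul_of_locallyIntegrableOn ((hY e he).2 α).1
        hψ.continuous hψc hψs
    · exact integrable_mul_of_locallyIntegrableOn (hX e he).1
        (continuous_fderiv_apply hψ _) (hasCompactSupport_fderiv_apply hψc _)
        ((tsupport_fderiv_apply_subset _).trans hψs)
    · exact integrable_mul_of_locallyIntegrableOn (hY e he).1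
        (continuous_fderiv_apply hψ _) (hasCompactSupport_fderiv_apply hψc _)
        ((tsupport_fderiv_apply_subset _).trans hψs)

theorem IsWeakGrad.const_smul {g : Metric I M} {u : M → ℝ} {X : M → 𝔼} (hX : IsWeakGrad g u X)
    (c : ℝ) : IsWeakGrad g (fun p => c * u p) (fun p => c • X p) := by
  rw [isWeakGrad_iff] at hX ⊢
  intro e he
  refine ⟨(hX e he).1.smul c, fun α => ⟨?_, fun ψ hψ hψc hψs => ?_⟩⟩
  · have := ((hX e he).2 α).1.smul c
    refine this.congr (Filter.Eventually.of_forall fun y => ?_)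
    simp [chartCov_smul]
  · have hx := ((hX e he).2 α).2 ψ hψ hψc hψs
    simp only [chartCov_smul, mul_assoc]
    rw [integral_const_mul, integral_const_mul, hx, mul_neg]

theorem IsWeakGrad.congr {g : Metric I M} {u v : M → ℝ} {X Y : M → 𝔼} (hX : IsWeakGrad g u X)
    (huv : u =ᵐ[vol g] v) (hXY : X =ᵐ[vol g] Y) : IsWeakGrad g v Y := by
  rw [isWeakGrad_iff] at hX ⊢
  intro e he
  have hem := IsManifold.subset_maximalAtlas (I := I) (n := ∞) he
  have h1 := (ae_chart_iff g hem).1 (ae_restrict_of_ae (s := e.source) huv)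
  have h2 := (ae_chart_iff g hem).1 (ae_restrict_of_ae (s := e.source) hXY)
  rw [← restrict_interior_target] at h1 h2
  have h2' : ∀ α, chartCov g e X α =ᵐ[volume.restrict (interior (e.extend I).target)]
      chartCov g e Y α := by
    intro α
    filter_upwards [h2] with y hy
    rw [chartCov, chartCov, hy]
  refine ⟨(hX e he).1.congr h1, fun α => ⟨((hX e he).2 α).1.congr (h2' α),
    fun ψ hψ hψc hψs => ?_⟩⟩
  have hx := ((hX e he).2 α).2 ψ hψ hψc hψs
  have h3 := (ae_restrict_iff' isOpen_interior.measurableSet).1 h1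
  have h4 := (ae_restrict_iff' isOpen_interior.measurableSet).1 (h2' α)
  have e1 : ∫ y, v ((e.extend I).symm y) * fderiv ℝ ψ y (EuclideanSpace.single α (1 : ℝ)) =
      ∫ y, u ((e.extend I).symm y) * fderiv ℝ ψ y (EuclideanSpace.single α (1 : ℝ)) := by
    refine integral_congr_ae ?_
    filter_upwards [h3] with y hy
    by_cases hyψ : y ∈ tsupport ψ
    · rw [hy (hψs hyψ)]
    · have : fderiv ℝ ψ y = 0 :=
        image_eq_zero_of_notMem_tsupport (fun h => hyψ (tsupport_fderiv_subset ℝ h))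
      simp [this]
  have e2 : ∫ y, chartCov g e Y α y * ψ y = ∫ y, chartCov g e X α y * ψ y := by
    refine integral_congr_ae ?_
    filter_upwards [h4] with y hy
    by_cases hyψ : y ∈ tsupport ψ
    · rw [hy (hψs hyψ)]
    · simp [image_eq_zero_of_notMem_tsupport hyψ]
  rw [e1, e2, hx]

theorem IsWeakGrad.ae_unique {g : Metric I M} {u v : M → ℝ} {X Y : M → 𝔼}
    (hX : IsWeakGrad g u X) (hY : IsWeakGrad g v Y) (huv : u =ᵐ[vol g] v) : X =ᵐ[vol g] Y := by
  have h1 := (hX.add (hY.const_smul (-1))).ae_eq_zero_of_isOpen isOpen_univ (by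
    filter_upwards [huv] with p hp _
    rw [hp]; ring)
  filter_upwards [h1] with p hp
  have := hp (mem_univ p)
  rw [neg_one_smul, ← sub_eq_add_neg, sub_eq_zero] at this
  exact this

/-- Integration by parts in coordinates. The test function has compact support in the interior of
the target, so there is no boundary term even if `φ` does not vanish on the boundary of `M`. -/
theorem isWeakGrad_classicalGrad (g : Metric I M) {φ : M → ℝ} (hφ : ContMDiff I 𝓘(ℝ, ℝ) ∞ φ) :
    IsWeakGrad g φ (classicalGrad g φ) := by
  rw [isWeakGrad_iff]
  intro e he
  have hem := IsManifold.subset_maximalAtlas (I := I) (n := ∞) he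
  have hU : IsOpen (interior (e.extend I).target) := isOpen_interior
  have h1 : ContDiffOn ℝ ∞ (fun y => φ ((e.extend I).symm y)) (interior (e.extend I).target) :=
    (contDiffOn_comp_extend_symm hem hφ).mono interior_subset
  have h2 : ∀ α : Fin d, ∀ y ∈ interior (e.extend I).target,
      chartCov g e (classicalGrad g φ) α y =
        fderiv ℝ (fun y => φ ((e.extend I).symm y)) y (EuclideanSpace.single α 1) := by
    intro α y hy
    rw [chartCov, metricAt_classicalGrad, differential_chartFrame hem hφ hy]
  have h3 : ∀ α : Fin d, ContinuousOn (fun y => fderiv ℝ (fun y => φ ((e.extend I).symm y)) y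
      (EuclideanSpace.single α 1)) (interior (e.extend I).target) := fun α =>
    (h1.continuousOn_fderiv_of_isOpen hU (by simp)).clm_apply continuousOn_const
  have h4 : ∀ α : Fin d, ContinuousOn (chartCov g e (classicalGrad g φ) α)
      (interior (e.extend I).target) := fun α => (h3 α).congr (h2 α)
  have h5 := h1.continuousOn.locallyIntegrableOn (μ := volume) hU.measurableSet
  have h6 := fun α => (h4 α).locallyIntegrableOn (μ := volume) hU.measurableSet
  have h7 := fun α => (h3 α).locallyIntegrableOn (μ := volume) hU.measurableSet
  refine ⟨h5, fun α => ⟨h6 α, fun ψ hψ hψc hψs => ?_⟩⟩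
  have h8 := integral_mul_fderiv_eq_neg_fderiv_mul_of_integrable (μ := (volume : Measure 𝔼))
    (f := fun y => φ ((e.extend I).symm y)) (g := ψ) (v := EuclideanSpace.single α (1 : ℝ))
    (integrable_mul_of_locallyIntegrableOn (h7 α) hψ.continuous hψc hψs)
    (integrable_mul_of_locallyIntegrableOn h5
        (continuous_fderiv_apply hψ _) (hasCompactSupport_fderiv_apply hψc _)
        ((tsupport_fderiv_apply_subset _).trans hψs))
    (integrable_mul_of_locallyIntegrableOn h5 hψ.continuous hψc hψs)
    (fun y hy => (h1.differentiableOn (by simp)).differentiableAt (hU.mem_nhds (hψs hy)))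
    (fun y _ => hψ.differentiable (by simp) y)
  rw [h8]
  congr 1
  refine integral_congr_ae (Filter.Eventually.of_forall fun y => ?_)
  by_cases hyψ : y ∈ tsupport ψ
  · simp only
    rw [h2 α y (hψs hyψ)]
  · simp [image_eq_zero_of_notMem_tsupport hyψ]

theorem isWeakGrad_weakGrad {g : Metric I M} {u : M → ℝ} {X : M → 𝔼} (h : IsWeakGrad g u X) :
    IsWeakGrad g u (weakGrad g u) := by
  have hex : ∃ X, HasWeakGrad g u X := ⟨X, h⟩
  have := hex.choose_spec
  rw [weakGrad, dif_pos hex]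
  exact this

end WeakGradients

end SchwarzManifold
end

/-! ### The Hilbert space of pairs and the closed graph of the weak gradient -/

noncomputable section

namespace SchwarzManifold

set_option linter.unusedSectionVars false

section PairSpace

variable {d : ℕ} {H : Type*} [TopologicalSpace H]
  {I : ModelWithCorners ℝ (EuclideanSpace ℝ (Fin d)) H}
  {M : Type*} [TopologicalSpace M] [ChartedSpace H M] [IsManifold I ∞ M]
  [MeasurableSpace M] [BorelSpace M] [CompactSpace M]
  {e e' : OpenPartialHomeomorph M H}

local notation "𝔼" => EuclideanSpace ℝ (Fin d)

/-- Pairs of a square integrable function and a square integrable vector field, the latter being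
represented in an adapted frame. -/
abbrev PairSpace (g : Metric I M) : Type _ :=
  WithLp 2 (Lp ℝ 2 (vol g) × Lp 𝔼 2 (vol g))

/-- The vector field of a pair. -/
def AdaptedFrame.field {g : Metric I M} (𝓕 : AdaptedFrame g) (ξ : M → 𝔼) (p : M) : 𝔼 :=
  𝓕.frame p (ξ p)

theorem AdaptedFrame.symm_field {g : Metric I M} (𝓕 : AdaptedFrame g) (ξ : M → 𝔼) (p : M) :
    (𝓕.frame p).symm (𝓕.field ξ p) = ξ p := by
  simp [AdaptedFrame.field]

theorem AdaptedFrame.aesm_field {g : Metric I M} (𝓕 : AdaptedFrame g) {ξ : M → 𝔼}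
    (hξ : AEStronglyMeasurable ξ (vol g)) :
    AEStronglyMeasurable (fun p => (𝓕.frame p).symm (𝓕.field ξ p)) (vol g) := by
  simpa only [𝓕.symm_field] using hξ

theorem AdaptedFrame.abs_metricAt_field_le {g : Metric I M} (𝓕 : AdaptedFrame g) (p : M)
    (v w : 𝔼) : |metricAt g p (𝓕.frame p v) (𝓕.frame p w)| ≤ 𝓕.K * (‖v‖ * ‖w‖) := by
  have h1 := metricAt_cauchy_schwarz g p (𝓕.frame p v) (𝓕.frame p w)
  have h2 := 𝓕.upper p v
  have h3 := 𝓕.upper p w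
  have h4 := 𝓕.K_pos
  refine abs_le_of_sq_le_sq ?_ (by positivity)
  calc _ ≤ _ := h1
    _ ≤ (𝓕.K * ‖v‖ ^ 2) * (𝓕.K * ‖w‖ ^ 2) :=
      mul_le_mul h2 h3 (metricAt_self_nonneg g p _) (by positivity)
    _ = _ := by ring

theorem abs_le_of_sq_le_mul {a b c : ℝ} (hb : 0 ≤ b) (hc : 0 ≤ c) (h : a ^ 2 ≤ b ^ 2 * c ^ 2) :
    |a| ≤ b * c := abs_le_of_sq_le_sq (by rwa [mul_pow]) (by positivity)

/-- Cauchy–Schwarz with the bounds of the frame and of the metric on `Q`. It makes pairing with a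
coordinate field a continuous operation for L¹ convergence on compact parts of a chart. -/
theorem AdaptedFrame.exists_chartCov_bound {g : Metric I M} (𝓕 : AdaptedFrame g)
    (he : e ∈ IsManifold.maximalAtlas I ∞ M)
    {Q : Set 𝔼} (hQ : IsCompact Q) (hQT : Q ⊆ (e.extend I).target) (w : 𝔼) :
    ∃ C : NNReal, ∀ p ∈ chartPart I e Q, ∀ v : 𝔼,
      ‖metricAt g p (𝓕.frame p v) (chartFrame I e p w)‖ₑ ≤ C * ‖v‖ₑ := by
  obtain ⟨K, hK0, hK⟩ := exists_metricForm_bounds g he hQ hQT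
  refine ⟨Real.toNNReal (Real.sqrt (𝓕.K * (K * ‖w‖ ^ 2))), fun p hp v => ?_⟩
  have h1 := metricAt_cauchy_schwarz g p (𝓕.frame p v) (chartFrame I e p w)
  have h2 := 𝓕.upper p v
  have h3 := (hK _ hp.2 w).2
  rw [metricForm_apply, e.extend_left_inv hp.1] at h3
  have h4 := 𝓕.K_pos
  have h5 : ‖metricAt g p (𝓕.frame p v) (chartFrame I e p w)‖ ≤
      Real.sqrt (𝓕.K * (K * ‖w‖ ^ 2)) * ‖v‖ := by
    refine abs_le_of_sq_le_mul (Real.sqrt_nonneg _) (norm_nonneg _) (h1.trans ?_)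
    rw [Real.sq_sqrt (by positivity)]
    calc _ ≤ (𝓕.K * ‖v‖ ^ 2) * (K * ‖w‖ ^ 2) :=
          mul_le_mul h2 h3 (metricAt_self_nonneg g p _) (by positivity)
      _ = _ := by ring
  rw [← ofReal_norm, ← ofReal_norm]
  refine (ENNReal.ofReal_le_ofReal h5).trans ?_
  rw [ENNReal.ofReal_mul (Real.sqrt_nonneg _)]
  rfl

theorem tendsto_lintegral_of_tendsto_Lp {F : Type*} [NormedAddCommGroup F] {α : Type*}
    [MeasurableSpace α] {μ : Measure α} [IsFiniteMeasure μ] {f : ℕ → Lp F 2 μ} {f₀ : Lp F 2 μ}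
    (h : Filter.Tendsto f Filter.atTop (𝓝 f₀)) :
    Filter.Tendsto (fun k => ∫⁻ p, ‖f k p - f₀ p‖ₑ ∂μ) Filter.atTop (𝓝 0) := by
  have h1 : Filter.Tendsto (fun k => eLpNorm (⇑(f k) - ⇑f₀) 2 μ * μ univ ^ ((1 : ℝ) - 1 / 2))
      Filter.atTop (𝓝 0) := by
    have h2 := (Lp.tendsto_Lp_iff_tendsto_eLpNorm' f f₀).1 h
    have h3 := ENNReal.Tendsto.mul_const (b := μ univ ^ ((1 : ℝ) - 1 / 2)) h2
      (Or.inr (ENNReal.rpow_ne_top_of_nonneg (by norm_num) (measure_ne_top _ _)))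
    simpa using h3
  refine tendsto_of_tendsto_of_tendsto_of_le_of_le tendsto_const_nhds h1 (fun _ => zero_le)
    fun k => ?_
  have h3 := eLpNorm_le_eLpNorm_mul_rpow_measure_univ (μ := μ) (f := ⇑(f k) - ⇑f₀) (p := 1) (q := 2)
    (by norm_num) ((Lp.aestronglyMeasurable _).sub (Lp.aestronglyMeasurable _))
  rw [eLpNorm_one_eq_lintegral_enorm] at h3
  simpa using h3

theorem lintegral_enorm_lt_top_of_Lp {F : Type*} [NormedAddCommGroup F] {α : Type*}
    [MeasurableSpace α] {μ : Measure α} [IsFiniteMeasure μ] (f : Lp F 2 μ) :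
    ∫⁻ p, ‖f p‖ₑ ∂μ < ⊤ := by
  have := (Lp.memLp f).integrable (by norm_num)
  exact this.2

/-- Integrability on a compact subset of the target of a chart. -/
theorem integrableOn_chart {g : Metric I M} (he : e ∈ IsManifold.maximalAtlas I ∞ M)
    {f : M → ℝ} (hf : AEStronglyMeasurable f ((vol g).restrict e.source)) {Q : Set 𝔼}
    (hQ : IsCompact Q) (hQT : Q ⊆ (e.extend I).target)
    (hfin : ∫⁻ p in chartPart I e Q, ‖f p‖ₑ ∂(vol g) < ⊤) :
    IntegrableOn (fun y => f ((e.extend I).symm y)) Q := by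
  obtain ⟨C, -, hC⟩ := exists_lintegral_chartPart_bounds g he hQ hQT
  refine ⟨((aestronglyMeasurable_chart_iff g he).1 hf).mono_measure
    (Measure.restrict_mono hQT le_rfl), ?_⟩
  refine lt_of_le_of_lt (hC _ hf.enorm).2 (ENNReal.mul_lt_top (by simp) hfin)

theorem tendsto_integral_chart {g : Metric I M} (he : e ∈ IsManifold.maximalAtlas I ∞ M)
    {f : ℕ → M → ℝ} {f₀ : M → ℝ} (hf : ∀ k, AEStronglyMeasurable (f k) ((vol g).restrict e.source))
    (hf₀ : AEStronglyMeasurable f₀ ((vol g).restrict e.source)) {h : 𝔼 → ℝ} (hh : Continuous h)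
    (hhc : HasCompactSupport h) (hhT : tsupport h ⊆ (e.extend I).target)
    (hfin : ∀ k, ∫⁻ p in chartPart I e (tsupport h), ‖f k p‖ₑ ∂(vol g) < ⊤)
    (hfin₀ : ∫⁻ p in chartPart I e (tsupport h), ‖f₀ p‖ₑ ∂(vol g) < ⊤)
    (hlim : Filter.Tendsto (fun k => ∫⁻ p in chartPart I e (tsupport h), ‖f k p - f₀ p‖ₑ ∂(vol g))
      Filter.atTop (𝓝 0)) :
    Filter.Tendsto (fun k => ∫ y, f k ((e.extend I).symm y) * h y) Filter.atTop
      (𝓝 (∫ y, f₀ ((e.extend I).symm y) * h y)) := by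
  have hQ : IsCompact (tsupport h) := hhc
  have hint : ∀ u : M → ℝ, IntegrableOn (fun y => u ((e.extend I).symm y)) (tsupport h) →
      Integrable (fun y => u ((e.extend I).symm y) * h y) := by
    intro u hu
    have h2 : IntegrableOn (fun y => u ((e.extend I).symm y) * h y) (tsupport h) :=
      hu.mul_continuousOn hh.continuousOn hQ
    rw [← integrableOn_iff_integrable_of_support_subset (s := tsupport h)]
    · exact h2
    · intro y hy
      refine subset_tsupport _ fun h => hy ?_
      simp [h]
  obtain ⟨C, -, hC⟩ := exists_lintegral_chartPart_bounds g he hQ hhT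
  obtain ⟨B, hB⟩ := hh.bounded_above_of_compact_support hhc
  refine tendsto_integral_of_L1 _ (hint _ (integrableOn_chart he hf₀ hQ hhT hfin₀)).aestronglyMeasurable
    (Filter.Eventually.of_forall fun k => hint _ (integrableOn_chart he (hf k) hQ hhT (hfin k))) ?_
  have hlim2 : Filter.Tendsto (fun k => ENNReal.ofReal B * (C *
      ∫⁻ p in chartPart I e (tsupport h), ‖f k p - f₀ p‖ₑ ∂(vol g))) Filter.atTop (𝓝 0) := by
    have h1 := ENNReal.Tendsto.const_mul (a := (C : ℝ≥0∞)) hlim (Or.inr (by simp))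
    have h2 := ENNReal.Tendsto.const_mul (a := ENNReal.ofReal B) h1 (Or.inr (by simp))
    simpa using h2
  refine tendsto_of_tendsto_of_tendsto_of_le_of_le tendsto_const_nhds hlim2 (fun _ => zero_le)
    fun k => ?_
  have h3 := (hC (fun p => ‖f k p - f₀ p‖ₑ) ((hf k).sub hf₀).enorm).2
  calc ∫⁻ y, ‖f k ((e.extend I).symm y) * h y - f₀ ((e.extend I).symm y) * h y‖ₑ
      = ∫⁻ y in tsupport h, ‖f k ((e.extend I).symm y) * h y - f₀ ((e.extend I).symm y) * h y‖ₑ := by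
        rw [setLIntegral_eq_of_support_subset]
        intro y hy
        refine subset_tsupport _ fun h => hy ?_
        simp [h]
    _ ≤ ∫⁻ y in tsupport h, ENNReal.ofReal B *
        ‖f k ((e.extend I).symm y) - f₀ ((e.extend I).symm y)‖ₑ := by
        refine lintegral_mono fun y => ?_
        rw [← sub_mul, enorm_mul, mul_comm]
        gcongr
        rw [← ofReal_norm]
        exact ENNReal.ofReal_le_ofReal (hB y)
    _ = ENNReal.ofReal B * ∫⁻ y in tsupport h,
        ‖f k ((e.extend I).symm y) - f₀ ((e.extend I).symm y)‖ₑ := by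
        rw [lintegral_const_mul' _ _ ENNReal.ofReal_ne_top]
    _ ≤ _ := by gcongr

/-- The pairs consisting of a function and its weak gradient. -/
def weakGraph {g : Metric I M} (𝓕 : AdaptedFrame g) : Submodule ℝ (PairSpace g) where
  carrier := {z | IsWeakGrad g z.fst (𝓕.field z.snd)}
  add_mem' := by
    intro z w hz hw
    refine (IsWeakGrad.add hz hw).congr (Lp.coeFn_add z.fst w.fst).symm ?_
    filter_upwards [Lp.coeFn_add z.snd w.snd] with p hp
    simp only [AdaptedFrame.field, WithLp.add_snd]
    rw [hp, Pi.add_apply, map_add]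
  zero_mem' := by
    have h := IsWeakGrad.const_smul (isWeakGrad_classicalGrad g (φ := fun _ => 0) contMDiff_const) 0
    refine h.congr ?_ ?_
    · filter_upwards [Lp.coeFn_zero ℝ 2 (vol g)] with p hp
      change (0 : ℝ) * 0 = (0 : Lp ℝ 2 (vol g)) p
      rw [hp, Pi.zero_apply, mul_zero]
    · filter_upwards [Lp.coeFn_zero 𝔼 2 (vol g)] with p hp
      change (0 : ℝ) • _ = 𝓕.frame p ((0 : Lp 𝔼 2 (vol g)) p)
      rw [hp, Pi.zero_apply, map_zero, zero_smul]
  smul_mem' := by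
    intro c z hz
    refine (IsWeakGrad.const_smul hz c).congr (Lp.coeFn_smul c z.fst).symm ?_
    filter_upwards [Lp.coeFn_smul c z.snd] with p hp
    simp only [AdaptedFrame.field, WithLp.smul_snd]
    rw [hp, Pi.smul_apply, map_smul]

theorem continuous_fst_pairSpace (g : Metric I M) : Continuous fun z : PairSpace g => z.fst :=
  (WithLp.prod_continuous_ofLp 2 _ _).fst

theorem continuous_snd_pairSpace (g : Metric I M) : Continuous fun z : PairSpace g => z.snd :=
  (WithLp.prod_continuous_ofLp 2 _ _).snd

theorem locallyIntegrableOn_of_forall_compact {f : 𝔼 → ℝ} {U : Set 𝔼} (hU : IsOpen U)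
    (h : ∀ Q ⊆ U, IsCompact Q → IntegrableOn f Q) : LocallyIntegrableOn f U :=
  (locallyIntegrableOn_iff hU.isLocallyClosed).2 h

/-- For a fixed test function both sides of the defining identity are continuous in the pair: the
volume is finite, so L² convergence implies L¹ convergence, which passes to compact subsets of a
chart. This is the completeness of H¹. -/
theorem isClosed_weakGraph {g : Metric I M} (𝓕 : AdaptedFrame g) :
    IsClosed (weakGraph 𝓕 : Set (PairSpace g)) := by
  refine IsSeqClosed.isClosed fun z z₀ hz hlim => ?_
  have hz' : ∀ k, IsWeakGrad g (z k).fst (𝓕.field (z k).snd) := hz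
  change IsWeakGrad g z₀.fst (𝓕.field z₀.snd)
  rw [isWeakGrad_iff]
  intro e he
  have hem := IsManifold.subset_maximalAtlas (I := I) (n := ∞) he
  have l1 : Filter.Tendsto (fun k => ∫⁻ p, ‖(z k).fst p - z₀.fst p‖ₑ ∂(vol g)) Filter.atTop (𝓝 0) :=
    tendsto_lintegral_of_tendsto_Lp (((continuous_fst_pairSpace g).tendsto _).comp hlim)
  have l2 : Filter.Tendsto (fun k => ∫⁻ p, ‖(z k).snd p - z₀.snd p‖ₑ ∂(vol g)) Filter.atTop (𝓝 0) :=
    tendsto_lintegral_of_tendsto_Lp (((continuous_snd_pairSpace g).tendsto _).comp hlim)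
  have m1 : ∀ w : PairSpace g, AEStronglyMeasurable w.fst ((vol g).restrict e.source) :=
    fun w => (Lp.aestronglyMeasurable _).restrict
  have m2 : ∀ (w : PairSpace g) (α : Fin d), AEStronglyMeasurable (fun p => metricAt g p
      (𝓕.field w.snd p) (chartFrame I e p (EuclideanSpace.single α 1)))
      ((vol g).restrict e.source) := fun w α =>
    𝓕.aesm_chart e hem _ (𝓕.aesm_field (Lp.aestronglyMeasurable _)) _
  have f1 : ∀ (w : PairSpace g) (S : Set M), ∫⁻ p in S, ‖w.fst p‖ₑ ∂(vol g) < ⊤ := fun w S =>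
    (setLIntegral_le_lintegral _ _).trans_lt (lintegral_enorm_lt_top_of_Lp _)
  have f2 : ∀ (w : PairSpace g) (α : Fin d) {Q : Set 𝔼}, IsCompact Q → Q ⊆ (e.extend I).target →
      ∫⁻ p in chartPart I e Q, ‖metricAt g p
      (𝓕.field w.snd p) (chartFrame I e p (EuclideanSpace.single α 1))‖ₑ ∂(vol g) < ⊤ := by
    intro w α Q hQ hQT
    obtain ⟨C, hC⟩ := 𝓕.exists_chartCov_bound hem hQ hQT (EuclideanSpace.single α 1)
    calc _ ≤ ∫⁻ p in chartPart I e Q, C * ‖w.snd p‖ₑ ∂(vol g) :=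
          setLIntegral_mono' (measurableSet_chartPart hQ.measurableSet) fun p hp => hC p hp _
      _ ≤ ∫⁻ p, C * ‖w.snd p‖ₑ ∂(vol g) := setLIntegral_le_lintegral _ _
      _ = C * ∫⁻ p, ‖w.snd p‖ₑ ∂(vol g) := lintegral_const_mul' _ _ (by simp)
      _ < ⊤ := ENNReal.mul_lt_top (by simp) (lintegral_enorm_lt_top_of_Lp _)
  refine ⟨locallyIntegrableOn_of_forall_compact isOpen_interior fun Q hQU hQ =>
    integrableOn_chart hem (m1 _) hQ (hQU.trans interior_subset) (f1 _ _), fun α =>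
    ⟨locallyIntegrableOn_of_forall_compact isOpen_interior fun Q hQU hQ => ?_,
    fun ψ hψ hψc hψs => ?_⟩⟩
  · have hQT := hQU.trans interior_subset
    refine (integrableOn_chart hem (m2 z₀ α) hQ hQT (f2 z₀ α hQ hQT)).congr_fun
      (fun y hy => (chartCov_eq_on_target g _ α (hQT hy)).symm) hQ.measurableSet
  · have hψT := hψs.trans interior_subset
    have hds := tsupport_fderiv_apply_subset (ψ := ψ) (EuclideanSpace.single α (1 : ℝ))
    have t1 := tendsto_integral_chart hem (fun k => m1 (z k)) (m1 z₀)
      (continuous_fderiv_apply hψ (EuclideanSpace.single α (1 : ℝ)))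
      (hasCompactSupport_fderiv_apply hψc _) (hds.trans hψT) (fun k => f1 _ _) (f1 _ _)
      (tendsto_of_tendsto_of_tendsto_of_le_of_le tendsto_const_nhds l1 (fun _ => zero_le)
        fun k => setLIntegral_le_lintegral _ _)
    obtain ⟨C, hC⟩ := 𝓕.exists_chartCov_bound hem hψc hψT (EuclideanSpace.single α 1)
    have l3 : Filter.Tendsto (fun k => (C : ℝ≥0∞) * ∫⁻ p, ‖(z k).snd p - z₀.snd p‖ₑ ∂(vol g))
        Filter.atTop (𝓝 0) := by
      simpa using ENNReal.Tendsto.const_mul (a := (C : ℝ≥0∞)) l2 (Or.inr (by simp))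
    have t2 := tendsto_integral_chart hem (fun k => m2 (z k) α) (m2 z₀ α) hψ.continuous
      hψc hψT (fun k => f2 (z k) α hψc hψT) (f2 z₀ α hψc hψT)
      (tendsto_of_tendsto_of_tendsto_of_le_of_le tendsto_const_nhds l3 (fun _ => zero_le)
        fun k => by
          calc _ ≤ ∫⁻ p in chartPart I e (tsupport ψ),
                C * ‖(z k).snd p - z₀.snd p‖ₑ ∂(vol g) := by
                refine setLIntegral_mono' (measurableSet_chartPart (isClosed_tsupport ψ).measurableSet)
                  fun p hp => ?_
                have := hC p hp ((z k).snd p - z₀.snd p)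
                simpa only [AdaptedFrame.field, map_sub, sub_apply] using this
            _ ≤ ∫⁻ p, C * ‖(z k).snd p - z₀.snd p‖ₑ ∂(vol g) := setLIntegral_le_lintegral _ _
            _ = _ := lintegral_const_mul' _ _ (by simp))
    have hcov : ∀ w : PairSpace g, ∫ y, chartCov g e (𝓕.field w.snd) α y * ψ y =
        ∫ y, (fun p => metricAt g p (𝓕.field w.snd p)
          (chartFrame I e p (EuclideanSpace.single α 1))) ((e.extend I).symm y) * ψ y := by
      intro w
      refine integral_congr_ae (Filter.Eventually.of_forall fun y => ?_)
      by_cases hyψ : y ∈ tsupport ψ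
      · simp only
        rw [chartCov_eq_on_target g _ α (hψT hyψ)]
      · simp [image_eq_zero_of_notMem_tsupport hyψ]
    have hk := fun k => ((isWeakGrad_iff.1 (hz' k) e he).2 α).2 ψ hψ hψc hψs
    simp only [hcov] at hk ⊢
    exact tendsto_nhds_unique t1 (t2.neg.congr fun k => (hk k).symm)

/-- By uniqueness of the weak gradient a pair of the graph is determined by its function, which
permits passing from Sobolev functions to pairs and back. -/
theorem eq_of_mem_weakGraph {g : Metric I M} {𝓕 : AdaptedFrame g} {z w : PairSpace g}
    (hz : z ∈ weakGraph 𝓕) (hw : w ∈ weakGraph 𝓕) (h : z.fst =ᵐ[vol g] w.fst) : z = w := by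
  have h1 := IsWeakGrad.ae_unique hz hw h
  have h2 : z.fst = w.fst := Lp.ext h
  have h3 : z.snd = w.snd := by
    refine Lp.ext ?_
    filter_upwards [h1] with p hp
    rw [← 𝓕.symm_field z.snd p, ← 𝓕.symm_field w.snd p, hp]
  exact (WithLp.ofLp_injective 2) (Prod.ext h2 h3)

end PairSpace

end SchwarzManifold
end

/-! ### The energy form, and the Sobolev spaces as spaces of pairs -/

noncomputable section

namespace SchwarzManifold

set_option linter.unusedSectionVars false

theorem integral_norm_sq_Lp {F : Type*} [NormedAddCommGroup F] [InnerProductSpace ℝ F] {α : Type*}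
    [MeasurableSpace α] {μ : Measure α} (f : Lp F 2 μ) : ∫ p, ‖f p‖ ^ 2 ∂μ = ‖f‖ ^ 2 := by
  have := L2.inner_def (𝕜 := ℝ) f f
  rw [real_inner_self_eq_norm_sq] at this
  simpa only [real_inner_self_eq_norm_sq] using this.symm

theorem integrable_norm_sq_Lp {F : Type*} [NormedAddCommGroup F] {α : Type*}
    [MeasurableSpace α] {μ : Measure α} (f : Lp F 2 μ) : Integrable (fun p => ‖f p‖ ^ 2) μ :=
  (memLp_two_iff_integrable_sq_norm (Lp.aestronglyMeasurable _)).1 (Lp.memLp f)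

theorem integrable_norm_mul_Lp {F G : Type*} [NormedAddCommGroup F] [NormedAddCommGroup G]
    {α : Type*} [MeasurableSpace α] {μ : Measure α} (f : Lp F 2 μ) (h : Lp G 2 μ) :
    Integrable (fun p => ‖f p‖ * ‖h p‖) μ :=
  (Lp.memLp f).norm.integrable_mul (Lp.memLp h).norm

section Energy

variable {d : ℕ} {H : Type*} [TopologicalSpace H]
  {I : ModelWithCorners ℝ (EuclideanSpace ℝ (Fin d)) H}
  {M : Type*} [TopologicalSpace M] [ChartedSpace H M] [IsManifold I ∞ M]
  [MeasurableSpace M] [BorelSpace M] [CompactSpace M]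
  {e e' : OpenPartialHomeomorph M H}

local notation "𝔼" => EuclideanSpace ℝ (Fin d)

theorem WithLp_norm_sq {g : Metric I M} (z : PairSpace g) :
    ‖z‖ ^ 2 = ‖z.fst‖ ^ 2 + ‖z.snd‖ ^ 2 := WithLp.prod_norm_sq_eq_of_L2 z

/-- The inner product of the vector fields of two pairs. -/
def pairInner {g : Metric I M} (𝓕 : AdaptedFrame g) (z w : PairSpace g) (p : M) : ℝ :=
  metricAt g p (𝓕.field z.snd p) (𝓕.field w.snd p)

theorem integrable_pairInner {g : Metric I M} (𝓕 : AdaptedFrame g) (z w : PairSpace g) :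
    Integrable (pairInner 𝓕 z w) (vol g) := by
  refine ((integrable_norm_mul_Lp z.snd w.snd).const_mul 𝓕.K).mono'
    (𝓕.aesm_inner _ _ (𝓕.aesm_field (Lp.aestronglyMeasurable _))
      (𝓕.aesm_field (Lp.aestronglyMeasurable _))) ?_
  exact Filter.Eventually.of_forall fun p => 𝓕.abs_metricAt_field_le p _ _

theorem integrable_fst_mul {g : Metric I M} (u v : Lp ℝ 2 (vol g)) :
    Integrable (fun p => u p * v p) (vol g) :=
  (Lp.memLp u).integrable_mul (Lp.memLp v)

theorem pairInner_add_left {g : Metric I M} (𝓕 : AdaptedFrame g) (z z' w : PairSpace g) :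
    pairInner 𝓕 (z + z') w =ᵐ[vol g] fun p => pairInner 𝓕 z w p + pairInner 𝓕 z' w p := by
  filter_upwards [Lp.coeFn_add z.snd z'.snd] with p hp
  simp only [pairInner, AdaptedFrame.field, WithLp.add_snd]
  rw [hp, Pi.add_apply, map_add, map_add, add_apply]

theorem pairInner_smul_left {g : Metric I M} (𝓕 : AdaptedFrame g) (c : ℝ) (z w : PairSpace g) :
    pairInner 𝓕 (c • z) w =ᵐ[vol g] fun p => c * pairInner 𝓕 z w p := by
  filter_upwards [Lp.coeFn_smul c z.snd] with p hp
  simp only [pairInner, AdaptedFrame.field, WithLp.smul_snd]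
  rw [hp, Pi.smul_apply, map_smul, map_smul, smul_apply, smul_eq_mul]

theorem pairInner_comm {g : Metric I M} (𝓕 : AdaptedFrame g) (z w : PairSpace g) (p : M) :
    pairInner 𝓕 z w p = pairInner 𝓕 w z p := metricAt_comm g p _ _

/-- The Dirichlet form `∫ ⟨X, Y⟩` on pairs. -/
def dirichletForm {g : Metric I M} (𝓕 : AdaptedFrame g) : LinearMap.BilinForm ℝ (PairSpace g) :=
  LinearMap.mk₂ ℝ (fun z w => ∫ p, pairInner 𝓕 z w p ∂(vol g))
    (fun z z' w => by
      rw [integral_congr_ae (pairInner_add_left 𝓕 z z' w), integral_add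
        (integrable_pairInner 𝓕 _ _) (integrable_pairInner 𝓕 _ _)])
    (fun c z w => by
      rw [integral_congr_ae (pairInner_smul_left 𝓕 c z w), integral_const_mul, smul_eq_mul])
    (fun z w w' => by
      simp only [pairInner_comm 𝓕 z]
      rw [integral_congr_ae (pairInner_add_left 𝓕 w w' z), integral_add
        (integrable_pairInner 𝓕 _ _) (integrable_pairInner 𝓕 _ _)])
    (fun c z w => by
      simp only [pairInner_comm 𝓕 z]
      rw [integral_congr_ae (pairInner_smul_left 𝓕 c w z), integral_const_mul, smul_eq_mul])

theorem dirichletForm_apply {g : Metric I M} (𝓕 : AdaptedFrame g) (z w : PairSpace g) :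
    dirichletForm 𝓕 z w = ∫ p, pairInner 𝓕 z w p ∂(vol g) := rfl

theorem dirichletForm_comm {g : Metric I M} (𝓕 : AdaptedFrame g) (z w : PairSpace g) :
    dirichletForm 𝓕 z w = dirichletForm 𝓕 w z := by
  simp only [dirichletForm_apply, pairInner_comm 𝓕 z]

theorem dirichletForm_self_nonneg {g : Metric I M} (𝓕 : AdaptedFrame g) (z : PairSpace g) :
    0 ≤ dirichletForm 𝓕 z z :=
  integral_nonneg fun p => metricAt_self_nonneg g p _

theorem dirichletForm_self_le {g : Metric I M} (𝓕 : AdaptedFrame g) (z : PairSpace g) :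
    dirichletForm 𝓕 z z ≤ 𝓕.K * ‖z.snd‖ ^ 2 := by
  rw [← integral_norm_sq_Lp, ← integral_const_mul, dirichletForm_apply]
  exact integral_mono (integrable_pairInner 𝓕 _ _) ((integrable_norm_sq_Lp _).const_mul _)
    fun p => 𝓕.upper p _

theorem norm_snd_sq_le {g : Metric I M} (𝓕 : AdaptedFrame g) (z : PairSpace g) :
    ‖z.snd‖ ^ 2 ≤ 𝓕.K * dirichletForm 𝓕 z z := by
  rw [← integral_norm_sq_Lp, dirichletForm_apply, ← integral_const_mul]
  exact integral_mono (integrable_norm_sq_Lp _) ((integrable_pairInner 𝓕 _ _).const_mul _)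
    fun p => 𝓕.lower p _

theorem abs_dirichletForm_le {g : Metric I M} (𝓕 : AdaptedFrame g) (z w : PairSpace g) :
    |dirichletForm 𝓕 z w| ≤ 𝓕.K * (‖z.snd‖ * ‖w.snd‖) := by
  have h1 := LinearMap.BilinForm.apply_mul_apply_le_of_forall_zero_le (dirichletForm 𝓕)
    (dirichletForm_self_nonneg 𝓕) z w
  rw [dirichletForm_comm 𝓕 w z] at h1
  have h2 := dirichletForm_self_le 𝓕 z
  have h3 := dirichletForm_self_le 𝓕 w
  have h4 := 𝓕.K_pos
  refine abs_le_of_sq_le_sq ?_ (by positivity)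
  calc _ = _ := sq _
    _ ≤ _ := h1
    _ ≤ (𝓕.K * ‖z.snd‖ ^ 2) * (𝓕.K * ‖w.snd‖ ^ 2) :=
      mul_le_mul h2 h3 (dirichletForm_self_nonneg 𝓕 _) (by positivity)
    _ = _ := by ring

/-- The Dirichlet form as a continuous bilinear form. -/
def dirichletFormL {g : Metric I M} (𝓕 : AdaptedFrame g) :
    PairSpace g →L[ℝ] PairSpace g →L[ℝ] ℝ :=
  LinearMap.mkContinuous₂ (dirichletForm 𝓕) 𝓕.K fun z w => by
    refine (abs_dirichletForm_le 𝓕 z w).trans ?_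
    rw [mul_assoc]
    have h := 𝓕.K_pos
    gcongr
    · refine abs_le_of_sq_le_sq' ?_ (norm_nonneg _) |>.2
      rw [WithLp_norm_sq z]
      nlinarith [sq_nonneg ‖z.fst‖]
    · refine abs_le_of_sq_le_sq' ?_ (norm_nonneg _) |>.2
      rw [WithLp_norm_sq w]
      nlinarith [sq_nonneg ‖w.fst‖]

/-- The energy form `∫ ⟨X, Y⟩ + b u v` on pairs. -/
def energyForm {g : Metric I M} (𝓕 : AdaptedFrame g) (b : ℝ) :
    PairSpace g →L[ℝ] PairSpace g →L[ℝ] ℝ :=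
  dirichletFormL 𝓕 + b • (innerSL ℝ).bilinearComp (WithLp.fstL 2 ℝ _ _) (WithLp.fstL 2 ℝ _ _)

theorem energyForm_apply {g : Metric I M} (𝓕 : AdaptedFrame g) (b : ℝ) (z w : PairSpace g) :
    energyForm 𝓕 b z w = dirichletForm 𝓕 z w + b * inner ℝ z.fst w.fst := rfl

theorem energyForm_comm {g : Metric I M} (𝓕 : AdaptedFrame g) (b : ℝ) (z w : PairSpace g) :
    energyForm 𝓕 b z w = energyForm 𝓕 b w z := by
  rw [energyForm_apply, energyForm_apply, dirichletForm_comm, real_inner_comm]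

theorem inner_Lp_eq {g : Metric I M} (u v : Lp ℝ 2 (vol g)) :
    inner ℝ u v = ∫ p, u p * v p ∂(vol g) := by
  rw [L2.inner_def]
  refine integral_congr_ae (Filter.Eventually.of_forall fun p => ?_)
  simp [mul_comm]

theorem energyForm_eq_integral {g : Metric I M} (𝓕 : AdaptedFrame g) (b : ℝ) (z w : PairSpace g) :
    energyForm 𝓕 b z w =
      ∫ p, (pairInner 𝓕 z w p + b * z.fst p * w.fst p) ∂(vol g) := by
  rw [energyForm_apply, inner_Lp_eq, dirichletForm_apply, ← integral_const_mul, ← integral_add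
    (integrable_pairInner 𝓕 z w) ((integrable_fst_mul _ _).const_mul b)]
  simp only [mul_assoc]

theorem gradInner_eq (g : Metric I M) (u v : M → ℝ) (p : M) :
    gradInner g u v p = metricAt g p (weakGrad g u p) (weakGrad g v p) := rfl

/-- `weakGrad` is an arbitrary choice among weak gradients; uniqueness almost everywhere identifies
it with the field of the pair. -/
theorem gradInner_ae_eq {g : Metric I M} {𝓕 : AdaptedFrame g} {z w : PairSpace g}
    (hz : z ∈ weakGraph 𝓕) (hw : w ∈ weakGraph 𝓕) {u v : M → ℝ} (hu : u =ᵐ[vol g] z.fst)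
    (hv : v =ᵐ[vol g] w.fst) : gradInner g u v =ᵐ[vol g] pairInner 𝓕 z w := by
  have h1 : IsWeakGrad g u (𝓕.field z.snd) := IsWeakGrad.congr hz hu.symm Filter.EventuallyEq.rfl
  have h2 : IsWeakGrad g v (𝓕.field w.snd) := IsWeakGrad.congr hw hv.symm Filter.EventuallyEq.rfl
  filter_upwards [(isWeakGrad_weakGrad h1).ae_unique h1 Filter.EventuallyEq.rfl,
    (isWeakGrad_weakGrad h2).ae_unique h2 Filter.EventuallyEq.rfl] with p hp1 hp2
  rw [gradInner_eq, hp1, hp2]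
  rfl

theorem h1Norm_eq {g : Metric I M} {𝓕 : AdaptedFrame g} {z : PairSpace g}
    (hz : z ∈ weakGraph 𝓕) {u : M → ℝ} (hu : u =ᵐ[vol g] z.fst) :
    h1Norm g u = Real.sqrt (energyForm 𝓕 1 z z) := by
  rw [h1Norm, energyForm_eq_integral]
  congr 1
  refine integral_congr_ae ?_
  filter_upwards [gradInner_ae_eq hz hz hu hu, hu] with p hp1 hp2
  rw [hp1, hp2]
  ring

theorem energyForm_one_self_le {g : Metric I M} (𝓕 : AdaptedFrame g) (z : PairSpace g) :
    energyForm 𝓕 1 z z ≤ (𝓕.K + 1) * ‖z‖ ^ 2 := by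
  rw [energyForm_apply, WithLp_norm_sq, real_inner_self_eq_norm_sq]
  have h1 := dirichletForm_self_le 𝓕 z
  have h2 := 𝓕.K_pos
  nlinarith [sq_nonneg ‖z.fst‖, sq_nonneg ‖z.snd‖]

theorem norm_sq_le_energyForm_one {g : Metric I M} (𝓕 : AdaptedFrame g) (z : PairSpace g) :
    ‖z‖ ^ 2 ≤ (𝓕.K + 1) * energyForm 𝓕 1 z z := by
  rw [energyForm_apply, WithLp_norm_sq, real_inner_self_eq_norm_sq]
  have h1 := norm_snd_sq_le 𝓕 z
  have h2 := 𝓕.K_pos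
  have h3 := dirichletForm_self_nonneg 𝓕 z
  nlinarith [sq_nonneg ‖z.fst‖, sq_nonneg ‖z.snd‖]

theorem h1Norm_le_norm {g : Metric I M} {𝓕 : AdaptedFrame g} {z : PairSpace g}
    (hz : z ∈ weakGraph 𝓕) {u : M → ℝ} (hu : u =ᵐ[vol g] z.fst) :
    h1Norm g u ≤ Real.sqrt (𝓕.K + 1) * ‖z‖ := by
  rw [h1Norm_eq hz hu, ← Real.sqrt_sq (norm_nonneg z), ← Real.sqrt_mul (by
    have := 𝓕.K_pos; positivity)]
  exact Real.sqrt_le_sqrt (energyForm_one_self_le 𝓕 z)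

theorem norm_le_h1Norm {g : Metric I M} {𝓕 : AdaptedFrame g} {z : PairSpace g}
    (hz : z ∈ weakGraph 𝓕) {u : M → ℝ} (hu : u =ᵐ[vol g] z.fst) :
    ‖z‖ ≤ Real.sqrt (𝓕.K + 1) * h1Norm g u := by
  rw [h1Norm_eq hz hu, ← Real.sqrt_mul (by have := 𝓕.K_pos; positivity)]
  exact Real.le_sqrt_of_sq_le (norm_sq_le_energyForm_one 𝓕 z)

/-- The lower frame bound turns integrability of ⟨∇u, ∇u⟩ into square integrability of the
components of ∇u; the upper bound gives the converse. -/
theorem mem_H1_iff {g : Metric I M} (𝓕 : AdaptedFrame g) {u : Lp ℝ 2 (vol g)} :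
    u ∈ H1 g ↔ ∃ z ∈ weakGraph 𝓕, z.fst = u := by
  constructor
  · rintro ⟨⟨X, hX⟩, hint⟩
    have hX' : IsWeakGrad g u X := hX
    have h1 := isWeakGrad_weakGrad hX'
    have h2 := h1.aesm 𝓕
    set Y : M → 𝔼 := weakGrad g u with hY
    have h3 : MemLp (fun p => (𝓕.frame p).symm (Y p)) 2 (vol g) := by
      rw [memLp_two_iff_integrable_sq_norm h2]
      refine (hint.const_mul 𝓕.K).mono' (h2.norm.pow 2) (Filter.Eventually.of_forall fun p => ?_)
      rw [Real.norm_of_nonneg (by positivity)]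
      have := 𝓕.lower p ((𝓕.frame p).symm (Y p))
      rw [ContinuousLinearEquiv.apply_symm_apply] at this
      exact this
    refine ⟨WithLp.toLp 2 (u, h3.toLp _), ?_, rfl⟩
    refine IsWeakGrad.congr h1 Filter.EventuallyEq.rfl ?_
    change Y =ᵐ[vol g] 𝓕.field (h3.toLp _)
    filter_upwards [h3.coeFn_toLp] with p hp
    rw [AdaptedFrame.field, hp, ContinuousLinearEquiv.apply_symm_apply]
  · rintro ⟨z, hz, rfl⟩
    exact ⟨⟨_, hz⟩, (integrable_pairInner 𝓕 z z).congr
      (gradInner_ae_eq hz hz Filter.EventuallyEq.rfl Filter.EventuallyEq.rfl).symm⟩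

theorem differential_chartDeriv (he : e ∈ IsManifold.maximalAtlas I ∞ M) {φ : M → ℝ}
    (hφ : ContMDiff I 𝓘(ℝ, ℝ) ∞ φ) {y : 𝔼} (hy : y ∈ (e.extend I).target) (v : 𝔼) :
    differential I φ ((e.extend I).symm y) (chartDeriv I e y v) =
      fderivWithin ℝ (fun y => φ ((e.extend I).symm y)) (e.extend I).target y v := by
  have hu : UniqueMDiffWithinAt 𝓘(ℝ, 𝔼) (e.extend I).target y :=
    (uniqueDiffOn_extend_target y hy).uniqueMDiffWithinAt
  have h1 := mfderiv_comp_mfderivWithin (I' := I) (I'' := 𝓘(ℝ, ℝ)) y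
    (hφ.mdifferentiableAt (by simp))
    ((mdifferentiableWithinAt_extend_symm he hy).mono e.extend_target_subset_range) hu
  rw [chartDeriv_eq_target he hy]
  have h2 := congrArg (fun A : 𝔼 →L[ℝ] ℝ => A v) h1
  refine h2.symm.trans ?_
  rw [mfderivWithin_eq_fderivWithin]
  rfl

/-- The classical gradient is comparable with the Euclidean derivative on compact subsets of a
chart. -/
theorem exists_classicalGrad_bounds (g : Metric I M) (he : e ∈ IsManifold.maximalAtlas I ∞ M)
    {Q : Set 𝔼} (hQ : IsCompact Q) (hQT : Q ⊆ (e.extend I).target) :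
    ∃ K : ℝ, 0 < K ∧ ∀ φ : M → ℝ, ContMDiff I 𝓘(ℝ, ℝ) ∞ φ → ∀ y ∈ Q,
      metricAt g ((e.extend I).symm y) (classicalGrad g φ ((e.extend I).symm y))
        (classicalGrad g φ ((e.extend I).symm y)) ≤
        K * ‖fderivWithin ℝ (fun y => φ ((e.extend I).symm y)) (e.extend I).target y‖ ^ 2 ∧
      ‖fderivWithin ℝ (fun y => φ ((e.extend I).symm y)) (e.extend I).target y‖ ^ 2 ≤ K *
        metricAt g ((e.extend I).symm y) (classicalGrad g φ ((e.extend I).symm y))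
          (classicalGrad g φ ((e.extend I).symm y)) := by
  obtain ⟨K, hK0, hK⟩ := exists_metricForm_bounds g he hQ hQT
  refine ⟨K, hK0, fun φ hφ y hy => ?_⟩
  have hl : ∀ v, metricAt g ((e.extend I).symm y) (classicalGrad g φ ((e.extend I).symm y))
      (chartDeriv I e y v) =
      fderivWithin ℝ (fun y => φ ((e.extend I).symm y)) (e.extend I).target y v := fun v => by
    rw [metricAt_classicalGrad, differential_chartDeriv he hφ (hQT hy)]
  set q := metricAt g ((e.extend I).symm y) (classicalGrad g φ ((e.extend I).symm y))
          (classicalGrad g φ ((e.extend I).symm y)) with hq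
  have hq0 : 0 ≤ q := metricAt_self_nonneg g _ _
  refine ⟨sq_norm_le_of_forall_metricAt g (chartDeriv_injective he (hQT hy))
    (fun v => (hK y hy v).1) _ hl, ?_⟩
  have h1 : ‖fderivWithin ℝ (fun y => φ ((e.extend I).symm y)) (e.extend I).target y‖ ≤
      Real.sqrt (K * q) := by
    refine ContinuousLinearMap.opNorm_le_bound _ (Real.sqrt_nonneg _) fun v => ?_
    refine abs_le_of_sq_le_mul (Real.sqrt_nonneg _) (norm_nonneg _) ?_
    rw [Real.sq_sqrt (by positivity), ← hl]
    calc _ ≤ _ := metricAt_cauchy_schwarz g _ _ _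
      _ ≤ q * (K * ‖v‖ ^ 2) := mul_le_mul_of_nonneg_left (hK y hy v).2 hq0
      _ = _ := by ring
  calc _ ≤ (Real.sqrt (K * q)) ^ 2 := by gcongr
    _ = _ := Real.sq_sqrt (by positivity)

theorem exists_chartPart_compact_mem_nhds (p : M) : ∃ Q : Set 𝔼, IsCompact Q ∧
    Q ⊆ ((chartAt H p).extend I).target ∧ chartPart I (chartAt H p) Q ∈ 𝓝 p := by
  obtain ⟨r, hr, -, hrT, hnhds⟩ := exists_chartPart_mem_nhds (I := I) (mem_chart_source H p)
    Filter.univ_mem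
  refine ⟨_, (isCompact_closedBall _ r).inter_right I.isClosed_range, hrT,
    Filter.mem_of_superset (hnhds r hr) ?_⟩
  rintro q ⟨hq, hq'⟩
  exact ⟨hq, Metric.ball_subset_closedBall hq', mem_range_self _⟩

/-- Local bounds in charts, where the gradient is comparable with a continuous derivative, are
joined by compactness of `M`. -/
theorem exists_bound_classicalGrad (g : Metric I M) {φ : M → ℝ}
    (hφ : ContMDiff I 𝓘(ℝ, ℝ) ∞ φ) :
    ∃ B : ℝ, ∀ p, metricAt g p (classicalGrad g φ p) (classicalGrad g φ p) ≤ B := by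
  have := isCompact_univ.induction_on
    (p := fun s : Set M => ∃ B : ℝ, ∀ p ∈ s,
      metricAt g p (classicalGrad g φ p) (classicalGrad g φ p) ≤ B)
    ⟨0, by simp⟩ (fun s t hst ⟨B, hB⟩ => ⟨B, fun p hp => hB p (hst hp)⟩)
    (fun s t ⟨B, hB⟩ ⟨B', hB'⟩ => ⟨max B B', fun p hp => hp.elim
      (fun h => (hB p h).trans (le_max_left _ _)) (fun h => (hB' p h).trans (le_max_right _ _))⟩)
    (fun p _ => by
      obtain ⟨Q, hQ, hQT, hn⟩ := exists_chartPart_compact_mem_nhds (I := I) p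
      have he := IsManifold.chart_mem_maximalAtlas (I := I) (n := ∞) p
      obtain ⟨K, hK0, hK⟩ := exists_classicalGrad_bounds g he hQ hQT
      have hc : ContinuousOn (fderivWithin ℝ (fun y => φ (((chartAt H p).extend I).symm y))
          ((chartAt H p).extend I).target) Q :=
        ((contDiffOn_comp_extend_symm he hφ).continuousOn_fderivWithin
          uniqueDiffOn_extend_target (by simp)).mono hQT
      obtain ⟨B, hB⟩ := hQ.exists_bound_of_continuousOn hc
      refine ⟨_, mem_nhdsWithin_of_mem_nhds hn, K * B ^ 2, fun q hq => ?_⟩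
      have h1 := (hK φ hφ _ hq.2).1
      rw [OpenPartialHomeomorph.extend_left_inv _ hq.1] at h1
      refine h1.trans ?_
      have := hB _ hq.2
      gcongr)
  obtain ⟨B, hB⟩ := this
  exact ⟨B, fun p => hB p (mem_univ p)⟩

theorem memLp_of_continuous (g : Metric I M) {φ : M → ℝ} (hφ : Continuous φ) :
    MemLp φ 2 (vol g) := by
  obtain ⟨B, hB⟩ := isCompact_univ.exists_bound_of_continuousOn hφ.continuousOn
  exact MemLp.of_bound hφ.aestronglyMeasurable B
    (Filter.Eventually.of_forall fun p => hB p (mem_univ p))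

/-- A smooth function and its gradient form a pair of the graph. -/
theorem exists_smooth_pair {g : Metric I M} (𝓕 : AdaptedFrame g) {φ : M → ℝ}
    (hφ : ContMDiff I 𝓘(ℝ, ℝ) ∞ φ) : ∃ z ∈ weakGraph 𝓕, z.fst =ᵐ[vol g] φ ∧
      𝓕.field z.snd =ᵐ[vol g] classicalGrad g φ := by
  have hw := isWeakGrad_classicalGrad g hφ
  have h1 := memLp_of_continuous g hφ.continuous
  obtain ⟨B, hB⟩ := exists_bound_classicalGrad g hφ
  have h2 : MemLp (fun p => (𝓕.frame p).symm (classicalGrad g φ p)) 2 (vol g) := by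
    refine MemLp.of_bound (hw.aesm 𝓕) (Real.sqrt (𝓕.K * B)) (Filter.Eventually.of_forall fun p => ?_)
    refine Real.le_sqrt_of_sq_le ?_
    have := 𝓕.lower p ((𝓕.frame p).symm (classicalGrad g φ p))
    rw [ContinuousLinearEquiv.apply_symm_apply] at this
    exact this.trans (mul_le_mul_of_nonneg_left (hB p) 𝓕.K_pos.le)
  have h3 : 𝓕.field (h2.toLp _) =ᵐ[vol g] classicalGrad g φ := by
    filter_upwards [h2.coeFn_toLp] with p hp
    rw [AdaptedFrame.field, hp, ContinuousLinearEquiv.apply_symm_apply]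
  exact ⟨WithLp.toLp 2 (h1.toLp _, h2.toLp _), hw.congr h1.coeFn_toLp.symm h3.symm,
    h1.coeFn_toLp, h3⟩

/-- The pairs given by smooth functions with compact support in the manifold interior of `K`. -/
def testPairs {g : Metric I M} (𝓕 : AdaptedFrame g) (K : Set M) : Submodule ℝ (PairSpace g) where
  carrier := {z | z ∈ weakGraph 𝓕 ∧ ∃ φ : M → ℝ, ContMDiff I 𝓘(ℝ, ℝ) ∞ φ ∧
    tsupport φ ⊆ interior K ∩ I.interior M ∧ z.fst =ᵐ[vol g] φ}
  add_mem' := by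
    rintro z w ⟨hz, φ, hφ, hφs, hzφ⟩ ⟨hw, ψ, hψ, hψs, hwψ⟩
    refine ⟨add_mem hz hw, fun p => φ p + ψ p, hφ.add hψ,
      (tsupport_add φ ψ).trans (union_subset hφs hψs), ?_⟩
    filter_upwards [Lp.coeFn_add z.fst w.fst, hzφ, hwψ] with p hp h1 h2
    rw [WithLp.add_fst, hp, Pi.add_apply, h1, h2]
  zero_mem' := ⟨zero_mem _, fun _ => 0, contMDiff_const, by simp [tsupport], Lp.coeFn_zero _ _ _⟩
  smul_mem' := by
    rintro c z ⟨hz, φ, hφ, hφs, hzφ⟩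
    refine ⟨Submodule.smul_mem _ c hz, fun p => c * φ p, contMDiff_const.mul hφ,
      (closure_mono fun p hp => ?_).trans hφs, ?_⟩
    · intro h; exact hp (by simp [h])
    · filter_upwards [Lp.coeFn_smul c z.fst, hzφ] with p hp h1
      rw [WithLp.smul_fst, hp, Pi.smul_apply, h1, smul_eq_mul]

/-- The space of pairs that corresponds to `H10 g K`. -/
def pairH10 {g : Metric I M} (𝓕 : AdaptedFrame g) (K : Set M) : Submodule ℝ (PairSpace g) :=
  (testPairs 𝓕 K).topologicalClosure

theorem pairH10_le_weakGraph {g : Metric I M} (𝓕 : AdaptedFrame g) (K : Set M) :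
    pairH10 𝓕 K ≤ weakGraph 𝓕 :=
  Submodule.topologicalClosure_minimal _ (fun _ hz => hz.1) (isClosed_weakGraph 𝓕)

theorem pairH10_mono {g : Metric I M} (𝓕 : AdaptedFrame g) {K K' : Set M} (h : K ⊆ K') :
    pairH10 𝓕 K ≤ pairH10 𝓕 K' := by
  refine Submodule.topologicalClosure_mono ?_
  rintro z ⟨hz, φ, hφ, hφs, hzφ⟩
  exact ⟨hz, φ, hφ, hφs.trans (inter_subset_inter_left _ (interior_mono h)), hzφ⟩

theorem isClosed_pairH10 {g : Metric I M} (𝓕 : AdaptedFrame g) (K : Set M) :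
    IsClosed (pairH10 𝓕 K : Set (PairSpace g)) := Submodule.isClosed_topologicalClosure _

theorem sub_fst_ae_eq {g : Metric I M} {z w : PairSpace g} {u v : M → ℝ}
    (hu : u =ᵐ[vol g] z.fst) (hv : v =ᵐ[vol g] w.fst) :
    (fun p => u p - v p) =ᵐ[vol g] (z - w).fst := by
  filter_upwards [Lp.coeFn_sub z.fst w.fst, hu, hv] with p hp h1 h2
  rw [WithLp.sub_fst, hp, Pi.sub_apply, h1, h2]

/-- `h1Norm` and the norm of pairs are equivalent on the graph, so the approximation clause of `H10`
is membership in a closure. Compactness of supports is automatic on a compact manifold. -/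
theorem mem_H10_iff {g : Metric I M} (𝓕 : AdaptedFrame g) {K : Set M} {u : Lp ℝ 2 (vol g)} :
    u ∈ H10 g K ↔ ∃ z ∈ pairH10 𝓕 K, z.fst = u := by
  have hs : 0 < Real.sqrt (𝓕.K + 1) := Real.sqrt_pos.2 (by have := 𝓕.K_pos; positivity)
  constructor
  · rintro ⟨hu, happ⟩
    obtain ⟨z, hz, rfl⟩ := (mem_H1_iff 𝓕).1 hu
    refine ⟨z, ?_, rfl⟩
    change z ∈ closure (testPairs 𝓕 K : Set (PairSpace g))
    rw [Metric.mem_closure_iff]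
    intro ε hε
    obtain ⟨φ, hφ, -, hφs, hlt⟩ := happ (ε / Real.sqrt (𝓕.K + 1)) (by positivity)
    obtain ⟨w, hw, hw1, -⟩ := exists_smooth_pair 𝓕 hφ
    refine ⟨w, ⟨hw, φ, hφ, hφs, hw1⟩, ?_⟩
    rw [dist_eq_norm]
    refine (norm_le_h1Norm (sub_mem hz hw)
      (sub_fst_ae_eq Filter.EventuallyEq.rfl hw1.symm)).trans_lt ?_
    rwa [lt_div_iff₀' hs] at hlt
  · rintro ⟨z, hz, rfl⟩
    have hzg := pairH10_le_weakGraph 𝓕 K hz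
    refine ⟨(mem_H1_iff 𝓕).2 ⟨z, hzg, rfl⟩, fun ε hε => ?_⟩
    have hz' : z ∈ closure (testPairs 𝓕 K : Set (PairSpace g)) := hz
    rw [Metric.mem_closure_iff] at hz'
    obtain ⟨w, ⟨hw, φ, hφ, hφs, hw1⟩, hlt⟩ := hz' (ε / Real.sqrt (𝓕.K + 1)) (by positivity)
    refine ⟨φ, hφ, HasCompactSupport.of_compactSpace _, hφs, ?_⟩
    rw [dist_eq_norm] at hlt
    refine (h1Norm_le_norm (sub_mem hzg hw)
      (sub_fst_ae_eq Filter.EventuallyEq.rfl hw1.symm)).trans_lt ?_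
    rwa [lt_div_iff₀' hs] at hlt

end Energy

end SchwarzManifold
end

/-! ### Multiplication by smooth functions and vanishing outside a subdomain -/

noncomputable section

namespace SchwarzManifold

set_option linter.unusedSectionVars false

section Multiplication

variable {d : ℕ} {H : Type*} [TopologicalSpace H]
  {I : ModelWithCorners ℝ (EuclideanSpace ℝ (Fin d)) H}
  {M : Type*} [TopologicalSpace M] [ChartedSpace H M] [IsManifold I ∞ M]
  [MeasurableSpace M] [BorelSpace M] [CompactSpace M]
  {e e' : OpenPartialHomeomorph M H}

local notation "𝔼" => EuclideanSpace ℝ (Fin d)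

theorem classicalGrad_mul (g : Metric I M) {χ φ : M → ℝ} (hχ : ContMDiff I 𝓘(ℝ, ℝ) ∞ χ)
    (hφ : ContMDiff I 𝓘(ℝ, ℝ) ∞ φ) (p : M) :
    classicalGrad g (fun q => χ q * φ q) p =
      χ p • classicalGrad g φ p + φ p • classicalGrad g χ p := by
  have h1 := (hχ.mdifferentiableAt (by simp) (x := p)).hasMFDerivAt.mul
    (hφ.mdifferentiableAt (by simp) (x := p)).hasMFDerivAt
  have h2 : differential I (fun q => χ q * φ q) p =
      χ p • differential I φ p + φ p • differential I χ p := h1.mfderiv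
  rw [classicalGrad, h2, map_add, map_smul, map_smul]
  rfl

theorem metricAt_add_self_le (g : Metric I M) (p : M) (v w : 𝔼) :
    metricAt g p (v + w) (v + w) ≤ 2 * metricAt g p v v + 2 * metricAt g p w w := by
  have h := metricAt_self_nonneg g p (v - w)
  simp only [map_add, map_sub, add_apply, sub_apply] at h ⊢
  linarith

/-- Multiplication by a smooth function is bounded with respect to the norm of pairs. -/
theorem exists_norm_mul_le {g : Metric I M} (𝓕 : AdaptedFrame g) {χ : M → ℝ}
    (hχ : ContMDiff I 𝓘(ℝ, ℝ) ∞ χ) : ∃ C : ℝ, 0 ≤ C ∧ ∀ φ : M → ℝ, ContMDiff I 𝓘(ℝ, ℝ) ∞ φ →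
      ∀ z ∈ weakGraph 𝓕, ∀ w ∈ weakGraph 𝓕, z.fst =ᵐ[vol g] φ →
      w.fst =ᵐ[vol g] (fun p => χ p * φ p) → ‖w‖ ≤ C * ‖z‖ := by
  obtain ⟨B, hB⟩ := isCompact_univ.exists_bound_of_continuousOn hχ.continuous.continuousOn
  obtain ⟨G, hG⟩ := exists_bound_classicalGrad g hχ
  have hK := 𝓕.K_pos
  -- From |∇(χφ)|² ≤ 2 χ²|∇φ|² + 2 φ²|∇χ|², with `B` bounding |χ| and `G` bounding |∇χ|²; the
  -- factors `𝓕.K` pass between the metric and the components in the frame.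
  refine ⟨Real.sqrt (B ^ 2 + 𝓕.K * (2 * B ^ 2 * 𝓕.K + 2 * |G|)), Real.sqrt_nonneg _,
    fun φ hφ z hz w hw hzφ hwφ => ?_⟩
  have hzX : 𝓕.field z.snd =ᵐ[vol g] classicalGrad g φ :=
    IsWeakGrad.ae_unique hz (isWeakGrad_classicalGrad g hφ) hzφ
  have hwX : 𝓕.field w.snd =ᵐ[vol g] classicalGrad g (fun p => χ p * φ p) :=
    IsWeakGrad.ae_unique hw (isWeakGrad_classicalGrad g (hχ.mul hφ)) hwφ
  have hB2 : ∀ p, χ p ^ 2 ≤ B ^ 2 := fun p => by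
    have := hB p (mem_univ p)
    rw [Real.norm_eq_abs] at this
    exact sq_le_sq' (by linarith [neg_abs_le (χ p)]) ((le_abs_self _).trans this)
  have h1 : ‖w.fst‖ ^ 2 ≤ B ^ 2 * ‖z.fst‖ ^ 2 := by
    rw [← integral_norm_sq_Lp, ← integral_norm_sq_Lp, ← integral_const_mul]
    refine integral_mono_ae (integrable_norm_sq_Lp _) ((integrable_norm_sq_Lp _).const_mul _) ?_
    filter_upwards [hzφ, hwφ] with p hp hp'
    rw [hp, hp', norm_mul, mul_pow, Real.norm_eq_abs, sq_abs]
    exact mul_le_mul_of_nonneg_right (hB2 p) (by positivity)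
  have h2 : dirichletForm 𝓕 w w ≤ 2 * B ^ 2 * dirichletForm 𝓕 z z + 2 * |G| * ‖z.fst‖ ^ 2 := by
    rw [← integral_norm_sq_Lp, dirichletForm_apply, dirichletForm_apply, ← integral_const_mul,
      ← integral_const_mul, ← integral_add ((integrable_pairInner 𝓕 _ _).const_mul _)
        ((integrable_norm_sq_Lp _).const_mul _)]
    refine integral_mono_ae (integrable_pairInner 𝓕 _ _)
      (((integrable_pairInner 𝓕 _ _).const_mul _).add ((integrable_norm_sq_Lp _).const_mul _)) ?_
    filter_upwards [hzφ, hzX, hwX] with p h3 h4 h5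
    simp only [pairInner]
    rw [h4, h5, h3, classicalGrad_mul g hχ hφ]
    refine (metricAt_add_self_le g p _ _).trans ?_
    simp only [map_smul, smul_apply, smul_eq_mul]
    have h6 := metricAt_self_nonneg g p (classicalGrad g φ p)
    have h7 : metricAt g p (classicalGrad g χ p) (classicalGrad g χ p) ≤ |G| :=
      (hG p).trans (le_abs_self G)
    rw [Real.norm_eq_abs, sq_abs]
    nlinarith [mul_le_mul_of_nonneg_right (hB2 p) h6, mul_le_mul_of_nonneg_left h7 (sq_nonneg (φ p))]
  have h3 := norm_snd_sq_le 𝓕 w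
  have h4 := dirichletForm_self_le 𝓕 z
  have h5 := dirichletForm_self_nonneg 𝓕 z
  refine abs_le_of_sq_le_sq' ?_ (by positivity) |>.2
  rw [mul_pow, Real.sq_sqrt (by positivity), WithLp_norm_sq, WithLp_norm_sq]
  have h6 : ‖w.snd‖ ^ 2 ≤ 𝓕.K * (2 * B ^ 2 * (𝓕.K * ‖z.snd‖ ^ 2) + 2 * |G| * ‖z.fst‖ ^ 2) := by
    refine h3.trans (mul_le_mul_of_nonneg_left (h2.trans ?_) hK.le)
    gcongr
  have h7 : 0 ≤ B ^ 2 * ‖z.snd‖ ^ 2 + 𝓕.K * (2 * B ^ 2 * 𝓕.K * ‖z.fst‖ ^ 2)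
    + 𝓕.K * (2 * |G| * ‖z.snd‖ ^ 2) := by positivity
  linarith

theorem ae_eq_of_lintegral_le {α : Type*} [MeasurableSpace α] {μ : Measure α} {u v : α → ℝ}
    (hu : AEStronglyMeasurable u μ) (hv : AEStronglyMeasurable v μ) {a : ℕ → ℝ≥0∞}
    (ha : Filter.Tendsto a Filter.atTop (𝓝 0)) (h : ∀ k, ∫⁻ p, ‖u p - v p‖ₑ ∂μ ≤ a k) :
    u =ᵐ[μ] v := by
  have h0 : ∫⁻ p, ‖u p - v p‖ₑ ∂μ = 0 := le_antisymm (ge_of_tendsto' ha h) zero_le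
  filter_upwards [(lintegral_eq_zero_iff' (hu.sub hv).enorm).1 h0] with p hp
  simpa [sub_eq_zero] using hp

/-- The product of an element of `H¹₀` with a smooth function. -/
theorem exists_mul_mem_pairH10 {g : Metric I M} (𝓕 : AdaptedFrame g) {χ : M → ℝ}
    (hχ : ContMDiff I 𝓘(ℝ, ℝ) ∞ χ) {K : Set M} (hK : tsupport χ ⊆ interior K) :
    ∃ C : ℝ, 0 ≤ C ∧ ∀ z ∈ pairH10 𝓕 univ, ∃ w ∈ pairH10 𝓕 K,
      w.fst =ᵐ[vol g] (fun p => χ p * z.fst p) ∧ ‖w‖ ≤ C * ‖z‖ := by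
  obtain ⟨C, hC0, hC⟩ := exists_norm_mul_le 𝓕 hχ
  obtain ⟨B, hB⟩ := isCompact_univ.exists_bound_of_continuousOn hχ.continuous.continuousOn
  refine ⟨C, hC0, fun z hz => ?_⟩
  obtain ⟨Z, hZ, hZlim⟩ := mem_closure_iff_seq_limit.1
    (show z ∈ closure (testPairs 𝓕 univ : Set (PairSpace g)) from hz)
  have hZ' : ∀ k, Z k ∈ weakGraph 𝓕 ∧ ∃ φ : M → ℝ, ContMDiff I 𝓘(ℝ, ℝ) ∞ φ ∧
    tsupport φ ⊆ interior univ ∩ I.interior M ∧ (Z k).fst =ᵐ[vol g] φ := hZ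
  choose hZg φ hφ hφs hZφ using hZ'
  choose W hWg hWφ hWX using fun k => exists_smooth_pair 𝓕 (hχ.mul (hφ k))
  -- Multiplication is bounded on smooth functions, so the products of `χ` with test functions
  -- approximating `z` form a Cauchy sequence; its limit is the required product.
  have hWd : ∀ k l, ‖W k - W l‖ ≤ C * ‖Z k - Z l‖ := by
    intro k l
    refine hC (fun p => φ k p - φ l p) ((hφ k).sub (hφ l)) _ (sub_mem (hZg k) (hZg l)) _
      (sub_mem (hWg k) (hWg l)) ?_ ?_
    · exact (sub_fst_ae_eq (hZφ k).symm (hZφ l).symm).symm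
    · refine (sub_fst_ae_eq (hWφ k).symm (hWφ l).symm).symm.trans
        (Filter.Eventually.of_forall fun p => ?_)
      simp only [Pi.mul_apply]
      ring
  have hWc : CauchySeq W := by
    have hZc := hZlim.cauchySeq
    rw [Metric.cauchySeq_iff] at hZc ⊢
    intro ε hε
    obtain ⟨N, hN⟩ := hZc (ε / (C + 1)) (by positivity)
    refine ⟨N, fun k hk l hl => ?_⟩
    have := hN k hk l hl
    rw [dist_eq_norm] at this ⊢
    rw [lt_div_iff₀ (by positivity)] at this
    nlinarith [hWd k l, norm_nonneg (Z k - Z l)]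
  obtain ⟨w, hw⟩ := cauchySeq_tendsto_of_complete hWc
  have hWK : ∀ k, W k ∈ testPairs 𝓕 K := fun k => ⟨hWg k, _, hχ.mul (hφ k), fun p hp =>
    ⟨hK (tsupport_mul_subset_left hp), (hφs k (tsupport_mul_subset_right hp)).2⟩, hWφ k⟩
  refine ⟨w, mem_closure_iff_seq_limit.2 ⟨W, hWK, hw⟩, ?_, ?_⟩
  · have l1 := tendsto_lintegral_of_tendsto_Lp (((continuous_fst_pairSpace g).tendsto _).comp hw)
    have l2 := tendsto_lintegral_of_tendsto_Lp (((continuous_fst_pairSpace g).tendsto _).comp hZlim)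
    have l3 := l1.add (ENNReal.Tendsto.const_mul (a := ENNReal.ofReal B) l2 (Or.inr (by simp)))
    rw [mul_zero, add_zero] at l3
    refine ae_eq_of_lintegral_le (Lp.aestronglyMeasurable _)
      (hχ.continuous.aestronglyMeasurable.mul (Lp.aestronglyMeasurable _)) l3 fun k => ?_
    rw [← lintegral_const_mul' _ _ ENNReal.ofReal_ne_top, ← lintegral_add_left']
    · refine lintegral_mono_ae ?_
      filter_upwards [hWφ k, hZφ k] with p h1 h2
      simp only [Function.comp]
      have h3 : w.fst p - χ p * z.fst p =
          -((W k).fst p - w.fst p) + χ p * ((Z k).fst p - z.fst p) := by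
        rw [h1, h2, Pi.mul_apply]; ring
      rw [h3]
      refine (enorm_add_le _ _).trans ?_
      rw [enorm_neg, enorm_mul]
      gcongr
      rw [← ofReal_norm]
      exact ENNReal.ofReal_le_ofReal (hB p (mem_univ p))
    · exact ((Lp.aestronglyMeasurable _).sub (Lp.aestronglyMeasurable _)).enorm
  · refine le_of_tendsto_of_tendsto' hw.norm (hZlim.norm.const_mul C) fun k => ?_
    exact hC (φ k) (hφ k) _ (hZg k) _ (hWg k) (hZφ k) (hWφ k)

/-- An element of `H¹₀(K)` vanishes outside `K`, together with its gradient. -/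
theorem ae_eq_zero_of_mem_pairH10 {g : Metric I M} {𝓕 : AdaptedFrame g} {K : Set M}
    {z : PairSpace g} (hz : z ∈ pairH10 𝓕 K) :
    (∀ᵐ p ∂(vol g), p ∈ (interior K)ᶜ → z.fst p = 0) ∧
      ∀ᵐ p ∂(vol g), p ∈ (interior K)ᶜ → 𝓕.field z.snd p = 0 := by
  obtain ⟨Z, hZ, hZlim⟩ := mem_closure_iff_seq_limit.1
    (show z ∈ closure (testPairs 𝓕 K : Set (PairSpace g)) from hz)
  have hZ' : ∀ k, Z k ∈ weakGraph 𝓕 ∧ ∃ φ : M → ℝ, ContMDiff I 𝓘(ℝ, ℝ) ∞ φ ∧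
    tsupport φ ⊆ interior K ∩ I.interior M ∧ (Z k).fst =ᵐ[vol g] φ := hZ
  choose hZg φ hφ hφs hZφ using hZ'
  have hm : MeasurableSet (interior K)ᶜ := isOpen_interior.measurableSet.compl
  have key : ∀ {F : Type _} [NormedAddCommGroup F] (f : ℕ → Lp F 2 (vol g)) (f₀ : Lp F 2 (vol g)),
      Filter.Tendsto f Filter.atTop (𝓝 f₀) →
      (∀ k, ∀ᵐ p ∂(vol g), p ∈ (interior K)ᶜ → f k p = 0) →
      ∀ᵐ p ∂(vol g), p ∈ (interior K)ᶜ → f₀ p = 0 := by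
    intro F _ f f₀ hf h0
    have l1 := tendsto_lintegral_of_tendsto_Lp hf
    have h1 : ∫⁻ p in (interior K)ᶜ, ‖f₀ p‖ₑ ∂(vol g) = 0 := by
      refine le_antisymm (ge_of_tendsto' l1 fun k => ?_) zero_le
      refine le_trans ?_ (setLIntegral_le_lintegral (interior K)ᶜ _)
      refine lintegral_mono_ae ((ae_restrict_iff' hm).2 ?_)
      filter_upwards [h0 k] with p hp hpK
      rw [hp hpK, zero_sub, enorm_neg]
    rw [lintegral_eq_zero_iff' (Lp.aestronglyMeasurable _).enorm.restrict] at h1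
    filter_upwards [(ae_restrict_iff' hm).1 h1] with p hp hpK
    simpa using hp hpK
  refine ⟨key _ _ (((continuous_fst_pairSpace g).tendsto _).comp hZlim) fun k => ?_, ?_⟩
  · filter_upwards [hZφ k] with p hp hpK
    rw [Function.comp, hp]
    exact image_eq_zero_of_notMem_tsupport fun h => hpK (hφs k h).1
  · have := key _ _ (((continuous_snd_pairSpace g).tendsto _).comp hZlim) fun k => ?_
    · filter_upwards [this] with p hp hpK
      rw [AdaptedFrame.field, hp hpK, map_zero]
    -- The complement of `interior K` is not open, so locality of the weak gradient is applied on
    -- the larger open complement of the support of `φ k`.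
    · have h1 : ∀ᵐ p ∂(vol g), p ∈ (tsupport (φ k))ᶜ → 𝓕.field (Z k).snd p = 0 := by
        refine IsWeakGrad.ae_eq_zero_of_isOpen (hZg k) (isClosed_tsupport _).isOpen_compl ?_
        filter_upwards [hZφ k] with p hp hpK
        rw [hp]
        exact image_eq_zero_of_notMem_tsupport hpK
      filter_upwards [h1] with p hp hpK
      rw [Function.comp, ← 𝓕.symm_field (Z k).snd p, hp fun h => hpK (hφs k h).1, map_zero]

end Multiplication

end SchwarzManifold
end

/-! ### Translation estimates in Euclidean space -/

noncomputable section

namespace SchwarzManifold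

set_option linter.unusedSectionVars false

section EuclideanEstimates

variable {F : Type*} [NormedAddCommGroup F] [NormedSpace ℝ F] [FiniteDimensional ℝ F]
  [MeasurableSpace F] [BorelSpace F]

/-- The mean of `h'` over the unit interval is `h 1 - h 0`, and the variance of `h'` is nonnegative.
-/
theorem sq_sub_le_integral_sq_deriv {h h' : ℝ → ℝ} (hd : ∀ t ∈ Icc (0 : ℝ) 1, HasDerivAt h (h' t) t)
    (hc : ContinuousOn h' (Icc 0 1)) : (h 1 - h 0) ^ 2 ≤ ∫ t in (0 : ℝ)..1, h' t ^ 2 := by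
  have hc' : ContinuousOn h' (uIcc 0 1) := by rwa [uIcc_of_le zero_le_one]
  have h1 : ∫ t in (0 : ℝ)..1, h' t = h 1 - h 0 :=
    intervalIntegral.integral_eq_sub_of_hasDerivAt (fun t ht => hd t (by
      rwa [uIcc_of_le zero_le_one] at ht)) hc'.intervalIntegrable
  set c := h 1 - h 0
  have h2 : 0 ≤ ∫ t in (0 : ℝ)..1, (h' t - c) ^ 2 :=
    intervalIntegral.integral_nonneg zero_le_one fun t _ => sq_nonneg _
  have h3 : ∫ t in (0 : ℝ)..1, (h' t - c) ^ 2 =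
      (∫ t in (0 : ℝ)..1, h' t ^ 2) - 2 * c * (∫ t in (0 : ℝ)..1, h' t) + c ^ 2 := by
    have e1 : ∀ t, (h' t - c) ^ 2 = h' t ^ 2 - 2 * c * h' t + c ^ 2 := fun t => by ring
    simp only [e1]
    rw [intervalIntegral.integral_add, intervalIntegral.integral_sub,
      intervalIntegral.integral_const_mul, intervalIntegral.integral_const]
    · simp
    · exact (hc'.pow 2).intervalIntegrable
    · exact (hc'.const_smul (2 * c)).intervalIntegrable
    · exact ((hc'.pow 2).sub (hc'.const_smul (2 * c))).intervalIntegrable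
    · exact intervalIntegrable_const
  rw [h1] at h3
  nlinarith

/-- The difference of a function and its translate is controlled by the derivative. -/
theorem lintegral_sq_translate_sub_le (μ : Measure F) [μ.IsAddHaarMeasure] {B S : Set F}
    (hB : IsOpen B)
    (hBc : Convex ℝ B) {ψ : F → ℝ} (hψ : ContDiffOn ℝ 1 ψ B) (hS : MeasurableSet S)
    (v : F) (hSB : S ⊆ B) (hSv : ∀ x ∈ S, x + v ∈ B) :
    ∫⁻ x in S, ‖ψ (x + v) - ψ x‖ₑ ^ 2 ∂μ ≤ ‖v‖ₑ ^ 2 * ∫⁻ x in B, ‖fderiv ℝ ψ x‖ₑ ^ 2 ∂μ := by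
  -- The derivative is cut off outside `B`, so that after exchanging the integrals the one over `x`
  -- runs over the whole space and is invariant under translation.
  set G : F → ℝ≥0∞ := B.indicator fun x => ‖fderiv ℝ ψ x‖ₑ ^ 2 with hG
  have hGm : Measurable G :=
    ((measurable_fderiv ℝ ψ).enorm.pow_const 2).indicator hB.measurableSet
  have hpt : ∀ x ∈ S, ‖ψ (x + v) - ψ x‖ₑ ^ 2 ≤
      ‖v‖ₑ ^ 2 * ∫⁻ t in Ioc (0 : ℝ) 1, G (x + t • v) := by
    intro x hx
    have hseg : ∀ t ∈ Icc (0 : ℝ) 1, x + t • v ∈ B := fun t ht => by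
      have := hBc.add_smul_sub_mem (hSB hx) (hSv x hx) ht
      simpa using this
    have hd : ∀ t ∈ Icc (0 : ℝ) 1, HasDerivAt (fun t : ℝ => ψ (x + t • v))
        (fderiv ℝ ψ (x + t • v) v) t := by
      intro t ht
      have h1 : HasFDerivAt ψ (fderiv ℝ ψ (x + t • v)) (x + t • v) :=
        (((hψ.differentiableOn (by simp)) _ (hseg t ht)).differentiableAt
          (hB.mem_nhds (hseg t ht))).hasFDerivAt
      have h2 : HasDerivAt (fun t : ℝ => x + t • v) v t := by
        simpa using ((hasDerivAt_id t).smul_const v).const_add x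
      exact h1.comp_hasDerivAt t h2
    have hc : ContinuousOn (fun t : ℝ => fderiv ℝ ψ (x + t • v) v) (Icc 0 1) := by
      refine ContinuousOn.clm_apply ?_ continuousOn_const
      exact (hψ.continuousOn_fderiv_of_isOpen hB (by simp)).comp (by fun_prop) hseg
    have h1 := sq_sub_le_integral_sq_deriv hd hc
    simp only [one_smul, zero_smul, add_zero] at h1
    have h2 : ‖ψ (x + v) - ψ x‖ₑ ^ 2 = ENNReal.ofReal ((ψ (x + v) - ψ x) ^ 2) := by
      rw [← ofReal_norm, ← ENNReal.ofReal_pow (norm_nonneg _), Real.norm_eq_abs, sq_abs]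
    rw [h2, ← lintegral_const_mul _ (f := fun t : ℝ => G (x + t • v)) (hGm.comp (by fun_prop))]
    refine (ENNReal.ofReal_le_ofReal h1).trans ?_
    rw [intervalIntegral.integral_of_le zero_le_one, ofReal_integral_eq_lintegral_ofReal]
    · refine setLIntegral_mono' measurableSet_Ioc fun t ht => ?_
      rw [hG, indicator_of_mem (hseg t (Ioc_subset_Icc_self ht)), ← ofReal_norm, ← ofReal_norm,
        ← ENNReal.ofReal_pow (norm_nonneg _), ← ENNReal.ofReal_pow (norm_nonneg _),
        ← ENNReal.ofReal_mul (by positivity), ← mul_pow, mul_comm]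
      refine ENNReal.ofReal_le_ofReal ?_
      rw [← sq_abs, ← Real.norm_eq_abs]
      gcongr
      exact ContinuousLinearMap.le_opNorm _ _
    · exact ((hc.pow 2).integrableOn_Icc).mono_set Ioc_subset_Icc_self
    · exact Filter.Eventually.of_forall fun t => sq_nonneg _
  have hm2 : Measurable (Function.uncurry fun (x : F) (t : ℝ) => G (x + t • v)) :=
    hGm.comp (by fun_prop)
  calc ∫⁻ x in S, ‖ψ (x + v) - ψ x‖ₑ ^ 2 ∂μ
      ≤ ∫⁻ x in S, ‖v‖ₑ ^ 2 * (∫⁻ t in Ioc (0 : ℝ) 1, G (x + t • v)) ∂μ := setLIntegral_mono' hS hpt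
    _ ≤ ∫⁻ x, ‖v‖ₑ ^ 2 * (∫⁻ t in Ioc (0 : ℝ) 1, G (x + t • v)) ∂μ := setLIntegral_le_lintegral _ _
    _ = ‖v‖ₑ ^ 2 * ∫⁻ x, (∫⁻ t in Ioc (0 : ℝ) 1, G (x + t • v)) ∂μ := by
        rw [lintegral_const_mul' _ _ (by finiteness)]
    _ = ‖v‖ₑ ^ 2 * ∫⁻ t in Ioc (0 : ℝ) 1, ∫⁻ x, G (x + t • v) ∂μ := by
        rw [lintegral_lintegral_swap hm2.aemeasurable]
    _ = ‖v‖ₑ ^ 2 * ∫⁻ x, G x ∂μ := by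
        simp only [lintegral_add_right_eq_self (μ := μ) G, lintegral_const,
          Measure.restrict_apply_univ, Real.volume_Ioc, sub_zero, ENNReal.ofReal_one, mul_one]
    _ = _ := by rw [hG, lintegral_indicator hB.measurableSet]

theorem enorm_sq_eq_ofReal {G : Type*} [NormedAddCommGroup G] (v : G) :
    ‖v‖ₑ ^ 2 = ENNReal.ofReal (‖v‖ ^ 2) := by
  rw [← ofReal_norm, ← ENNReal.ofReal_pow (norm_nonneg _)]

theorem enorm_sq_add_le {G : Type*} [NormedAddCommGroup G] (a b : G) :
    ‖a + b‖ₑ ^ 2 ≤ 2 * ‖a‖ₑ ^ 2 + 2 * ‖b‖ₑ ^ 2 := by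
  have h2 : (2 : ℝ≥0∞) = ENNReal.ofReal 2 := by simp
  simp only [enorm_sq_eq_ofReal]
  rw [h2, ← ENNReal.ofReal_mul zero_le_two, ← ENNReal.ofReal_mul zero_le_two,
    ← ENNReal.ofReal_add (by positivity) (by positivity)]
  refine ENNReal.ofReal_le_ofReal ?_
  nlinarith [sq_nonneg (‖a‖ - ‖b‖), norm_add_le a b, norm_nonneg (a + b), norm_nonneg a,
    norm_nonneg b]

/-- The square integral over a ball is controlled by that over a nonempty open subset of
a larger ball and by the derivative. -/
theorem exists_lintegral_ball_le (μ : Measure F) [μ.IsAddHaarMeasure] (x₀ : F) {r : ℝ} (hr : 0 < r)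
    {A : Set F} (hA : IsOpen A) (hAn : A.Nonempty) (hAB : A ⊆ Metric.ball x₀ r) :
    ∃ C : NNReal, ∀ ψ : F → ℝ, ContDiffOn ℝ 1 ψ (Metric.ball x₀ r) →
      ∫⁻ x in Metric.ball x₀ (r / 2), ‖ψ x‖ₑ ^ 2 ∂μ ≤
        C * (∫⁻ x in A, ‖ψ x‖ₑ ^ 2 ∂μ + ∫⁻ x in Metric.ball x₀ r, ‖fderiv ℝ ψ x‖ₑ ^ 2 ∂μ) := by
  obtain ⟨a, ha⟩ := hAn
  obtain ⟨δ₀, hδ₀, hδA⟩ := Metric.isOpen_iff.1 hA a ha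
  -- The first bound puts the ball about `a` inside `A`; the second keeps balls of radius `δ` with
  -- centres in the half ball inside the large one. Finitely many such balls cover the half ball,
  -- and each is a translate of the ball about `a`.
  set δ := min δ₀ (r / 2) with hδd
  have hδ : 0 < δ := lt_min hδ₀ (by positivity)
  have hSA : Metric.ball a δ ⊆ A := (Metric.ball_subset_ball (min_le_left _ _)).trans hδA
  obtain ⟨t, htB, htf, htc⟩ := Metric.finite_approx_of_totallyBounded
    ((isCompact_closedBall x₀ (r / 2)).totallyBounded.subset Metric.ball_subset_closedBall) δ hδ
  lift t to Finset F using htf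
  -- For each centre, |ψ(x + v)|² ≤ 2|ψ(x)|² + 2|ψ(x + v) - ψ(x)|² with v = c - a, and the
  -- translation estimate contributes ‖c - a‖².
  refine ⟨∑ c ∈ t, (2 * ‖c - a‖₊ ^ 2 + 2), fun ψ hψ => ?_⟩
  set X := ∫⁻ x in A, ‖ψ x‖ₑ ^ 2 ∂μ
  set Y := ∫⁻ x in Metric.ball x₀ r, ‖fderiv ℝ ψ x‖ₑ ^ 2 ∂μ
  have hone : ∀ c ∈ t, ∫⁻ x in Metric.ball c δ, ‖ψ x‖ₑ ^ 2 ∂μ ≤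
      ((2 * ‖c - a‖₊ ^ 2 + 2 : NNReal) : ℝ≥0∞) * (X + Y) := by
    intro c hc
    have hcB : Metric.ball c δ ⊆ Metric.ball x₀ r := by
      refine Metric.ball_subset_ball' ?_
      have h1 := htB hc
      rw [Metric.mem_ball] at h1
      have h2 : δ ≤ r / 2 := min_le_right _ _
      linarith
    have h1 := lintegral_sq_translate_sub_le μ Metric.isOpen_ball (convex_ball x₀ r) hψ
      (measurableSet_ball (x := a) (ε := δ)) (c - a) (hSA.trans hAB) (fun x hx => hcB (by
        rw [Metric.mem_ball, dist_eq_norm] at hx ⊢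
        rwa [show x + (c - a) - c = x - a by abel]))
    have h2 : ∫⁻ x in Metric.ball c δ, ‖ψ x‖ₑ ^ 2 ∂μ =
        ∫⁻ x in Metric.ball a δ, ‖ψ (x + (c - a))‖ₑ ^ 2 ∂μ := by
      rw [← lintegral_indicator measurableSet_ball, ← lintegral_indicator measurableSet_ball,
        ← lintegral_add_right_eq_self _ (c - a)]
      refine lintegral_congr fun x => ?_
      have : x + (c - a) ∈ Metric.ball c δ ↔ x ∈ Metric.ball a δ := by
        rw [Metric.mem_ball, Metric.mem_ball, dist_eq_norm, dist_eq_norm,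
          show x + (c - a) - c = x - a by abel]
      by_cases hx : x ∈ Metric.ball a δ
      · rw [indicator_of_mem hx, indicator_of_mem (this.2 hx)]
      · rw [indicator_of_notMem hx, indicator_of_notMem (fun h => hx (this.1 h))]
    have hcm : AEMeasurable (fun x => ‖ψ x‖ₑ ^ 2) (μ.restrict (Metric.ball a δ)) :=
      (((hψ.continuousOn.mono (hSA.trans hAB)).aestronglyMeasurable measurableSet_ball).enorm).pow_const 2
    rw [h2]
    calc _ ≤ ∫⁻ x in Metric.ball a δ, (2 * ‖ψ x‖ₑ ^ 2 + 2 * ‖ψ (x + (c - a)) - ψ x‖ₑ ^ 2) ∂μ := by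
          refine lintegral_mono fun x => ?_
          have := enorm_sq_add_le (ψ x) (ψ (x + (c - a)) - ψ x)
          rwa [add_sub_cancel] at this
      _ = 2 * ∫⁻ x in Metric.ball a δ, ‖ψ x‖ₑ ^ 2 ∂μ +
          2 * ∫⁻ x in Metric.ball a δ, ‖ψ (x + (c - a)) - ψ x‖ₑ ^ 2 ∂μ := by
          rw [lintegral_add_left' (hcm.const_mul 2), lintegral_const_mul' _ _ (by simp),
            lintegral_const_mul' _ _ (by simp)]
      _ ≤ 2 * X + 2 * (‖c - a‖ₑ ^ 2 * Y) := by
          gcongr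
          exact lintegral_mono_set hSA
      _ ≤ _ := by
          push_cast
          rw [enorm_eq_nnnorm]
          calc _ ≤ 2 * X + 2 * (‖c - a‖₊ ^ 2 * Y) + (2 * ‖c - a‖₊ ^ 2 * X + 2 * Y) := le_self_add
            _ = _ := by ring
  calc ∫⁻ x in Metric.ball x₀ (r / 2), ‖ψ x‖ₑ ^ 2 ∂μ
      ≤ ∫⁻ x in ⋃ c ∈ t, Metric.ball c δ, ‖ψ x‖ₑ ^ 2 ∂μ := lintegral_mono_set htc
    _ ≤ ∑ c ∈ t, ∫⁻ x in Metric.ball c δ, ‖ψ x‖ₑ ^ 2 ∂μ := by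
        clear htB hone htc
        classical
        induction t using Finset.cons_induction with
        | empty => simp
        | cons c t hc ih =>
          rw [Finset.sum_cons, Finset.cons_eq_insert, Finset.set_biUnion_insert]
          exact (lintegral_union_le _ _ _).trans (by gcongr)
    _ ≤ ∑ c ∈ t, ((2 * ‖c - a‖₊ ^ 2 + 2 : NNReal) : ℝ≥0∞) * (X + Y) := Finset.sum_le_sum hone
    _ = _ := by rw [← Finset.sum_mul]; push_cast; rfl

end EuclideanEstimates

end SchwarzManifold
end

/-! ### The Poincaré inequality -/

noncomputable section

namespace SchwarzManifold

set_option linter.unusedSectionVars false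

section Poincare

variable {d : ℕ} {H : Type*} [TopologicalSpace H]
  {I : ModelWithCorners ℝ (EuclideanSpace ℝ (Fin d)) H}
  {M : Type*} [TopologicalSpace M] [ChartedSpace H M] [IsManifold I ∞ M]
  [MeasurableSpace M] [BorelSpace M] [CompactSpace M]
  {e e' : OpenPartialHomeomorph M H}

local notation "𝔼" => EuclideanSpace ℝ (Fin d)

variable (I) in
/-- The coordinate representation of a function, extended by zero. -/
def chartExt (e : OpenPartialHomeomorph M H) (φ : M → ℝ) : 𝔼 → ℝ :=
  (e.extend I).target.indicator fun y => φ ((e.extend I).symm y)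

theorem chartExt_of_mem {φ : M → ℝ} {y : 𝔼} (hy : y ∈ (e.extend I).target) :
    chartExt I e φ y = φ ((e.extend I).symm y) := indicator_of_mem hy _

theorem chartExt_of_notMem {φ : M → ℝ} {y : 𝔼} (hy : y ∉ (e.extend I).target) :
    chartExt I e φ y = 0 := indicator_of_notMem hy _

theorem chartExt_eventuallyEq {φ : M → ℝ} {y : 𝔼} (hy : y ∈ interior (e.extend I).target) :
    chartExt I e φ =ᶠ[𝓝 y] fun y => φ ((e.extend I).symm y) := by
  filter_upwards [isOpen_interior.mem_nhds hy] with z hz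
  exact chartExt_of_mem (interior_subset hz)

theorem extend_symm_mem_source {y : 𝔼} (hy : y ∈ (e.extend I).target) :
    (e.extend I).symm y ∈ e.source := by
  have := (e.extend I).map_target hy
  rwa [e.extend_source] at this

theorem extend_symm_mem_interior_iff (he : e ∈ IsManifold.maximalAtlas I ∞ M) {y : 𝔼}
    (hy : y ∈ (e.extend I).target) :
    (e.extend I).symm y ∈ I.interior M ↔ y ∈ interior (e.extend I).target := by
  rw [mem_interior_iff_of_mem_maximalAtlas he (extend_symm_mem_source hy),
    (e.extend I).right_inv hy]

/-- The extension by zero is smooth at the points of the chart if the support of the function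
contains no boundary points. -/
theorem contDiffAt_chartExt (he : e ∈ IsManifold.maximalAtlas I ∞ M) {φ : M → ℝ}
    (hφ : ContMDiff I 𝓘(ℝ, ℝ) ∞ φ) (hs : tsupport φ ⊆ I.interior M) {y : 𝔼}
    (hy : y ∈ (e.extend I).target ∨ y ∉ closure (e.extend I).target) :
    ContDiffAt ℝ ∞ (chartExt I e φ) y := by
  rcases hy with hy | hy
  · by_cases hyi : y ∈ interior (e.extend I).target
    · have h1 := (contDiffOn_comp_extend_symm he hφ).contDiffAt (mem_interior_iff_mem_nhds.1 hyi)
      exact h1.congr_of_eventuallyEq (chartExt_eventuallyEq hyi)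
    -- The point of `M` with coordinates `y` lies on the boundary, so `φ` vanishes near it and the
    -- extension is locally zero.
    · rw [← extend_symm_mem_interior_iff he hy] at hyi
      have h1 : (tsupport φ)ᶜ ∈ 𝓝 ((e.extend I).symm y) :=
        (isClosed_tsupport φ).isOpen_compl.mem_nhds fun h => hyi (hs h)
      have h2 := (e.continuousOn_extend_symm y hy).preimage_mem_nhdsWithin h1
      rw [mem_nhdsWithin_iff_eventually] at h2
      refine (contDiffAt_const (c := (0 : ℝ))).congr_of_eventuallyEq ?_
      filter_upwards [h2] with z hz
      by_cases hzt : z ∈ (e.extend I).target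
      · rw [chartExt_of_mem hzt]
        exact image_eq_zero_of_notMem_tsupport (hz hzt)
      · exact chartExt_of_notMem hzt
  · refine (contDiffAt_const (c := (0 : ℝ))).congr_of_eventuallyEq ?_
    filter_upwards [isClosed_closure.isOpen_compl.mem_nhds hy] with z hz
    exact chartExt_of_notMem fun h => hz (subset_closure h)

theorem fderiv_chartExt {φ : M → ℝ} {y : 𝔼} (hy : y ∈ interior (e.extend I).target) :
    fderiv ℝ (chartExt I e φ) y =
      fderivWithin ℝ (fun y => φ ((e.extend I).symm y)) (e.extend I).target y := by
  rw [(chartExt_eventuallyEq hy).fderiv_eq, fderivWithin_of_mem_nhds (mem_interior_iff_mem_nhds.1 hy)]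

/-- The density of the Dirichlet integral of a function. -/
def gradDensity (g : Metric I M) (φ : M → ℝ) (p : M) : ℝ≥0∞ :=
  ENNReal.ofReal (metricAt g p (classicalGrad g φ p) (classicalGrad g φ p))

theorem aemeasurable_gradDensity (g : Metric I M) {φ : M → ℝ} (hφ : ContMDiff I 𝓘(ℝ, ℝ) ∞ φ) :
    AEMeasurable (gradDensity g φ) (vol g) := by
  obtain ⟨𝓕⟩ := exists_adaptedFrame g
  obtain ⟨z, hz, hz1, hz2⟩ := exists_smooth_pair 𝓕 hφ
  refine ((integrable_pairInner 𝓕 z z).aestronglyMeasurable.aemeasurable.ennreal_ofReal).congr ?_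
  filter_upwards [hz2] with p hp
  rw [gradDensity, pairInner, hp]

/-- The comparison on `Q` is applied to functions cut off to the part over `S`, so one constant
serves all measurable subsets. -/
theorem exists_setLIntegral_chartPart_bounds (g : Metric I M)
    (he : e ∈ IsManifold.maximalAtlas I ∞ M) {Q : Set 𝔼} (hQ : IsCompact Q)
    (hQT : Q ⊆ (e.extend I).target) :
    ∃ C : NNReal, ∀ f : M → ℝ≥0∞, AEMeasurable f ((vol g).restrict e.source) →
      ∀ S : Set 𝔼, MeasurableSet S → S ⊆ Q →
      (∫⁻ p in chartPart I e S, f p ∂(vol g) ≤ C * ∫⁻ y in S, f ((e.extend I).symm y)) ∧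
      (∫⁻ y in S, f ((e.extend I).symm y) ≤ C * ∫⁻ p in chartPart I e S, f p ∂(vol g)) := by
  obtain ⟨C, -, hC⟩ := exists_lintegral_chartPart_bounds g he hQ hQT
  refine ⟨C, fun f hf S hS hSQ => ?_⟩
  have hm : MeasurableSet (chartPart I e S) := measurableSet_chartPart hS
  have h := hC _ (hf.indicator hm)
  have hsub : chartPart I e S ⊆ chartPart I e Q :=
    inter_subset_inter_right _ (preimage_mono hSQ)
  have e1 : ∫⁻ p in chartPart I e Q, (chartPart I e S).indicator f p ∂(vol g) =
      ∫⁻ p in chartPart I e S, f p ∂(vol g) := by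
    rw [setLIntegral_indicator hm, inter_eq_left.2 hsub]
  have e2 : ∫⁻ y in Q, (chartPart I e S).indicator f ((e.extend I).symm y) =
      ∫⁻ y in S, f ((e.extend I).symm y) := by
    have : ∀ y ∈ Q, (chartPart I e S).indicator f ((e.extend I).symm y) =
        S.indicator (fun y => f ((e.extend I).symm y)) y := by
      intro y hy
      have h1 : (e.extend I).symm y ∈ chartPart I e S ↔ y ∈ S := by
        refine ⟨fun h => ?_, fun h => ⟨extend_symm_mem_source (hQT hy), ?_⟩⟩
        · have := h.2
          rwa [mem_preimage, (e.extend I).right_inv (hQT hy)] at this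
        · rwa [mem_preimage, (e.extend I).right_inv (hQT hy)]
      by_cases hyS : y ∈ S
      · rw [indicator_of_mem hyS, indicator_of_mem (h1.2 hyS)]
      · rw [indicator_of_notMem hyS, indicator_of_notMem (fun h => hyS (h1.1 h))]
    rw [setLIntegral_congr_fun hQ.measurableSet this, setLIntegral_indicator hS,
      inter_eq_left.2 hSQ]
  rwa [e1, e2] at h

/-- The Dirichlet integral over a part of a chart, in coordinates. -/
theorem exists_lintegral_fderiv_chartExt_le (g : Metric I M)
    (he : e ∈ IsManifold.maximalAtlas I ∞ M) {Q : Set 𝔼} (hQ : IsCompact Q)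
    (hQT : Q ⊆ (e.extend I).target) :
    ∃ C : NNReal, ∀ φ : M → ℝ, ContMDiff I 𝓘(ℝ, ℝ) ∞ φ →
      ∀ S : Set 𝔼, MeasurableSet S → S ⊆ Q →
      (∫⁻ y in S, ‖fderiv ℝ (chartExt I e φ) y‖ₑ ^ 2 ≤
        C * ∫⁻ p in chartPart I e S, gradDensity g φ p ∂(vol g)) ∧
      ∫⁻ p in chartPart I e S, gradDensity g φ p ∂(vol g) ≤
        C * ∫⁻ y in S, ‖fderiv ℝ (chartExt I e φ) y‖ₑ ^ 2 := by
  obtain ⟨C, hC⟩ := exists_setLIntegral_chartPart_bounds g he hQ hQT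
  obtain ⟨K, hK0, hK⟩ := exists_classicalGrad_bounds g he hQ hQT
  refine ⟨C * K.toNNReal, fun φ hφ S hS hSQ => ?_⟩
  obtain ⟨h1, h2⟩ := hC (gradDensity g φ) (aemeasurable_gradDensity g hφ).restrict S hS hSQ
  have hae : ∀ᵐ y ∂(volume.restrict S), y ∈ interior (e.extend I).target := by
    rw [ae_restrict_iff' hS]
    have h0 := volume_target_diff_interior (I := I) (e := e)
    have : ∀ᵐ y, y ∉ (e.extend I).target \ interior (e.extend I).target :=
      measure_eq_zero_iff_ae_notMem.1 h0
    filter_upwards [this] with y hy hyS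
    by_contra h
    exact hy ⟨hQT (hSQ hyS), h⟩
  have hKe : (K.toNNReal : ℝ≥0∞) = ENNReal.ofReal K := rfl
  constructor
  · calc ∫⁻ y in S, ‖fderiv ℝ (chartExt I e φ) y‖ₑ ^ 2
        ≤ ∫⁻ y in S, K.toNNReal * gradDensity g φ ((e.extend I).symm y) := by
          refine lintegral_mono_ae ?_
          filter_upwards [hae, ae_restrict_mem hS] with y hy hyS
          rw [fderiv_chartExt hy, enorm_sq_eq_ofReal, gradDensity, hKe, ← ENNReal.ofReal_mul hK0.le]
          exact ENNReal.ofReal_le_ofReal (hK φ hφ y (hSQ hyS)).2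
      _ = K.toNNReal * ∫⁻ y in S, gradDensity g φ ((e.extend I).symm y) :=
          lintegral_const_mul' _ _ (by simp)
      _ ≤ K.toNNReal * (C * ∫⁻ p in chartPart I e S, gradDensity g φ p ∂(vol g)) := by gcongr
      _ = _ := by push_cast; ring
  · calc ∫⁻ p in chartPart I e S, gradDensity g φ p ∂(vol g)
        ≤ C * ∫⁻ y in S, gradDensity g φ ((e.extend I).symm y) := h1
      _ ≤ C * ∫⁻ y in S, K.toNNReal * ‖fderiv ℝ (chartExt I e φ) y‖ₑ ^ 2 := by
          gcongr 1
          refine lintegral_mono_ae ?_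
          filter_upwards [hae, ae_restrict_mem hS] with y hy hyS
          rw [fderiv_chartExt hy, enorm_sq_eq_ofReal, gradDensity, hKe, ← ENNReal.ofReal_mul hK0.le]
          exact ENNReal.ofReal_le_ofReal (hK φ hφ y (hSQ hyS)).1
      _ = _ := by rw [lintegral_const_mul' _ _ (by simp)]; push_cast; ring

/-- Propagation of square integral bounds from an open set in coordinates to a neighbourhood. -/
theorem exists_nhds_lintegral_sq_le (g : Metric I M) {p : M} (he : e ∈ IsManifold.maximalAtlas I ∞ M)
    (hp : p ∈ e.source) :
    ∃ r : ℝ, 0 < r ∧ Metric.closedBall (e.extend I p) r ∩ range I ⊆ (e.extend I).target ∧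
      ∃ N : Set M, IsOpen N ∧ p ∈ N ∧ N ⊆ chartPart I e (Metric.ball (e.extend I p) r) ∧
      ∀ A : Set 𝔼, IsOpen A → A.Nonempty → A ⊆ Metric.ball (e.extend I p) r →
      ∃ C : NNReal, ∀ φ : M → ℝ, ContMDiff I 𝓘(ℝ, ℝ) ∞ φ → tsupport φ ⊆ I.interior M →
        ∫⁻ p in N, ‖φ p‖ₑ ^ 2 ∂(vol g) ≤
          C * ((∫⁻ y in A, ‖chartExt I e φ y‖ₑ ^ 2) + ∫⁻ p, gradDensity g φ p ∂(vol g)) := by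
  obtain ⟨r, hr, -, hrT, hnhds⟩ := exists_chartPart_mem_nhds (I := I) hp Filter.univ_mem
  obtain ⟨N, hNs, hNo, hpN⟩ := mem_nhds_iff.1 (hnhds (r / 2) (by positivity))
  refine ⟨r, hr, hrT, N, hNo, hpN, hNs.trans (inter_subset_inter_right _
    (preimage_mono (Metric.ball_subset_ball (by linarith)))), fun A hA hAn hAB => ?_⟩
  set B := Metric.ball (e.extend I p) r
  set Q := Metric.closedBall (e.extend I p) r ∩ range I
  have hQ : IsCompact Q := (isCompact_closedBall _ r).inter_right I.isClosed_range
  obtain ⟨C₁, hC₁⟩ := exists_lintegral_ball_le (volume : Measure 𝔼) (e.extend I p) hr hA hAn hAB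
  obtain ⟨C₂, -, hC₂⟩ := exists_lintegral_chartPart_bounds g he hQ hrT
  obtain ⟨C₃, hC₃⟩ := exists_lintegral_fderiv_chartExt_le g he hQ hrT
  refine ⟨C₂ * C₁ * (1 + C₃), fun φ hφ hs => ?_⟩
  -- Inside the ball the target is the trace of the closed set `range I`; hence every point of the
  -- ball is in the target or off its closure, and the extension by zero is smooth on the whole
  -- ball.
  have hBt : ∀ y ∈ B, y ∉ (e.extend I).target → y ∉ closure (e.extend I).target := by
    intro y hy hyt hyc
    refine hyt (hrT ⟨Metric.ball_subset_closedBall hy, ?_⟩)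
    exact closure_minimal e.extend_target_subset_range I.isClosed_range hyc
  have hsm : ContDiffOn ℝ 1 (chartExt I e φ) B := fun y hy =>
    ((contDiffAt_chartExt he hφ hs (by
      by_cases hyt : y ∈ (e.extend I).target
      · exact Or.inl hyt
      · exact Or.inr (hBt y hy hyt))).of_le (by simp)).contDiffWithinAt
  have h1 := hC₁ _ hsm
  have h2 : ∫⁻ y in B, ‖fderiv ℝ (chartExt I e φ) y‖ₑ ^ 2 ≤
      C₃ * ∫⁻ p, gradDensity g φ p ∂(vol g) := by
    refine le_trans ?_ ((hC₃ φ hφ Q hQ.measurableSet subset_rfl).1.trans (mul_le_mul_right (setLIntegral_le_lintegral _ _) _))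
    rw [← lintegral_indicator measurableSet_ball, ← lintegral_indicator hQ.measurableSet]
    refine lintegral_mono fun y => ?_
    by_cases hy : y ∈ B
    · rw [indicator_of_mem hy]
      by_cases hyt : y ∈ (e.extend I).target
      · rw [indicator_of_mem (show y ∈ Q from
          ⟨Metric.ball_subset_closedBall hy, e.extend_target_subset_range hyt⟩)]
      · have h0 : fderiv ℝ (chartExt I e φ) y = 0 := by
          have : chartExt I e φ =ᶠ[𝓝 y] fun _ => 0 := by
            filter_upwards [isClosed_closure.isOpen_compl.mem_nhds (hBt y hy hyt)] with z hz
            exact chartExt_of_notMem fun h => hz (subset_closure h)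
          rw [this.fderiv_eq]
          exact fderiv_const_apply _
        rw [h0, enorm_sq_eq_ofReal, norm_zero]
        simp
    · rw [indicator_of_notMem hy]
      exact zero_le
  have hφm : AEMeasurable (fun p => ‖φ p‖ₑ ^ 2) ((vol g).restrict e.source) :=
    (hφ.continuous.measurable.enorm.pow_const 2).aemeasurable
  have h3 : ∫⁻ p in N, ‖φ p‖ₑ ^ 2 ∂(vol g) ≤
      C₂ * ∫⁻ y in Metric.ball (e.extend I p) (r / 2), ‖chartExt I e φ y‖ₑ ^ 2 := by
    have h4 := (hC₂ (N.indicator fun p => ‖φ p‖ₑ ^ 2) (hφm.indicator hNo.measurableSet)).1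
    have h5 : N ⊆ chartPart I e Q := fun q hq => ⟨(hNs hq).1,
      Metric.ball_subset_closedBall (Metric.ball_subset_ball (by linarith) (hNs hq).2),
      mem_range_self _⟩
    rw [setLIntegral_indicator hNo.measurableSet, inter_eq_left.2 h5] at h4
    refine h4.trans (mul_le_mul_right ?_ _)
    rw [← lintegral_indicator hQ.measurableSet, ← lintegral_indicator measurableSet_ball]
    refine lintegral_mono fun y => ?_
    by_cases hy : y ∈ Q
    · rw [indicator_of_mem hy]
      by_cases hyN : (e.extend I).symm y ∈ N
      · have h6 := (hNs hyN).2
        rw [mem_preimage, (e.extend I).right_inv (hrT hy)] at h6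
        rw [indicator_of_mem hyN, indicator_of_mem h6, chartExt_of_mem (hrT hy)]
      · rw [indicator_of_notMem hyN]
        exact zero_le
    · rw [indicator_of_notMem hy]
      exact zero_le
  calc _ ≤ _ := h3
    _ ≤ C₂ * (C₁ * ((∫⁻ y in A, ‖chartExt I e φ y‖ₑ ^ 2) +
        C₃ * ∫⁻ p, gradDensity g φ p ∂(vol g))) := by
        refine mul_le_mul_right (h1.trans (mul_le_mul_right ?_ _)) _
        gcongr
    _ ≤ C₂ * (C₁ * ((∫⁻ y in A, ‖chartExt I e φ y‖ₑ ^ 2) +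
        C₃ * ∫⁻ p, gradDensity g φ p ∂(vol g))) + C₂ * C₁ * (C₃ * (∫⁻ y in A, ‖chartExt I e φ y‖ₑ ^ 2) +
        ∫⁻ p, gradDensity g φ p ∂(vol g)) := le_self_add
    _ = _ := by push_cast; ring

/-- The square integral over `N` is controlled by the Dirichlet integral. -/
def PoincareOn (g : Metric I M) (N : Set M) : Prop :=
  ∃ C : NNReal, ∀ φ : M → ℝ, ContMDiff I 𝓘(ℝ, ℝ) ∞ φ → tsupport φ ⊆ I.interior M →
    ∫⁻ p in N, ‖φ p‖ₑ ^ 2 ∂(vol g) ≤ C * ∫⁻ p, gradDensity g φ p ∂(vol g)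

/-- A coordinate ball about a boundary point contains a nonempty open set outside `range I`, where
the extension by zero vanishes. Taking this set as `A` removes the L² term on the right. -/
theorem exists_poincareOn_of_mem_boundary (g : Metric I M) {p : M} (hp : p ∈ I.boundary M) :
    ∃ N, IsOpen N ∧ p ∈ N ∧ PoincareOn g N := by
  have he := IsManifold.chart_mem_maximalAtlas (I := I) (n := ∞) p
  obtain ⟨r, hr, hrT, N, hN, hpN, -, h⟩ := exists_nhds_lintegral_sq_le g he (mem_chart_source H p)
  refine ⟨N, hN, hpN, ?_⟩
  have hfr : (chartAt H p).extend I p ∈ frontier (range I) := hp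
  have hne : (Metric.ball ((chartAt H p).extend I p) r \ range I).Nonempty := by
    by_contra hne
    rw [not_nonempty_iff_eq_empty, sdiff_eq_empty] at hne
    exact hfr.2 (mem_interior_iff_mem_nhds.2 (Filter.mem_of_superset (Metric.ball_mem_nhds _ hr) hne))
  obtain ⟨C, hC⟩ := h _ (Metric.isOpen_ball.sdiff I.isClosed_range) hne sdiff_subset
  refine ⟨C, fun φ hφ hs => (hC φ hφ hs).trans_eq ?_⟩
  have : ∫⁻ y in Metric.ball ((chartAt H p).extend I p) r \ range I,
      ‖chartExt I (chartAt H p) φ y‖ₑ ^ 2 = 0 := by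
    refine setLIntegral_eq_zero (measurableSet_ball.diff I.isClosed_range.measurableSet) fun y hy => ?_
    rw [chartExt_of_notMem fun h => hy.2 ((chartAt H p).extend_target_subset_range h)]
    simp
  rw [this, zero_add]

/-- Close to `p` there is a point `q` that already has a good neighbourhood. In the chart of `p`
this neighbourhood contains a nonempty open set, and the L² bound there spreads to a neighbourhood
of `p`. -/
theorem exists_poincareOn_of_mem_closure (g : Metric I M) {p : M}
    (hp : p ∈ closure {q : M | ∃ N, IsOpen N ∧ q ∈ N ∧ PoincareOn g N}) :
    ∃ N, IsOpen N ∧ p ∈ N ∧ PoincareOn g N := by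
  have he := IsManifold.chart_mem_maximalAtlas (I := I) (n := ∞) p
  set e := chartAt H p
  obtain ⟨r, hr, hrT, N, hN, hpN, hNs, h⟩ := exists_nhds_lintegral_sq_le g he (mem_chart_source H p)
  refine ⟨N, hN, hpN, ?_⟩
  obtain ⟨q, hqN, N', hN', hqN', C', hC'⟩ := mem_closure_iff.1 hp N hN hpN
  have hqe := (hNs hqN).1
  have h1 : e.extend I '' (e.source ∩ (N ∩ N')) ∈ 𝓝[range I] (e.extend I q) := by
    rw [← e.map_extend_nhds hqe]
    refine Filter.image_mem_map ?_
    exact (e.open_source.inter (hN.inter hN')).mem_nhds ⟨hqe, hqN, hqN'⟩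
  obtain ⟨V, hV, hqV, hVs⟩ := mem_nhdsWithin.1 h1
  -- If `q` is a boundary point, `V ∩ range I` is not open in the model space; its part in the
  -- interior of `range I` is open and still nonempty.
  have hne : (V ∩ interior (range I)).Nonempty :=
    mem_closure_iff.1 (I.range_subset_closure_interior (mem_range_self _)) V hV hqV
  have hAs : V ∩ interior (range I) ⊆ e.extend I '' (e.source ∩ (N ∩ N')) :=
    (inter_subset_inter_right _ interior_subset).trans hVs
  have hAB : V ∩ interior (range I) ⊆ Metric.ball (e.extend I p) r := by
    refine hAs.trans ?_
    rintro - ⟨x, hx, rfl⟩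
    exact (hNs hx.2.1).2
  obtain ⟨C, hC⟩ := h _ (hV.inter isOpen_interior) hne hAB
  have hQ : IsCompact (Metric.closedBall (e.extend I p) r ∩ range I) :=
    (isCompact_closedBall _ r).inter_right I.isClosed_range
  obtain ⟨C₂, -, hC₂⟩ := exists_lintegral_chartPart_bounds g he hQ hrT
  refine ⟨C * (C₂ * C' + 1), fun φ hφ hs => (hC φ hφ hs).trans ?_⟩
  have hφm : AEMeasurable (fun p => ‖φ p‖ₑ ^ 2) ((vol g).restrict e.source) :=
    (hφ.continuous.measurable.enorm.pow_const 2).aemeasurable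
  have h2 : ∫⁻ y in V ∩ interior (range I), ‖chartExt I e φ y‖ₑ ^ 2 ≤
      C₂ * ∫⁻ p in N', ‖φ p‖ₑ ^ 2 ∂(vol g) := by
    have h4 := (hC₂ (N'.indicator fun p => ‖φ p‖ₑ ^ 2) (hφm.indicator hN'.measurableSet)).2
    rw [setLIntegral_indicator hN'.measurableSet] at h4
    refine le_trans ?_ (h4.trans (mul_le_mul_right (lintegral_mono_set inter_subset_left) _))
    rw [← lintegral_indicator hQ.measurableSet,
      ← lintegral_indicator (hV.inter isOpen_interior).measurableSet]
    refine lintegral_mono fun y => ?_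
    by_cases hy : y ∈ V ∩ interior (range I)
    · obtain ⟨x, hx, rfl⟩ := hAs hy
      have hx' : x ∈ (e.extend I).source := by rw [e.extend_source]; exact hx.1
      rw [indicator_of_mem hy, indicator_of_mem (show _ ∈ Metric.closedBall (e.extend I p) r ∩ range I from
        ⟨Metric.ball_subset_closedBall (hAB hy), interior_subset hy.2⟩), chartExt_of_mem ((e.extend I).map_source hx'),
        (e.extend I).left_inv hx', indicator_of_mem hx.2.2]
    · rw [indicator_of_notMem hy]
      exact zero_le
  calc _ ≤ C * ((C₂ * (C' * ∫⁻ p, gradDensity g φ p ∂(vol g))) + ∫⁻ p, gradDensity g φ p ∂(vol g)) := by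
        refine mul_le_mul_right (add_le_add_left ?_ _) _
        exact h2.trans (mul_le_mul_right (hC' φ hφ hs) _)
    _ = _ := by push_cast; ring

/-- The points with a good neighbourhood form an open and closed set containing the boundary, hence
everything by connectedness. A finite subcover adds up the constants. -/
theorem poincareOn_univ [ConnectedSpace M] (g : Metric I M) (hb : (I.boundary M).Nonempty) :
    PoincareOn g (univ : Set M) := by
  set S := {q : M | ∃ N, IsOpen N ∧ q ∈ N ∧ PoincareOn g N}
  have hSo : IsOpen S := by
    rw [isOpen_iff_mem_nhds]
    rintro q ⟨N, hN, hq, h⟩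
    exact Filter.mem_of_superset (hN.mem_nhds hq) fun q' hq' => ⟨N, hN, hq', h⟩
  have hSc : IsClosed S := closure_subset_iff_isClosed.1 fun q hq =>
    exists_poincareOn_of_mem_closure g hq
  have hSu : S = univ := IsClopen.eq_univ ⟨hSc, hSo⟩
    (hb.mono fun q hq => exists_poincareOn_of_mem_boundary g hq)
  refine isCompact_univ.induction_on (p := fun s => PoincareOn g s) ⟨0, by simp⟩
    (fun s t hst ⟨C, hC⟩ => ⟨C, fun φ hφ hs => (lintegral_mono_set hst).trans (hC φ hφ hs)⟩)
    (fun s t ⟨C, hC⟩ ⟨C', hC'⟩ => ⟨C + C', fun φ hφ hs => (lintegral_union_le _ _ _).trans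
      ((add_le_add (hC φ hφ hs) (hC' φ hφ hs)).trans_eq (by push_cast; ring))⟩)
    (fun p _ => ?_)
  obtain ⟨N, hN, hp, h⟩ : p ∈ S := hSu ▸ mem_univ p
  exact ⟨N, mem_nhdsWithin_of_mem_nhds (hN.mem_nhds hp), h⟩

/-- The Poincaré inequality. -/
theorem exists_poincare [ConnectedSpace M] {g : Metric I M} (𝓕 : AdaptedFrame g)
    (hb : (I.boundary M).Nonempty) :
    ∃ C : ℝ, 0 ≤ C ∧ ∀ z ∈ pairH10 𝓕 univ, ‖z.fst‖ ^ 2 ≤ C * dirichletForm 𝓕 z z := by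
  obtain ⟨C, hC⟩ := poincareOn_univ g hb
  refine ⟨C, C.2, fun z hz => ?_⟩
  -- Both sides are continuous in the pair, so the inequality needs proof only for test functions.
  have hcont : IsClosed {z : PairSpace g | ‖z.fst‖ ^ 2 ≤ C * dirichletForm 𝓕 z z} := by
    refine isClosed_le ((continuous_fst_pairSpace g).norm.pow 2) (continuous_const.mul ?_)
    exact (dirichletFormL 𝓕).continuous.clm_apply continuous_id
  refine closure_minimal ?_ hcont hz
  rintro z ⟨hzg, φ, hφ, hs, hzφ⟩
  have h1 := hC φ hφ fun p hp => (hs hp).2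
  have hX : 𝓕.field z.snd =ᵐ[vol g] classicalGrad g φ :=
    IsWeakGrad.ae_unique hzg (isWeakGrad_classicalGrad g hφ) hzφ
  have e1 : ENNReal.ofReal (‖z.fst‖ ^ 2) = ∫⁻ p, ‖φ p‖ₑ ^ 2 ∂(vol g) := by
    rw [← integral_norm_sq_Lp, ofReal_integral_eq_lintegral_ofReal (integrable_norm_sq_Lp _)
      (Filter.Eventually.of_forall fun p => by positivity)]
    refine lintegral_congr_ae ?_
    filter_upwards [hzφ] with p hp
    rw [hp, enorm_sq_eq_ofReal]
  have e2 : ENNReal.ofReal (dirichletForm 𝓕 z z) = ∫⁻ p, gradDensity g φ p ∂(vol g) := by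
    rw [dirichletForm_apply, ofReal_integral_eq_lintegral_ofReal (integrable_pairInner 𝓕 z z)
      (Filter.Eventually.of_forall fun p => metricAt_self_nonneg g p _)]
    refine lintegral_congr_ae ?_
    filter_upwards [hX] with p hp
    rw [pairInner, hp, gradDensity]
  rw [setLIntegral_univ, ← e1, ← e2, ← ENNReal.ofReal_coe_nnreal,
    ← ENNReal.ofReal_mul (NNReal.coe_nonneg C)] at h1
  exact (ENNReal.ofReal_le_ofReal_iff (mul_nonneg C.2 (dirichletForm_self_nonneg 𝓕 z))).1 h1

end Poincare

end SchwarzManifold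
end

/-! ### Approximation by translated functions -/

noncomputable section

namespace SchwarzManifold

set_option linter.unusedSectionVars false

section Translation

variable {F : Type*} [NormedAddCommGroup F] [NormedSpace ℝ F] [FiniteDimensional ℝ F]
  [MeasurableSpace F] [BorelSpace F]

theorem tendsto_lintegral_sq_sub_translate (μ : Measure F) [μ.IsAddHaarMeasure] {G : Type*}
    [NormedAddCommGroup G] {f : F → G} (hf : Continuous f) (hc : HasCompactSupport f) (v : F) :
    Filter.Tendsto (fun t : ℝ => ∫⁻ x, ‖f x - f (x - t • v)‖ₑ ^ 2 ∂μ) (𝓝 0) (𝓝 0) := by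
  obtain ⟨B, hB⟩ := hf.bounded_above_of_compact_support hc
  obtain ⟨R, hR⟩ := hc.isBounded.subset_closedBall (0 : F)
  have h0 : ∀ x, R < ‖x‖ → f x = 0 := fun x hx => by
    refine image_eq_zero_of_notMem_tsupport fun h => ?_
    have := hR h
    rw [mem_closedBall_zero_iff] at this
    linarith
  have h1 : ∫⁻ _ : F, (0 : ℝ≥0∞) ∂μ = 0 := lintegral_zero
  rw [← h1]
  have hcont : ∀ t : ℝ, Continuous fun x => f x - f (x - t • v) := fun t =>
    hf.sub (hf.comp (by fun_prop))
  refine tendsto_lintegral_filter_of_dominated_convergence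
    ((Metric.closedBall (0 : F) (R + ‖v‖)).indicator fun _ => ENNReal.ofReal ((2 * B) ^ 2))
    (Filter.Eventually.of_forall fun t => (hcont t).enorm.measurable.pow_const 2) ?_ ?_ ?_
  -- For |t| < 1 both `f` and its translate vanish outside the ball of radius `R + ‖v‖`, which gives
  -- an integrable majorant independent of `t`.
  · have h2 : Metric.ball (0 : ℝ) 1 ∈ 𝓝 0 := Metric.ball_mem_nhds _ one_pos
    filter_upwards [h2] with t ht
    refine Filter.Eventually.of_forall fun x => ?_
    rw [mem_ball_zero_iff, Real.norm_eq_abs] at ht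
    by_cases hx : x ∈ Metric.closedBall (0 : F) (R + ‖v‖)
    · rw [indicator_of_mem hx, enorm_sq_eq_ofReal]
      refine ENNReal.ofReal_le_ofReal ?_
      have := norm_sub_le (f x) (f (x - t • v))
      have h3 := hB x
      have h4 := hB (x - t • v)
      gcongr
      linarith
    · rw [indicator_of_notMem hx]
      rw [mem_closedBall_zero_iff, not_le] at hx
      have h3 : ‖t • v‖ ≤ ‖v‖ := by
        rw [norm_smul, Real.norm_eq_abs]
        exact mul_le_of_le_one_left (norm_nonneg _) ht.le
      have h4 : R < ‖x - t • v‖ := by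
        have := norm_sub_norm_le x (t • v)
        linarith
      rw [h0 x (by linarith [norm_nonneg v]), h0 _ h4]
      simp
  · rw [lintegral_indicator Metric.isClosed_closedBall.measurableSet, setLIntegral_const]
    exact ENNReal.mul_ne_top ENNReal.ofReal_ne_top
      (isCompact_closedBall _ _).measure_lt_top.ne
  · refine Filter.Eventually.of_forall fun x => ?_
    have h2 : Continuous fun t : ℝ => ‖f x - f (x - t • v)‖ₑ ^ 2 :=
      (ENNReal.continuous_pow 2).comp (continuous_const.sub (hf.comp (by fun_prop))).enorm
    have := h2.tendsto 0
    simpa using this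

/-- The density of the square of the Sobolev norm. -/
def sobolevDensity (η : F → ℝ) (x : F) : ℝ≥0∞ := ‖η x‖ₑ ^ 2 + ‖fderiv ℝ η x‖ₑ ^ 2

theorem measurable_sobolevDensity {η : F → ℝ} (h : Continuous η) : Measurable (sobolevDensity η) :=
  (h.enorm.measurable.pow_const 2).add ((measurable_fderiv ℝ η).enorm.pow_const 2)

theorem sobolevDensity_add_le {η θ : F → ℝ} {x : F} (hη : DifferentiableAt ℝ η x)
    (hθ : DifferentiableAt ℝ θ x) : sobolevDensity (fun x => η x + θ x) x ≤
      2 * sobolevDensity η x + 2 * sobolevDensity θ x := by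
  rw [sobolevDensity, fderiv_fun_add hη hθ]
  refine (add_le_add (enorm_sq_add_le _ _) (enorm_sq_add_le _ _)).trans_eq ?_
  rw [sobolevDensity, sobolevDensity]
  ring

theorem lintegral_sobolevDensity_add_le (μ : Measure F) {η θ : F → ℝ} (hη : ContDiff ℝ ∞ η)
    (hθ : ContDiff ℝ ∞ θ) : ∫⁻ x, sobolevDensity (fun x => η x + θ x) x ∂μ ≤
      2 * (∫⁻ x, sobolevDensity η x ∂μ + ∫⁻ x, sobolevDensity θ x ∂μ) := by
  rw [← lintegral_add_left (measurable_sobolevDensity hη.continuous),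
    ← lintegral_const_mul' _ _ (by simp)]
  refine lintegral_mono fun x => ?_
  rw [mul_add]
  exact sobolevDensity_add_le (hη.differentiable (by simp) x) (hθ.differentiable (by simp) x)

theorem sobolevDensity_comp_sub (η : F → ℝ) (v x : F) :
    sobolevDensity (fun x => η (x - v)) x = sobolevDensity η (x - v) := by
  rw [sobolevDensity, sobolevDensity, fderiv_comp_sub]

theorem tendsto_lintegral_sobolevDensity_sub_translate (μ : Measure F) [μ.IsAddHaarMeasure]
    {η : F → ℝ} (hη : ContDiff ℝ ∞ η) (hc : HasCompactSupport η) (v : F) :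
    Filter.Tendsto (fun t : ℝ => ∫⁻ x, sobolevDensity (fun x => η x - η (x - t • v)) x ∂μ)
      (𝓝 0) (𝓝 0) := by
  have h1 := tendsto_lintegral_sq_sub_translate μ hη.continuous hc v
  have h2 := tendsto_lintegral_sq_sub_translate μ (hη.continuous_fderiv (by simp)) (hc.fderiv ℝ) v
  have h3 := h1.add h2
  rw [add_zero] at h3
  refine h3.congr fun t => ?_
  rw [← lintegral_add_left]
  · refine lintegral_congr fun x => ?_
    have h4 : DifferentiableAt ℝ (fun x => η (x - t • v)) x :=
      (hη.differentiable (by simp) _).comp x (by fun_prop)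
    rw [sobolevDensity, fderiv_fun_sub (hη.differentiable (by simp) x) h4, fderiv_comp_sub]
  · exact (hη.continuous.sub (hη.continuous.comp
      (continuous_id.sub continuous_const))).enorm.measurable.pow_const 2

theorem sobolevDensity_mul_le {ρ η : F → ℝ} {x : F} {B : ℝ} (hρ : DifferentiableAt ℝ ρ x)
    (hη : DifferentiableAt ℝ η x) (h0 : ‖ρ x‖ ≤ B) (h1 : ‖fderiv ℝ ρ x‖ ≤ B) :
    sobolevDensity (fun x => ρ x * η x) x ≤ ENNReal.ofReal (4 * B ^ 2) * sobolevDensity η x := by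
  have hB : 0 ≤ B := (norm_nonneg _).trans h0
  simp only [sobolevDensity, enorm_sq_eq_ofReal]
  rw [fderiv_fun_mul hρ hη, ← ENNReal.ofReal_add (by positivity) (by positivity),
    ← ENNReal.ofReal_add (by positivity) (by positivity), ← ENNReal.ofReal_mul (by positivity)]
  refine ENNReal.ofReal_le_ofReal ?_
  have h2 : ‖ρ x • fderiv ℝ η x + η x • fderiv ℝ ρ x‖ ≤ B * ‖fderiv ℝ η x‖ + ‖η x‖ * B := by
    refine (norm_add_le _ _).trans ?_
    rw [norm_smul, norm_smul]
    gcongr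
  have h3 : ‖ρ x * η x‖ ≤ B * ‖η x‖ := by
    rw [norm_mul]
    gcongr
  have h4 : ‖ρ x • fderiv ℝ η x + η x • fderiv ℝ ρ x‖ ^ 2 ≤
      (B * ‖fderiv ℝ η x‖ + ‖η x‖ * B) ^ 2 := by gcongr
  have h5 : ‖ρ x * η x‖ ^ 2 ≤ (B * ‖η x‖) ^ 2 := by gcongr
  nlinarith [sq_nonneg (B * ‖fderiv ℝ η x‖ - ‖η x‖ * B), sq_nonneg (B * ‖η x‖),
    sq_nonneg (B * ‖fderiv ℝ η x‖)]

theorem exists_bound_one_sub {κ : F → ℝ} (hκ : ContDiff ℝ ∞ κ) (hκc : HasCompactSupport κ) :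
    ∃ B : ℝ, ∀ x, ‖1 - κ x‖ ≤ B ∧ ‖fderiv ℝ (fun x => 1 - κ x) x‖ ≤ B := by
  obtain ⟨B₀, hB₀⟩ := hκ.continuous.bounded_above_of_compact_support hκc
  obtain ⟨B₁, hB₁⟩ := (hκ.continuous_fderiv (by simp)).bounded_above_of_compact_support
    (hκc.fderiv ℝ)
  refine ⟨max (1 + B₀) B₁, fun x => ⟨?_, ?_⟩⟩
  · refine (norm_sub_le _ _).trans (le_max_of_le_left ?_)
    have := hB₀ x
    simpa using this
  · refine le_max_of_le_right ?_
    rw [fderiv_const_sub, norm_neg]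
    exact hB₁ x

/-- There is a smooth cutoff function with compact support in a given neighbourhood of
a compact set. -/
theorem exists_smooth_cutoff {S O : Set F} (hS : IsCompact S) (hO : IsOpen O) (hSO : S ⊆ O) :
    ∃ κ : F → ℝ, ContDiff ℝ ∞ κ ∧ HasCompactSupport κ ∧ tsupport κ ⊆ O ∧
      ∀ x ∈ S, κ =ᶠ[𝓝 x] fun _ => 1 := by
  obtain ⟨L, hL, hSL, hLO⟩ := exists_compact_between hS hO hSO
  obtain ⟨κ, h1, h2, -⟩ := exists_contMDiffMap_one_nhds_of_subset_interior 𝓘(ℝ, F) (n := ⊤)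
    hS.isClosed hSL
  have hs : tsupport κ ⊆ L := closure_minimal (fun x hx => by
    by_contra h
    exact hx (h2 x h)) hL.isClosed
  refine ⟨κ, κ.contMDiff.contDiff, HasCompactSupport.intro hL h2, hs.trans hLO, fun x hx => ?_⟩
  exact (Filter.eventually_iff_exists_mem.1 h1).elim fun V hV => by
    filter_upwards [mem_nhdsSet_iff_forall.1 hV.1 x hx] with y hy using hV.2 y hy

/-- Functions that are small outside of a closed set `A` are approximated by functions
supported in an open set into which small translations move `A`. -/
theorem exists_approx_of_translate (μ : Measure F) [μ.IsAddHaarMeasure] {S A O : Set F} {v : F}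
    (hS : IsCompact S) (hA : IsClosed A) (hO : IsOpen O)
    (hv : ∀ᶠ t : ℝ in 𝓝[>] 0, ∀ x ∈ S ∩ A, x + t • v ∈ O) {η : ℕ → F → ℝ}
    (hη : ∀ k, ContDiff ℝ ∞ (η k)) (hηs : ∀ k, tsupport (η k) ⊆ S)
    (hcauchy : ∀ ε : ℝ≥0∞, 0 < ε → ∃ N, ∀ k ≥ N, ∀ l ≥ N,
      ∫⁻ x, sobolevDensity (fun x => η k x - η l x) x ∂μ ≤ ε)
    (hsmall : Filter.Tendsto (fun k => ∫⁻ x in Aᶜ, sobolevDensity (η k) x ∂μ) Filter.atTop (𝓝 0))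
    {ε : ℝ≥0∞} (hε : 0 < ε) (N₀ : ℕ) :
    ∃ k ≥ N₀, ∃ θ : F → ℝ, ContDiff ℝ ∞ θ ∧ HasCompactSupport θ ∧ tsupport θ ⊆ O ∧
      ∫⁻ x, sobolevDensity (fun x => η k x - θ x) x ∂μ ≤ ε := by
  -- The error will be a sum of four terms; applying the estimate for a sum twice gives each of them
  -- the factor 4.
  have hδ : 0 < ε / 16 := ENNReal.div_pos hε.ne' (by simp)
  have hηc : ∀ k, HasCompactSupport (η k) := fun k => hS.of_isClosed_subset
    (isClosed_tsupport _) (hηs k)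
  -- The order of choices matters: `t` depends on the fixed function `η N`, the cutoff `κ` and its
  -- bound `B` depend on `t`, and `k` is taken last so that the mass of `η k` outside `A` is small
  -- compared with `B`.
  obtain ⟨N, hN⟩ := hcauchy _ hδ
  have h1 := (tendsto_lintegral_sobolevDensity_sub_translate μ (hη N) (hηc N) v).eventually
    (ge_mem_nhds hδ)
  obtain ⟨t, ht1, ht2⟩ := ((h1.filter_mono nhdsWithin_le_nhds).and hv).exists
  have hS1 : IsCompact ((fun x => x + t • v) '' (S ∩ A)) :=
    (hS.inter_right hA).image (by fun_prop)
  obtain ⟨κ, hκ, hκc, hκO, hκ1⟩ := exists_smooth_cutoff hS1 hO (by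
    rintro - ⟨x, hx, rfl⟩
    exact ht2 x hx)
  obtain ⟨B, hB⟩ := exists_bound_one_sub hκ hκc
  have h2 : Filter.Tendsto (fun k => ENNReal.ofReal (4 * B ^ 2) *
      ∫⁻ x in Aᶜ, sobolevDensity (η k) x ∂μ) Filter.atTop (𝓝 0) := by
    simpa only [mul_zero] using ENNReal.Tendsto.const_mul (a := ENNReal.ofReal (4 * B ^ 2)) hsmall
      (Or.inr ENNReal.ofReal_ne_top)
  obtain ⟨k, hk1, hk2⟩ := ((h2.eventually (ge_mem_nhds hδ)).and
    (Filter.eventually_ge_atTop (max N N₀))).exists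
  have hkN : N ≤ k := (le_max_left _ _).trans hk2
  have hτ : ∀ l, ContDiff ℝ ∞ (fun x => η l (x - t • v)) := fun l =>
    (hη l).comp (contDiff_id.sub contDiff_const)
  refine ⟨k, (le_max_right _ _).trans hk2, fun x => κ x * η k (x - t • v), hκ.mul (hτ k),
    hκc.mul_right, (tsupport_mul_subset_left).trans hκO, ?_⟩
  -- The four terms are small, in turn, by the Cauchy property, by continuity of translation for `η
  -- N`, by the Cauchy property after translation, and by smallness of `η k` outside `A`.
  have e1 : (fun x => η k x - κ x * η k (x - t • v)) = fun x =>
      ((η k x - η N x) + (η N x - η N (x - t • v))) +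
      ((η N (x - t • v) - η k (x - t • v)) + (1 - κ x) * η k (x - t • v)) := by
    funext x; ring
  have b3 : ∫⁻ x, sobolevDensity (fun x => η N (x - t • v) - η k (x - t • v)) x ∂μ ≤ ε / 16 := by
    have : ∀ x, sobolevDensity (fun x => η N (x - t • v) - η k (x - t • v)) x =
        sobolevDensity (fun x => η N x - η k x) (x - t • v) := fun x =>
      sobolevDensity_comp_sub (fun x => η N x - η k x) (t • v) x
    simp only [this]
    rw [lintegral_sub_right_eq_self (μ := μ) (sobolevDensity (fun x => η N x - η k x))]
    exact hN N le_rfl k hkN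
  have b4 : ∫⁻ x, sobolevDensity (fun x => (1 - κ x) * η k (x - t • v)) x ∂μ ≤ ε / 16 := by
    refine le_trans ?_ hk1
    rw [← lintegral_indicator hA.isOpen_compl.measurableSet, ← lintegral_const_mul _
      ((measurable_sobolevDensity (hη k).continuous).indicator hA.isOpen_compl.measurableSet),
      ← lintegral_sub_right_eq_self (μ := μ) (fun x => ENNReal.ofReal (4 * B ^ 2) *
        Aᶜ.indicator (sobolevDensity (η k)) x) (t • v)]
    refine lintegral_mono fun x => ?_
    have hρ : DifferentiableAt ℝ (fun x => 1 - κ x) x :=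
      (hκ.differentiable (by simp) x).const_sub 1
    -- If the point comes from `A`, the term vanishes near `x`: either the point lies in `S` too and
    -- `κ` is one near `x`, or `η k` vanishes near it.
    by_cases hxA : x - t • v ∈ A
    · have h0 : (fun x => (1 - κ x) * η k (x - t • v)) =ᶠ[𝓝 x] fun _ => 0 := by
        by_cases hxS : x - t • v ∈ S
        · filter_upwards [hκ1 x ⟨_, ⟨hxS, hxA⟩, by simp⟩] with y hy
          rw [hy]; ring
        · have h5 : Filter.Tendsto (fun y => y - t • v) (𝓝 x) (𝓝 (x - t • v)) :=
            (continuous_id.sub continuous_const).tendsto x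
          filter_upwards [h5.eventually (hS.isClosed.isOpen_compl.mem_nhds hxS)] with y hy
          rw [image_eq_zero_of_notMem_tsupport (fun h => hy (hηs k h)), mul_zero]
      have h6 : sobolevDensity (fun x => (1 - κ x) * η k (x - t • v)) x = 0 := by
        rw [sobolevDensity, h0.fderiv_eq, h0.eq_of_nhds, fderiv_const_apply,
          enorm_sq_eq_ofReal, enorm_sq_eq_ofReal, norm_zero, norm_zero]
        simp
      rw [h6]
      exact zero_le
    · rw [indicator_of_mem (show x - t • v ∈ Aᶜ from hxA), ← sobolevDensity_comp_sub]
      exact sobolevDensity_mul_le hρ ((hτ k).differentiable (by simp) x) (hB x).1 (hB x).2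
  have c1 : ContDiff ℝ ∞ fun x => η k x - η N x := (hη k).sub (hη N)
  have c2 : ContDiff ℝ ∞ fun x => η N x - η N (x - t • v) := (hη N).sub (hτ N)
  have c3 : ContDiff ℝ ∞ fun x => η N (x - t • v) - η k (x - t • v) := (hτ N).sub (hτ k)
  have c4 : ContDiff ℝ ∞ fun x => (1 - κ x) * η k (x - t • v) := (contDiff_const.sub hκ).mul (hτ k)
  rw [e1]
  calc _ ≤ _ := lintegral_sobolevDensity_add_le μ (c1.add c2) (c3.add c4)
    _ ≤ 2 * (2 * (ε / 16 + ε / 16) + 2 * (ε / 16 + ε / 16)) := by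
        gcongr
        · exact (lintegral_sobolevDensity_add_le μ c1 c2).trans (by
            gcongr
            exact hN k hkN N le_rfl)
        · exact (lintegral_sobolevDensity_add_le μ c3 c4).trans (by gcongr)
    _ = 16 * (ε / 16) := by ring
    _ = ε := ENNReal.mul_div_cancel (by simp) (by simp)

end Translation

end SchwarzManifold
end

/-! ### Passing between functions on the manifold and functions in a chart -/

noncomputable section

namespace SchwarzManifold

set_option linter.unusedSectionVars false

section Characterization

variable {d : ℕ} {H : Type*} [TopologicalSpace H]
  {I : ModelWithCorners ℝ (EuclideanSpace ℝ (Fin d)) H}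
  {M : Type*} [TopologicalSpace M] [ChartedSpace H M] [IsManifold I ∞ M]
  [MeasurableSpace M] [BorelSpace M] [CompactSpace M]
  {e e' : OpenPartialHomeomorph M H}

local notation "𝔼" => EuclideanSpace ℝ (Fin d)

theorem isCompact_extend_image_tsupport {φ : M → ℝ} (hs : tsupport φ ⊆ e.source) :
    IsCompact (e.extend I '' tsupport φ) := by
  refine (isClosed_tsupport φ).isCompact.image_of_continuousOn (e.continuousOn_extend.mono ?_)
  rwa [e.extend_source]

theorem tsupport_chartExt_subset {φ : M → ℝ} (hs : tsupport φ ⊆ e.source) :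
    tsupport (chartExt I e φ) ⊆ e.extend I '' tsupport φ := by
  refine closure_minimal (fun y hy => ?_) (isCompact_extend_image_tsupport hs).isClosed
  by_cases hyt : y ∈ (e.extend I).target
  · rw [Function.mem_support, chartExt_of_mem hyt] at hy
    exact ⟨_, subset_tsupport _ hy, (e.extend I).right_inv hyt⟩
  · exact absurd (chartExt_of_notMem hyt) hy

theorem contDiff_chartExt (he : e ∈ IsManifold.maximalAtlas I ∞ M) {φ : M → ℝ}
    (hφ : ContMDiff I 𝓘(ℝ, ℝ) ∞ φ) (hs : tsupport φ ⊆ e.source)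
    (hs' : tsupport φ ⊆ I.interior M) : ContDiff ℝ ∞ (chartExt I e φ) := by
  rw [contDiff_iff_contDiffAt]
  intro y
  by_cases hyt : y ∈ (e.extend I).target
  · exact contDiffAt_chartExt he hφ hs' (Or.inl hyt)
  · have h1 : y ∉ tsupport (chartExt I e φ) := by
      intro h
      obtain ⟨x, hx, rfl⟩ := tsupport_chartExt_subset hs h
      exact hyt ((e.extend I).map_source (by rw [e.extend_source]; exact hs hx))
    refine (contDiffAt_const (c := (0 : ℝ))).congr_of_eventuallyEq ?_
    filter_upwards [(isClosed_tsupport _).isOpen_compl.mem_nhds h1] with z hz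
    exact image_eq_zero_of_notMem_tsupport hz

theorem chartExt_sub (φ ψ : M → ℝ) :
    chartExt I e (fun p => φ p - ψ p) = fun y => chartExt I e φ y - chartExt I e ψ y := by
  funext y
  by_cases hyt : y ∈ (e.extend I).target
  · rw [chartExt_of_mem hyt, chartExt_of_mem hyt, chartExt_of_mem hyt]
  · rw [chartExt_of_notMem hyt, chartExt_of_notMem hyt, chartExt_of_notMem hyt, sub_zero]

variable (I) in
open Classical in
/-- The function on the manifold with a given coordinate representation, extended by zero. -/
def chartLift (e : OpenPartialHomeomorph M H) (θ : 𝔼 → ℝ) (p : M) : ℝ :=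
  if p ∈ e.source then θ (e.extend I p) else 0

theorem isCompact_extend_symm_image {S : Set 𝔼} (hS : IsCompact S) (hST : S ⊆ (e.extend I).target) :
    IsCompact ((e.extend I).symm '' S) :=
  hS.image_of_continuousOn (e.continuousOn_extend_symm.mono hST)

theorem tsupport_chartLift_subset [T2Space M] {θ : 𝔼 → ℝ} (hc : HasCompactSupport θ)
    (hs : tsupport θ ⊆ (e.extend I).target) :
    tsupport (chartLift I e θ) ⊆ (e.extend I).symm '' tsupport θ := by
  refine closure_minimal (fun p hp => ?_) (isCompact_extend_symm_image hc hs).isClosed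
  rw [Function.mem_support, chartLift] at hp
  split_ifs at hp with h
  · refine ⟨_, subset_tsupport _ hp, (e.extend I).left_inv ?_⟩
    rwa [e.extend_source]
  · exact absurd rfl hp

theorem tsupport_chartLift_subset_chartPart [T2Space M] {θ : 𝔼 → ℝ} (hc : HasCompactSupport θ)
    (hs : tsupport θ ⊆ (e.extend I).target) :
    tsupport (chartLift I e θ) ⊆ chartPart I e (tsupport θ) := by
  refine (tsupport_chartLift_subset hc hs).trans ?_
  rintro - ⟨y, hy, rfl⟩
  refine ⟨extend_symm_mem_source (hs hy), ?_⟩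
  rwa [mem_preimage, (e.extend I).right_inv (hs hy)]

theorem contMDiff_chartLift [T2Space M] (he : e ∈ IsManifold.maximalAtlas I ∞ M) {θ : 𝔼 → ℝ}
    (hθ : ContDiff ℝ ∞ θ) (hc : HasCompactSupport θ) (hs : tsupport θ ⊆ (e.extend I).target) :
    ContMDiff I 𝓘(ℝ, ℝ) ∞ (chartLift I e θ) := by
  intro p
  by_cases hp : p ∈ e.source
  · have h1 : ContMDiffAt I 𝓘(ℝ, ℝ) ∞ (fun q => θ (e.extend I q)) p :=
      (hθ.contMDiff.contMDiffAt).comp p (e.contMDiffAt_extend he hp)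
    refine h1.congr_of_eventuallyEq ?_
    filter_upwards [e.open_source.mem_nhds hp] with q hq
    rw [chartLift, if_pos hq]
  · have h1 : p ∉ tsupport (chartLift I e θ) := fun h =>
      hp (tsupport_chartLift_subset_chartPart hc hs h).1
    refine (contMDiffAt_const (c := (0 : ℝ))).congr_of_eventuallyEq ?_
    filter_upwards [(isClosed_tsupport _).isOpen_compl.mem_nhds h1] with z hz
    exact image_eq_zero_of_notMem_tsupport hz

theorem chartExt_chartLift {θ : 𝔼 → ℝ} (hs : tsupport θ ⊆ (e.extend I).target) :
    chartExt I e (chartLift I e θ) = θ := by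
  funext y
  by_cases hyt : y ∈ (e.extend I).target
  · rw [chartExt_of_mem hyt, chartLift, if_pos (extend_symm_mem_source hyt),
      (e.extend I).right_inv hyt]
  · rw [chartExt_of_notMem hyt, image_eq_zero_of_notMem_tsupport fun h => hyt (hs h)]

/-- The density of the square of the norm of `H¹`. -/
def energyDensity (g : Metric I M) (φ : M → ℝ) (p : M) : ℝ≥0∞ := ‖φ p‖ₑ ^ 2 + gradDensity g φ p

theorem energyDensity_eq_zero (g : Metric I M) {φ : M → ℝ} {p : M} (hp : p ∉ tsupport φ) :
    energyDensity g φ p = 0 := by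
  have h1 : φ =ᶠ[𝓝 p] fun _ => 0 := by
    filter_upwards [(isClosed_tsupport _).isOpen_compl.mem_nhds hp] with z hz
    exact image_eq_zero_of_notMem_tsupport hz
  have h2 : differential I φ p = 0 := h1.mfderiv_eq.trans mfderiv_const
  rw [energyDensity, gradDensity, classicalGrad, h2, h1.eq_of_nhds, map_zero, map_zero]
  simp

theorem sobolevDensity_eq_zero {F : Type*} [NormedAddCommGroup F] [NormedSpace ℝ F]
    {η : F → ℝ} {x : F} (hx : x ∉ tsupport η) : sobolevDensity η x = 0 := by
  rw [sobolevDensity, image_eq_zero_of_notMem_tsupport hx,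
    image_eq_zero_of_notMem_tsupport (fun h => hx (tsupport_fderiv_subset ℝ h)),
    enorm_sq_eq_ofReal, enorm_sq_eq_ofReal, norm_zero, norm_zero]
  simp

theorem exists_lintegral_sobolevDensity_chartExt_le (g : Metric I M)
    (he : e ∈ IsManifold.maximalAtlas I ∞ M) {Q : Set 𝔼} (hQ : IsCompact Q)
    (hQT : Q ⊆ (e.extend I).target) :
    ∃ C : NNReal, ∀ φ : M → ℝ, ContMDiff I 𝓘(ℝ, ℝ) ∞ φ →
      ∀ S : Set 𝔼, MeasurableSet S → S ⊆ Q →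
      (∫⁻ y in S, sobolevDensity (chartExt I e φ) y ≤
        C * ∫⁻ p in chartPart I e S, energyDensity g φ p ∂(vol g)) ∧
      ∫⁻ p in chartPart I e S, energyDensity g φ p ∂(vol g) ≤
        C * ∫⁻ y in S, sobolevDensity (chartExt I e φ) y := by
  obtain ⟨C₁, hC₁⟩ := exists_setLIntegral_chartPart_bounds g he hQ hQT
  obtain ⟨C₂, hC₂⟩ := exists_lintegral_fderiv_chartExt_le g he hQ hQT
  refine ⟨C₁ + C₂, fun φ hφ S hS hSQ => ?_⟩
  have hm : Measurable fun p => ‖φ p‖ₑ ^ 2 := hφ.continuous.measurable.enorm.pow_const 2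
  have hm' : AEMeasurable (fun y => ‖chartExt I e φ y‖ₑ ^ 2) (volume.restrict S) := by
    have h1 : ContinuousOn (fun y => φ ((e.extend I).symm y)) (e.extend I).target :=
      (contDiffOn_comp_extend_symm he hφ).continuousOn
    have h2 := (h1.mono (hSQ.trans hQT)).aestronglyMeasurable (μ := volume) hS
    refine (h2.enorm.pow_const 2).congr ?_
    filter_upwards [ae_restrict_mem hS] with y hy
    rw [chartExt_of_mem (hQT (hSQ hy))]
  obtain ⟨a1, a2⟩ := hC₁ _ hm.aemeasurable S hS hSQ
  obtain ⟨b1, b2⟩ := hC₂ φ hφ S hS hSQ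
  have e1 : ∫⁻ y in S, ‖φ ((e.extend I).symm y)‖ₑ ^ 2 = ∫⁻ y in S, ‖chartExt I e φ y‖ₑ ^ 2 :=
    setLIntegral_congr_fun hS fun y hy => by
      rw [chartExt_of_mem (hQT (hSQ hy))]
  rw [e1] at a1 a2
  simp only [sobolevDensity, energyDensity]
  rw [lintegral_add_left' hm', lintegral_add_left hm]
  set A := ∫⁻ y in S, ‖chartExt I e φ y‖ₑ ^ 2
  set B := ∫⁻ y in S, ‖fderiv ℝ (chartExt I e φ) y‖ₑ ^ 2
  set A' := ∫⁻ p in chartPart I e S, ‖φ p‖ₑ ^ 2 ∂(vol g)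
  set B' := ∫⁻ p in chartPart I e S, gradDensity g φ p ∂(vol g)
  push_cast
  constructor
  · calc A + B ≤ C₁ * A' + C₂ * B' := add_le_add a2 b1
      _ ≤ C₁ * A' + C₂ * B' + (C₁ * B' + C₂ * A') := le_self_add
      _ = _ := by ring
  · calc A' + B' ≤ C₁ * A + C₂ * B := add_le_add a1 b2
      _ ≤ C₁ * A + C₂ * B + (C₁ * B + C₂ * A) := le_self_add
      _ = _ := by ring

theorem norm_sq_le_lintegral_energyDensity {g : Metric I M} {𝓕 : AdaptedFrame g} {z : PairSpace g}
    (hz : z ∈ weakGraph 𝓕) {φ : M → ℝ} (hφ : ContMDiff I 𝓘(ℝ, ℝ) ∞ φ) (hzφ : z.fst =ᵐ[vol g] φ) :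
    ENNReal.ofReal (‖z‖ ^ 2) ≤
      ENNReal.ofReal (𝓕.K + 1) * ∫⁻ p, energyDensity g φ p ∂(vol g) := by
  have hK := 𝓕.K_pos
  have hX : 𝓕.field z.snd =ᵐ[vol g] classicalGrad g φ :=
    IsWeakGrad.ae_unique hz (isWeakGrad_classicalGrad g hφ) hzφ
  refine (ENNReal.ofReal_le_ofReal (norm_sq_le_energyForm_one 𝓕 z)).trans_eq ?_
  rw [ENNReal.ofReal_mul (by positivity), energyForm_eq_integral,
    ofReal_integral_eq_lintegral_ofReal]
  · congr 1
    refine lintegral_congr_ae ?_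
    filter_upwards [hzφ, hX] with p h1 h2
    rw [energyDensity, gradDensity, pairInner, h1, h2, enorm_sq_eq_ofReal, Real.norm_eq_abs, sq_abs,
      ← ENNReal.ofReal_add (sq_nonneg _) (metricAt_self_nonneg g p _)]
    congr 1
    ring
  · exact (integrable_pairInner 𝓕 z z).add (by
      simpa only [mul_assoc] using (integrable_fst_mul z.fst z.fst).const_mul 1)
  · refine Filter.Eventually.of_forall fun p => ?_
    have h1 : 0 ≤ pairInner 𝓕 z z p := metricAt_self_nonneg g p _
    have h2 := mul_self_nonneg (z.fst p)
    simp only [Pi.zero_apply, one_mul]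
    positivity

/-- On `S` the function and the field of `w` vanish, so there the energy density of `φ` is that of
the difference `z - w`. With `w = 0` it bounds the whole energy; with `S` outside a subdomain it
shows that approximants of `w` have little energy there. -/
theorem lintegral_energyDensity_le {g : Metric I M} {𝓕 : AdaptedFrame g} {z w : PairSpace g}
    (hz : z ∈ weakGraph 𝓕) {φ : M → ℝ} (hφ : ContMDiff I 𝓘(ℝ, ℝ) ∞ φ) (hzφ : z.fst =ᵐ[vol g] φ)
    {S : Set M} (hS : MeasurableSet S) (hw : ∀ᵐ p ∂(vol g), p ∈ S → w.fst p = 0)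
    (hwX : ∀ᵐ p ∂(vol g), p ∈ S → 𝓕.field w.snd p = 0) :
    ∫⁻ p in S, energyDensity g φ p ∂(vol g) ≤ ENNReal.ofReal ((𝓕.K + 1) * ‖z - w‖ ^ 2) := by
  have hX : 𝓕.field z.snd =ᵐ[vol g] classicalGrad g φ :=
    IsWeakGrad.ae_unique hz (isWeakGrad_classicalGrad g hφ) hzφ
  refine le_trans ?_ (ENNReal.ofReal_le_ofReal (energyForm_one_self_le 𝓕 (z - w)))
  rw [energyForm_eq_integral, ofReal_integral_eq_lintegral_ofReal]
  · refine le_trans ?_ (setLIntegral_le_lintegral S _)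
    refine lintegral_mono_ae ((ae_restrict_iff' hS).2 ?_)
    filter_upwards [hzφ, hX, hw, hwX, Lp.coeFn_sub z.fst w.fst, Lp.coeFn_sub z.snd w.snd]
      with p h1 h2 h3 h4 h5 h6 hp
    have h7 : 𝓕.field (z - w).snd p = classicalGrad g φ p := by
      have : 𝓕.field (z - w).snd p = 𝓕.field z.snd p - 𝓕.field w.snd p := by
        rw [AdaptedFrame.field, WithLp.sub_snd, h6, Pi.sub_apply, map_sub]
        rfl
      rw [this, h2, h4 hp, sub_zero]
    rw [energyDensity, gradDensity, pairInner, h7, WithLp.sub_fst, h5, Pi.sub_apply, h1, h3 hp,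
      enorm_sq_eq_ofReal, Real.norm_eq_abs, sq_abs,
      ← ENNReal.ofReal_add (sq_nonneg _) (metricAt_self_nonneg g p _)]
    refine ENNReal.ofReal_le_ofReal (le_of_eq ?_)
    ring
  · exact (integrable_pairInner 𝓕 _ _).add (by
      simpa only [mul_assoc] using (integrable_fst_mul (z - w).fst (z - w).fst).const_mul 1)
  · refine Filter.Eventually.of_forall fun p => ?_
    have h1 : 0 ≤ pairInner 𝓕 (z - w) (z - w) p := metricAt_self_nonneg g p _
    have h2 := mul_self_nonneg ((z - w).fst p)
    simp only [Pi.zero_apply, one_mul]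
    positivity

theorem setLIntegral_eq_of_forall_notMem {α : Type*} [MeasurableSpace α] {μ : Measure α}
    {f : α → ℝ≥0∞} {S T : Set α} (hS : MeasurableSet S) (hT : MeasurableSet T)
    (h : ∀ x ∉ T, f x = 0) : ∫⁻ x in S, f x ∂μ = ∫⁻ x in S ∩ T, f x ∂μ := by
  rw [← lintegral_indicator hS, ← lintegral_indicator (hS.inter hT)]
  refine lintegral_congr fun x => ?_
  by_cases hx : x ∈ T
  · by_cases hxS : x ∈ S <;> simp [hx, hxS]
  · by_cases hxS : x ∈ S <;> simp [hx, hxS, h x hx]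

end Characterization

end SchwarzManifold
end

/-! ### Functions in H¹₀(M) that vanish outside a Lipschitz subdomain -/

noncomputable section

namespace SchwarzManifold

set_option linter.unusedSectionVars false

section VanishingOutside

variable {d : ℕ} {H : Type*} [TopologicalSpace H]
  {I : ModelWithCorners ℝ (EuclideanSpace ℝ (Fin d)) H}
  {M : Type*} [TopologicalSpace M] [ChartedSpace H M] [IsManifold I ∞ M]
  [MeasurableSpace M] [BorelSpace M] [CompactSpace M] [T2Space M]
  {e e' : OpenPartialHomeomorph M H}

local notation "𝔼" => EuclideanSpace ℝ (Fin d)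

/-- Functions that vanish outside `K` are approximated by test functions of `K` if, in a chart, `K`
is moved into its interior by small translations in a given direction. -/
theorem mem_pairH10_of_translate {g : Metric I M} (𝓕 : AdaptedFrame g)
    (he : e ∈ IsManifold.maximalAtlas I ∞ M) {K : Set M} (hK : IsClosed K) {Q S A O : Set 𝔼} {v : 𝔼}
    (hQ : IsCompact Q) (hQT : Q ⊆ (e.extend I).target) (hS : IsCompact S) (hSQ : S ⊆ Q)
    (hA : IsClosed A) (hO : IsOpen O) (hOQ : O ⊆ Q) (hOK : chartPart I e O ⊆ interior K)
    (hKA : ∀ p ∈ chartPart I e Q, p ∈ K → e.extend I p ∈ A)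
    (hv : ∀ᶠ t : ℝ in 𝓝[>] 0, ∀ x ∈ S ∩ A, x + t • v ∈ O)
    {W : ℕ → PairSpace g} {w : PairSpace g} {a : ℕ → M → ℝ}
    (hW : ∀ k, W k ∈ weakGraph 𝓕) (ha : ∀ k, ContMDiff I 𝓘(ℝ, ℝ) ∞ (a k))
    (hWa : ∀ k, (W k).fst =ᵐ[vol g] a k) (has : ∀ k, tsupport (a k) ⊆ chartPart I e S)
    (has' : ∀ k, tsupport (a k) ⊆ I.interior M)
    (hlim : Filter.Tendsto W Filter.atTop (𝓝 w)) (hw : ∀ᵐ p ∂(vol g), p ∈ Kᶜ → w.fst p = 0) :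
    w ∈ pairH10 𝓕 K := by
  have hwg : w ∈ weakGraph 𝓕 := (isClosed_weakGraph 𝓕).mem_of_tendsto hlim
    (Filter.Eventually.of_forall hW)
  -- Closedness of `K` makes the complement open, so the gradient of `w` vanishes there along with
  -- `w`.
  have hwX := IsWeakGrad.ae_eq_zero_of_isOpen hwg hK.isOpen_compl hw
  have hsrc : ∀ k, tsupport (a k) ⊆ e.source := fun k => (has k).trans inter_subset_left
  obtain ⟨C, hC⟩ := exists_lintegral_sobolevDensity_chartExt_le g he hQ hQT
  set η : ℕ → 𝔼 → ℝ := fun k => chartExt I e (a k)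
  have hη : ∀ k, ContDiff ℝ ∞ (η k) := fun k => contDiff_chartExt he (ha k) (hsrc k) (has' k)
  have hηs : ∀ k, tsupport (η k) ⊆ S := fun k =>
    (tsupport_chartExt_subset (hsrc k)).trans (by
      rintro - ⟨p, hp, rfl⟩
      exact (has k hp).2)
  have hzero : ∀ k, ∀ y ∉ Q, sobolevDensity (η k) y = 0 := fun k y hy =>
    sobolevDensity_eq_zero fun h => hy (hSQ (hηs k h))
  have hlimd : Filter.Tendsto (fun k => (C : ℝ≥0∞) * ENNReal.ofReal ((𝓕.K + 1) * ‖W k - w‖ ^ 2))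
      Filter.atTop (𝓝 0) := by
    have h1 : Filter.Tendsto (fun k => (𝓕.K + 1) * ‖W k - w‖ ^ 2) Filter.atTop (𝓝 0) := by
      have := ((tendsto_iff_norm_sub_tendsto_zero.1 hlim).pow 2).const_mul (𝓕.K + 1)
      simpa using this
    have h2 := ENNReal.tendsto_ofReal h1
    rw [ENNReal.ofReal_zero] at h2
    simpa only [mul_zero] using ENNReal.Tendsto.const_mul (a := (C : ℝ≥0∞)) h2
      (Or.inr ENNReal.coe_ne_top)
  have hcauchy : ∀ ε : ℝ≥0∞, 0 < ε → ∃ N, ∀ k ≥ N, ∀ l ≥ N,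
      ∫⁻ x, sobolevDensity (fun x => η k x - η l x) x ≤ ε := by
    have h1 : ∀ k l, ∫⁻ x, sobolevDensity (fun x => η k x - η l x) x ≤
        C * ENNReal.ofReal ((𝓕.K + 1) * ‖W k - W l‖ ^ 2) := by
      intro k l
      have e1 : (fun x => η k x - η l x) = chartExt I e (fun p => a k p - a l p) :=
        (chartExt_sub _ _).symm
      have h0 : ∀ x ∉ Q, sobolevDensity (fun x => η k x - η l x) x = 0 := fun x hx => by
        refine sobolevDensity_eq_zero fun h => hx (hSQ ?_)
        refine closure_minimal (fun y hy => ?_) hS.isClosed h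
        by_contra hyS
        exact hy (by
          simp only
          rw [image_eq_zero_of_notMem_tsupport fun h => hyS (hηs k h),
            image_eq_zero_of_notMem_tsupport fun h => hyS (hηs l h), sub_zero])
      have hd := (ha k).sub (ha l)
      rw [← setLIntegral_univ, setLIntegral_eq_of_forall_notMem MeasurableSet.univ
        hQ.measurableSet h0, univ_inter, e1]
      refine (hC _ hd Q hQ.measurableSet subset_rfl).1.trans (mul_le_mul_right ?_ _)
      refine (lintegral_mono_set (subset_univ _)).trans ?_
      have h2 := lintegral_energyDensity_le (w := 0) (sub_mem (hW k) (hW l)) hd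
        ((sub_fst_ae_eq (hWa k).symm (hWa l).symm).symm) MeasurableSet.univ
        (by filter_upwards [Lp.coeFn_zero ℝ 2 (vol g)] with p hp _ using hp)
        (by
          filter_upwards [Lp.coeFn_zero 𝔼 2 (vol g)] with p hp _
          rw [AdaptedFrame.field, WithLp.zero_snd, hp, Pi.zero_apply, map_zero])
      rwa [sub_zero] at h2
    intro ε hε
    have h2 := cauchySeq_iff_tendsto_dist_atTop_0.1 hlim.cauchySeq
    have h3 : Filter.Tendsto (fun n : ℕ × ℕ => (C : ℝ≥0∞) *
        ENNReal.ofReal ((𝓕.K + 1) * ‖W n.1 - W n.2‖ ^ 2)) Filter.atTop (𝓝 0) := by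
      simp only [dist_eq_norm] at h2
      have h4 := ENNReal.tendsto_ofReal ((h2.pow 2).const_mul (𝓕.K + 1))
      simpa using ENNReal.Tendsto.const_mul (a := (C : ℝ≥0∞)) h4 (Or.inr ENNReal.coe_ne_top)
    obtain ⟨⟨N₁, N₂⟩, hN⟩ := Filter.eventually_atTop.1 (h3.eventually (ge_mem_nhds hε))
    exact ⟨max N₁ N₂, fun k hk l hl => (h1 k l).trans
      (hN (k, l) ⟨(le_max_left _ _).trans hk, (le_max_right _ _).trans hl⟩)⟩
  -- In `Q`, points off `A` lie off `K`, where `w` and its gradient vanish; the energy of `W k`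
  -- there is at most a multiple of `‖W k - w‖ ^ 2`.
  have hsmall : Filter.Tendsto (fun k => ∫⁻ x in Aᶜ, sobolevDensity (η k) x)
      Filter.atTop (𝓝 0) := by
    refine tendsto_of_tendsto_of_tendsto_of_le_of_le tendsto_const_nhds hlimd (fun _ => zero_le)
      fun k => ?_
    have hAm := hA.isOpen_compl.measurableSet
    simp only
    rw [setLIntegral_eq_of_forall_notMem hAm hQ.measurableSet (hzero k)]
    refine (hC _ (ha k) _ (hAm.inter hQ.measurableSet) inter_subset_right).1.trans
      (mul_le_mul_right ?_ _)
    refine (lintegral_mono_set (t := Kᶜ) ?_).trans (lintegral_energyDensity_le (hW k) (ha k) (hWa k)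
      hK.isOpen_compl.measurableSet hw hwX)
    intro p hp hpK
    exact hp.2.1 (hKA p ⟨hp.1, hp.2.2⟩ hpK)
  change w ∈ closure (testPairs 𝓕 K : Set (PairSpace g))
  rw [Metric.mem_closure_iff]
  intro ε hε
  obtain ⟨N₀, hN₀⟩ := Metric.tendsto_atTop.1 hlim (ε / 2) (by positivity)
  -- `D` is the product of the constants for passing from coordinates to the norm of pairs. Dividing
  -- by `D + 1` avoids the case `D = 0`, and the result is an error of at most `ε / 4`.
  set D : ℝ≥0∞ := ENNReal.ofReal (𝓕.K + 1) * C with hD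
  set δ : ℝ≥0∞ := ENNReal.ofReal ((ε / 4) ^ 2) / (D + 1)
  have hδ : 0 < δ := ENNReal.div_pos (by simpa using hε.ne') (by finiteness)
  obtain ⟨k, hk, θ, hθ, hθc, hθO, hle⟩ := exists_approx_of_translate (volume : Measure 𝔼) hS hA hO hv
    hη hηs hcauchy hsmall hδ N₀
  have hθT : tsupport θ ⊆ (e.extend I).target := hθO.trans (hOQ.trans hQT)
  have hΦ := contMDiff_chartLift he hθ hθc hθT
  have hΦs := (tsupport_chartLift_subset_chartPart hθc hθT).trans
    (inter_subset_inter_right _ (preimage_mono hθO))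
  have hΦi : tsupport (chartLift I e θ) ⊆ I.interior M := fun p hp => by
    rw [mem_interior_iff_of_mem_maximalAtlas he (hΦs hp).1]
    exact interior_maximal (hOQ.trans hQT) hO (hΦs hp).2
  obtain ⟨V, hV, hVΦ, -⟩ := exists_smooth_pair 𝓕 hΦ
  refine ⟨V, ⟨hV, _, hΦ, fun p hp => ⟨hOK (hΦs hp), hΦi hp⟩, hVΦ⟩, ?_⟩
  have hd := (ha k).sub hΦ
  have h1 := norm_sq_le_lintegral_energyDensity (sub_mem (hW k) hV) hd
    ((sub_fst_ae_eq (hWa k).symm hVΦ.symm).symm)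
  have h0 : ∀ p ∉ chartPart I e Q, energyDensity g (fun p => a k p - chartLift I e θ p) p = 0 := by
    intro p hp
    refine energyDensity_eq_zero g fun h => hp ?_
    have h2 : tsupport (fun p => a k p - chartLift I e θ p) ⊆
        tsupport (a k) ∪ tsupport (chartLift I e θ) := by
      refine closure_minimal (fun q hq => ?_) ((isClosed_tsupport _).union (isClosed_tsupport _))
      by_contra hq'
      rw [mem_union, not_or] at hq'
      exact hq (by
        simp only
        rw [image_eq_zero_of_notMem_tsupport hq'.1, image_eq_zero_of_notMem_tsupport hq'.2,
          sub_zero])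
    rcases h2 h with h3 | h3
    · exact ⟨(has k h3).1, hSQ (has k h3).2⟩
    · exact ⟨(hΦs h3).1, hOQ (hΦs h3).2⟩
  have h3 : ∫⁻ p, energyDensity g (fun p => a k p - chartLift I e θ p) p ∂(vol g) ≤ C * δ := by
    rw [← setLIntegral_univ, setLIntegral_eq_of_forall_notMem MeasurableSet.univ
        (measurableSet_chartPart hQ.measurableSet) h0, univ_inter]
    refine (hC _ hd Q hQ.measurableSet subset_rfl).2.trans (mul_le_mul_right ?_ _)
    refine (lintegral_mono_set (subset_univ _)).trans ?_
    rw [setLIntegral_univ]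
    have e2 : chartExt I e (fun p => a k p - chartLift I e θ p) = fun x => η k x - θ x := by
      rw [chartExt_sub, chartExt_chartLift hθT]
    exact (le_of_eq (by rw [← e2])).trans hle
  have h4 : ENNReal.ofReal (‖W k - V‖ ^ 2) ≤ ENNReal.ofReal ((ε / 4) ^ 2) := by
    calc _ ≤ ENNReal.ofReal (𝓕.K + 1) * (C * δ) := h1.trans (mul_le_mul_right h3 _)
      _ = D * δ := by rw [hD, mul_assoc]
      _ ≤ (D + 1) * δ := mul_le_mul_left le_self_add _
      _ = _ := ENNReal.mul_div_cancel (by simp) (by finiteness)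
  rw [ENNReal.ofReal_le_ofReal_iff (by positivity)] at h4
  have h5 : ‖W k - V‖ ≤ ε / 4 := abs_le_of_sq_le_sq' h4 (by positivity) |>.2
  have h6 := hN₀ k hk
  rw [dist_comm] at h6
  calc dist w V ≤ dist w (W k) + dist (W k) V := dist_triangle _ _ _
    _ < ε / 2 + ε / 2 := by
        rw [dist_eq_norm (W k)]
        linarith
    _ = ε := by ring

/-- Near a frontier point `K` is the region above a graph in the direction `ν`. Translation by a
small positive multiple of `ν` lifts it strictly above the graph, hence into its interior, so the
translation argument applies to the product with a cutoff. -/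
theorem exists_nhds_mul_mem_pairH10_of_mem_frontier {g : Metric I M} (𝓕 : AdaptedFrame g)
    {K : Set M} (hK : IsClosedLipschitzSubdomain I K) {p : M} (hp : p ∈ frontier K) :
    ∃ V : Set M, IsOpen V ∧ p ∈ V ∧ ∀ χ : M → ℝ, ContMDiff I 𝓘(ℝ, ℝ) ∞ χ → tsupport χ ⊆ V →
      ∀ z ∈ pairH10 𝓕 univ, (∀ᵐ p ∂(vol g), p ∈ Kᶜ → z.fst p = 0) →
      ∃ w ∈ pairH10 𝓕 K, w.fst =ᵐ[vol g] fun p => χ p * z.fst p := by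
  obtain ⟨e, he, hpe, U, hU, ν, hν, L, γ, hγ, hgraph⟩ := hK.2 p hp
  obtain ⟨r, hr, hrU, hrT, -⟩ := exists_chartPart_mem_nhds hpe hU
  set x₀ := e.extend I p
  refine ⟨chartPart I e (Metric.ball x₀ (r / 2)), e.isOpen_extend_preimage Metric.isOpen_ball,
    ⟨hpe, Metric.mem_ball_self (by positivity)⟩, fun χ hχ hχs z hz hz0 => ?_⟩
  obtain ⟨Z, hZ, hZlim⟩ := mem_closure_iff_seq_limit.1
    (show z ∈ closure (testPairs 𝓕 univ : Set (PairSpace g)) from hz)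
  have hZ' : ∀ k, Z k ∈ weakGraph 𝓕 ∧ ∃ φ : M → ℝ, ContMDiff I 𝓘(ℝ, ℝ) ∞ φ ∧
    tsupport φ ⊆ interior univ ∩ I.interior M ∧ (Z k).fst =ᵐ[vol g] φ := hZ
  choose hZg φ hφ hφs hZφ using hZ'
  choose W hWg hWφ hWX using fun k => exists_smooth_pair 𝓕 (hχ.mul (hφ k))
  obtain ⟨C, hC0, hC⟩ := exists_mul_mem_pairH10 𝓕 hχ (K := univ) (by simp)
  obtain ⟨w, hw, hwz, -⟩ := hC z hz
  have hwg := pairH10_le_weakGraph 𝓕 _ hw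
  have hlim : Filter.Tendsto W Filter.atTop (𝓝 w) := by
    rw [tendsto_iff_norm_sub_tendsto_zero] at hZlim ⊢
    refine squeeze_zero (fun _ => norm_nonneg _) (fun k => ?_)
      (by simpa only [mul_zero] using hZlim.const_mul C)
    -- Boundedness of multiplication, applied to `Z k - z`, transfers convergence of the
    -- approximants to their products with `χ`.
    obtain ⟨w', hw', hwz', hle⟩ := hC (Z k - z) (sub_mem (subset_closure (hZ k)) hz)
    have : W k - w = w' := by
      refine eq_of_mem_weakGraph (sub_mem (hWg k) hwg) (pairH10_le_weakGraph 𝓕 _ hw') ?_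
      filter_upwards [Lp.coeFn_sub (W k).fst w.fst, Lp.coeFn_sub (Z k).fst z.fst, hWφ k, hZφ k, hwz,
        hwz'] with q h1 h2 h3 h4 h5 h6
      rw [h6, WithLp.sub_fst, WithLp.sub_fst, h1, h2, Pi.sub_apply, Pi.sub_apply, h3, h4, h5,
        Pi.mul_apply]
      ring
    rw [this]
    exact hle
  set A : Set 𝔼 := {x | γ (x - inner ℝ ν x • ν) ≤ inner ℝ ν x}
  have hc1 : Continuous fun x : 𝔼 => (inner ℝ ν x : ℝ) := continuous_const.inner continuous_id
  have hc2 : Continuous fun x : 𝔼 => γ (x - (inner ℝ ν x : ℝ) • ν) :=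
    hγ.continuous.comp (continuous_id.sub (hc1.smul continuous_const))
  have hA : IsClosed A := isClosed_le hc2 hc1
  have hA' : {x : 𝔼 | γ (x - (inner ℝ ν x : ℝ) • ν) < inner ℝ ν x} ⊆ interior A :=
    interior_maximal (fun x (hx : γ _ < inner ℝ ν x) => hx.le) (isOpen_lt hc2 hc1)
  have hQ : IsCompact (Metric.closedBall x₀ r ∩ range I) :=
    (isCompact_closedBall _ r).inter_right I.isClosed_range
  have hχe : tsupport χ ⊆ e.source := hχs.trans inter_subset_left
  -- The graph description holds in the full model space, so every point of `A` near `x₀` is the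
  -- coordinate of a point of `K`. In particular, moving up along `ν` does not leave `range I`, even
  -- at boundary points of `M`.
  have hmem : ∀ x ∈ A, x ∈ Metric.closedBall x₀ r → ∃ q ∈ e.source ∩ K, e.extend I q = x := by
    intro x hxA hx
    have : x ∈ (e.extend I) '' (e.source ∩ K) ∩ U := by
      rw [hgraph]
      exact ⟨hxA, hrU hx⟩
    exact this.1
  have hS : e.extend I '' tsupport χ ⊆ Metric.ball x₀ (r / 2) := by
    rintro - ⟨q, hq, rfl⟩
    exact (hχs hq).2
  have hO : interior A ∩ Metric.ball x₀ r ⊆ Metric.closedBall x₀ r ∩ range I := by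
    intro x hx
    refine ⟨Metric.ball_subset_closedBall hx.2, ?_⟩
    obtain ⟨q, -, rfl⟩ := hmem x (interior_subset hx.1) (Metric.ball_subset_closedBall hx.2)
    exact mem_range_self _
  have hOo : IsOpen (interior A ∩ Metric.ball x₀ r) := isOpen_interior.inter Metric.isOpen_ball
  refine ⟨w, mem_pairH10_of_translate 𝓕 he hK.1 (v := ν) (a := fun k p => χ p * φ k p) hQ hrT
    (isCompact_extend_image_tsupport (I := I) hχe) ?_ hA hOo hO ?_ ?_ ?_ hWg
    (fun k => hχ.mul (hφ k)) hWφ (fun k q hq => ?_) (fun k q hq => ?_) hlim ?_, hwz⟩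
  · exact fun x hx => ⟨Metric.ball_subset_closedBall (Metric.ball_subset_ball (by linarith) (hS hx)), by
      obtain ⟨q, -, rfl⟩ := hx
      exact mem_range_self _⟩
  · refine interior_maximal ?_ (e.isOpen_extend_preimage (I := I) hOo)
    rintro q ⟨hqe, hq⟩
    obtain ⟨q', hq', heq⟩ := hmem _ (interior_subset hq.1) (Metric.ball_subset_closedBall hq.2)
    have : q' = q := (e.extend I).injOn (by rw [e.extend_source]; exact hq'.1)
      (by rw [e.extend_source]; exact hqe) heq
    rw [← this]
    exact hq'.2
  · rintro q ⟨hqe, hq⟩ hqK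
    have : e.extend I q ∈ A ∩ U := by
      rw [← hgraph]
      exact ⟨⟨q, ⟨hqe, hqK⟩, rfl⟩, hrU hq.1⟩
    exact this.1
  · have h1 : Ioo (0 : ℝ) (r / 2) ∈ 𝓝[>] (0 : ℝ) := Ioo_mem_nhdsGT (by positivity)
    filter_upwards [h1] with t ht x hx
    refine ⟨hA' ?_, ?_⟩
    -- Moving along the unit vector `ν` raises the height by `t` and leaves the argument of `γ`
    -- unchanged.
    · have h2 : (inner ℝ ν (x + t • ν) : ℝ) = inner ℝ ν x + t := by
        rw [inner_add_right, inner_smul_right, real_inner_self_eq_norm_sq, hν]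
        ring
      have h3 : x + t • ν - (inner ℝ ν (x + t • ν) : ℝ) • ν = x - (inner ℝ ν x : ℝ) • ν := by
        rw [h2, add_smul]
        abel
      rw [mem_ofPred_eq, h3, h2]
      have h4 : γ (x - (inner ℝ ν x : ℝ) • ν) ≤ inner ℝ ν x := hx.2
      linarith [ht.1]
    · have h2 := hS hx.1
      rw [Metric.mem_ball, dist_eq_norm] at h2 ⊢
      have h3 : ‖t • ν‖ = t := by rw [norm_smul, hν, mul_one, Real.norm_of_nonneg ht.1.le]
      calc ‖x + t • ν - x₀‖ = ‖(x - x₀) + t • ν‖ := by congr 1; abel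
        _ ≤ ‖x - x₀‖ + ‖t • ν‖ := norm_add_le _ _
        _ < r := by rw [h3]; linarith [ht.2]
  · have h1 : q ∈ tsupport χ := tsupport_mul_subset_left hq
    exact ⟨hχe h1, mem_image_of_mem _ h1⟩
  · exact (hφs k (tsupport_mul_subset_right hq)).2
  · filter_upwards [hwz, hz0] with q h1 h2 hq
    rw [h1, h2 hq, mul_zero]

/-- Finite smooth partitions of unity on compact manifolds. -/
theorem exists_finite_smooth_partition {ι : Type*} (V : ι → Set M) (hV : ∀ i, IsOpen (V i))
    (hc : ⋃ i, V i = univ) : ∃ (t : Finset ι) (χ : ι → M → ℝ),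
      (∀ i, ContMDiff I 𝓘(ℝ, ℝ) ∞ (χ i)) ∧ (∀ i, tsupport (χ i) ⊆ V i) ∧
      ∀ p, ∑ i ∈ t, χ i p = 1 := by
  obtain ⟨f, hf⟩ := SmoothPartitionOfUnity.exists_isSubordinate I isClosed_univ V hV hc.ge
  have hfin : {i | (Function.support (f i)).Nonempty}.Finite :=
    LocallyFinite.finite_nonempty_of_compact f.locallyFinite
  refine ⟨hfin.toFinset, fun i => f i, fun i => (f i).contMDiff, hf, fun p => ?_⟩
  rw [← f.sum_eq_one (mem_univ p), finsum_eq_sum_of_support_subset]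
  intro i hi
  rw [Finite.coe_toFinset]
  exact ⟨p, hi⟩

/-- An element of `H¹₀(M)` that vanishes outside of a closed Lipschitz subdomain `K` belongs to
`H¹₀(K)`. -/
theorem mem_pairH10_of_ae_eq_zero {g : Metric I M} (𝓕 : AdaptedFrame g)
    {K : Set M} (hK : IsClosedLipschitzSubdomain I K) {z : PairSpace g} (hz : z ∈ pairH10 𝓕 univ)
    (hz0 : ∀ᵐ p ∂(vol g), p ∈ Kᶜ → z.fst p = 0) : z ∈ pairH10 𝓕 K := by
  -- The claim is local by a partition of unity. At interior points the product with a cutoff is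
  -- already supported well inside `K`, at frontier points translation is used, and off `K` the
  -- product is zero.
  have key : ∀ p : M, ∃ V : Set M, IsOpen V ∧ p ∈ V ∧
      ∀ χ : M → ℝ, ContMDiff I 𝓘(ℝ, ℝ) ∞ χ → tsupport χ ⊆ V →
      ∃ w ∈ pairH10 𝓕 K, w.fst =ᵐ[vol g] fun p => χ p * z.fst p := by
    intro p
    by_cases h1 : p ∈ interior K
    · refine ⟨interior K, isOpen_interior, h1, fun χ hχ hχs => ?_⟩
      obtain ⟨C, -, hC⟩ := exists_mul_mem_pairH10 𝓕 hχ hχs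
      obtain ⟨w, hw, hwz, -⟩ := hC z hz
      exact ⟨w, hw, hwz⟩
    by_cases h2 : p ∈ K
    · obtain ⟨V, hV, hpV, h⟩ := exists_nhds_mul_mem_pairH10_of_mem_frontier 𝓕 hK
        (p := p) ⟨subset_closure h2, h1⟩
      exact ⟨V, hV, hpV, fun χ hχ hχs => h χ hχ hχs z hz hz0⟩
    · refine ⟨Kᶜ, hK.1.isOpen_compl, h2, fun χ hχ hχs => ⟨0, zero_mem _, ?_⟩⟩
      filter_upwards [hz0, Lp.coeFn_zero ℝ 2 (vol g)] with q hq hq0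
      rw [WithLp.zero_fst, hq0, Pi.zero_apply]
      by_cases hqK : q ∈ K
      · rw [image_eq_zero_of_notMem_tsupport fun h => hχs h hqK, zero_mul]
      · rw [hq hqK, mul_zero]
  choose V hV hpV h using key
  obtain ⟨t, χ, hχ, hχs, hsum⟩ := exists_finite_smooth_partition (I := I) V hV
    (eq_univ_of_forall fun p => mem_iUnion.2 ⟨p, hpV p⟩)
  choose w hw hwz using fun p => h p (χ p) (hχ p) (hχs p)
  have : z = ∑ p ∈ t, w p := by
    refine eq_of_mem_weakGraph (pairH10_le_weakGraph 𝓕 _ hz)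
      (sum_mem fun p _ => pairH10_le_weakGraph 𝓕 _ (hw p)) ?_
    have h1 : (∑ p ∈ t, w p).fst = ∑ p ∈ t, (w p).fst :=
      map_sum (WithLp.fstL 2 ℝ (Lp ℝ 2 (vol g)) (Lp 𝔼 2 (vol g))) w t
    rw [h1]
    filter_upwards [Lp.coeFn_finsetSum t fun p => (w p).fst, (t.eventually_all).2 fun p _ => hwz p]
      with q hq hq'
    rw [hq, Finset.sum_apply, Finset.sum_congr rfl fun p hp => hq' p hp, ← Finset.sum_mul, hsum,
      one_mul]
  rw [this]
  exact sum_mem fun p _ => hw p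

end VanishingOutside

end SchwarzManifold
end

/-! ### Hilbert space arguments: solvability and contraction by successive projections -/

noncomputable section

namespace SchwarzManifold

set_option linter.unusedSectionVars false

section Hilbert

variable {E : Type*} [NormedAddCommGroup E] [InnerProductSpace ℝ E]

/-- The theorem of Lax and Milgram on a complete subspace. -/
theorem exists_mem_forall_form_eq (a : E →L[ℝ] E →L[ℝ] ℝ) (W : Submodule ℝ E) [CompleteSpace W]
    {c : ℝ} (hc : 0 < c) (hcoer : ∀ w ∈ W, c * ‖w‖ ^ 2 ≤ a w w) (l : E →L[ℝ] ℝ) :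
    ∃ w ∈ W, ∀ v ∈ W, a w v = l v := by
  set B : W →L[ℝ] W →L[ℝ] ℝ := a.bilinearComp W.subtypeL W.subtypeL
  have hBc : IsCoercive B := ⟨c, hc, fun w => by
    have := hcoer w w.2
    rw [pow_two, ← mul_assoc] at this
    exact this⟩
  set r : W := (InnerProductSpace.toDual ℝ W).symm (l.comp W.subtypeL)
  refine ⟨(hBc.continuousLinearEquivOfBilin.symm r : W), Subtype.coe_prop _, fun v hv => ?_⟩
  have h1 := hBc.continuousLinearEquivOfBilin_apply (hBc.continuousLinearEquivOfBilin.symm r)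
    ⟨v, hv⟩
  rw [ContinuousLinearEquiv.apply_symm_apply] at h1
  have h2 : inner ℝ r (⟨v, hv⟩ : W) = l v := InnerProductSpace.toDual_symm_apply
  rw [← h2, h1]
  rfl

/-- Only the difference has to lie in `W`: solutions of a local problem lie in a translate of the
local space. -/
theorem eq_of_forall_form_eq (a : E →L[ℝ] E →L[ℝ] ℝ) (W : Submodule ℝ E)
    {c : ℝ} (hc : 0 < c) (hcoer : ∀ w ∈ W, c * ‖w‖ ^ 2 ≤ a w w) {w w' : E} (hw : w - w' ∈ W)
    (h : ∀ v ∈ W, a w v = a w' v) : w = w' := by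
  have h1 := hcoer _ hw
  have h2 : a (w - w') (w - w') = 0 := by
    rw [map_sub a w w', sub_apply, h _ hw, sub_self]
  rw [h2] at h1
  have h3 : ‖w - w'‖ ^ 2 = 0 := le_antisymm (nonpos_of_mul_nonpos_right h1 hc) (sq_nonneg _)
  exact sub_eq_zero.1 (norm_eq_zero.1 (pow_eq_zero_iff two_ne_zero |>.1 h3))

theorem abs_form_le {a : E →L[ℝ] E →L[ℝ] ℝ} (hsymm : ∀ x y, a x y = a y x)
    (hnonneg : ∀ x, 0 ≤ a x x) (x y : E) : |a x y| ≤ Real.sqrt (a x x) * Real.sqrt (a y y) := by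
  have h1 := LinearMap.BilinForm.apply_mul_apply_le_of_forall_zero_le
    (LinearMap.mk₂ ℝ (fun x y => a x y) (by simp) (by simp) (by simp) (by simp)) hnonneg x y
  simp only [LinearMap.mk₂_apply] at h1
  rw [hsymm y x, ← pow_two] at h1
  refine abs_le_of_sq_le_mul (Real.sqrt_nonneg _) (Real.sqrt_nonneg _) ?_
  rwa [Real.sq_sqrt (hnonneg x), Real.sq_sqrt (hnonneg y)]

/-- Successive projections onto the complements of subspaces contract those vectors that have
a stable decomposition. -/
theorem form_last_le_of_decomposition {a : E →L[ℝ] E →L[ℝ] ℝ} (hsymm : ∀ x y, a x y = a y x)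
    (hnonneg : ∀ x, 0 ≤ a x x) {m : ℕ} {W : Fin m → Submodule ℝ E} {e : Fin (m + 1) → E}
    (hstep : ∀ i, e i.castSucc - e i.succ ∈ W i) (horth : ∀ i, ∀ v ∈ W i, a (e i.succ) v = 0)
    {v : Fin m → E} (hv : ∀ i, v i ∈ W i) (hsum : ∑ i, v i = e 0) {C : ℝ} (hC0 : 0 ≤ C)
    (hC : ∀ i, a (v i) (v i) ≤ C * a (e 0) (e 0)) :
    (m ^ 4 * C + 1) * a (e (Fin.last m)) (e (Fin.last m)) ≤ m ^ 4 * C * a (e 0) (e 0) := by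
  set s : Fin (m + 1) → ℝ := fun i => a (e i) (e i) with hs
  set r : Fin m → E := fun i => e i.castSucc - e i.succ with hr
  -- Pythagoras: the correction `r i` lies in `W i`, to which the new error is orthogonal.
  have hpyth : ∀ i, s i.castSucc = s i.succ + a (r i) (r i) := by
    intro i
    have h1 := horth i _ (hstep i)
    have h2 : e i.castSucc = e i.succ + r i := by simp [hr]
    simp only [hs]
    rw [h2]
    change a (e i.succ) (r i) = 0 at h1
    have h3 : a (r i) (e i.succ) = 0 := by rw [hsymm, h1]
    simp only [map_add, add_apply, h1, h3]
    ring
  have hanti : Antitone s := Fin.antitone_iff_succ_le.2 fun i => by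
    have := hnonneg (r i)
    linarith [hpyth i]
  -- The root of the total energy loss bounds the energy norm of every single correction.
  set δ := Real.sqrt (s 0 - s (Fin.last m)) with hδ
  have hδ2 : δ ^ 2 = s 0 - s (Fin.last m) :=
    Real.sq_sqrt (sub_nonneg.2 (hanti (Fin.zero_le _)))
  have hrδ : ∀ i, Real.sqrt (a (r i) (r i)) ≤ δ := fun i => by
    refine Real.sqrt_le_sqrt ?_
    have h1 := hanti (Fin.zero_le i.castSucc)
    have h2 := hanti (Fin.le_last i.succ)
    linarith [hpyth i]
  have hdiff : ∀ (x : E) (j : Fin (m + 1)),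
      |a (e 0 - e j) x| ≤ j * (δ * Real.sqrt (a x x)) := by
    intro x j
    induction j using Fin.induction with
    | zero => simp
    | succ i ih =>
      have h1 : e 0 - e i.succ = (e 0 - e i.castSucc) + r i := by simp [hr]
      rw [h1, map_add, add_apply]
      refine (abs_add_le _ _).trans ?_
      have h2 : |a (r i) x| ≤ δ * Real.sqrt (a x x) :=
        (abs_form_le hsymm hnonneg _ _).trans
          (mul_le_mul_of_nonneg_right (hrδ i) (Real.sqrt_nonneg _))
      rw [Fin.val_castSucc] at ih
      rw [Fin.val_succ]
      push_cast
      linarith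
  have hs0 : 0 ≤ s 0 := hnonneg _
  have hmain : s 0 ≤ m ^ 2 * (δ * (Real.sqrt C * Real.sqrt (s 0))) := by
    -- Since `e i.succ` is orthogonal to `v i`, it may be subtracted; what remains is a sum of at
    -- most `m` corrections.
    have h1 : s 0 = ∑ i, a (e 0 - e i.succ) (v i) := by
      have : s 0 = a (e 0) (∑ i, v i) := by rw [hsum]
      rw [this, map_sum]
      refine Finset.sum_congr rfl fun i _ => ?_
      rw [map_sub, sub_apply, horth i _ (hv i), sub_zero]
    refine h1.le.trans ?_
    -- There are `m` summands and each involves at most `m` corrections, whence `m ^ 2`; squaring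
    -- produces `m ^ 4 * C`.
    calc _ ≤ ∑ i : Fin m, (m * (δ * (Real.sqrt C * Real.sqrt (s 0))) : ℝ) := by
          refine Finset.sum_le_sum fun i _ => (le_abs_self _).trans ((hdiff _ _).trans ?_)
          rw [← Real.sqrt_mul hC0]
          have h2 : ((i.succ : Fin (m + 1)) : ℝ) ≤ m := by
            exact_mod_cast i.succ.is_le
          have h3 := Real.sqrt_le_sqrt (hC i)
          gcongr
      _ = m * (m * (δ * (Real.sqrt C * Real.sqrt (s 0)))) := by
          rw [Finset.sum_const, Finset.card_univ, Fintype.card_fin, nsmul_eq_mul]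
      _ = _ := by ring
  have hsq : s 0 * s 0 ≤ (m ^ 4 * C * δ ^ 2) * s 0 := by
    have h1 := mul_self_le_mul_self hs0 hmain
    refine h1.trans_eq ?_
    have h2 := Real.mul_self_sqrt hC0
    have h3 := Real.mul_self_sqrt hs0
    calc _ = (m : ℝ) ^ 4 * δ ^ 2 * ((Real.sqrt C * Real.sqrt C) *
          (Real.sqrt (s 0) * Real.sqrt (s 0))) := by ring
      _ = _ := by rw [h2, h3]; ring
  have hfin : s 0 ≤ m ^ 4 * C * δ ^ 2 := by
    rcases hs0.eq_or_lt with h | h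
    · rw [← h]; positivity
    · exact le_of_mul_le_mul_right hsq h
  rw [hδ2] at hfin
  -- Adding `s (Fin.last m) ≤ s 0` to the bound gives the ratio A / (A + 1) with A = m⁴C, which is
  -- below one for every A ≥ 0.
  have h1 := hanti (Fin.zero_le (Fin.last m))
  change (m ^ 4 * C + 1) * s (Fin.last m) ≤ m ^ 4 * C * s 0
  linarith

end Hilbert

/-! ### Unique sequences and finite chains generated by a relation -/

section Recursion

/-- The relation has unique successors only on `S`, so membership in `S` has to be carried along the
induction. -/
theorem existsUnique_iterate {α : Type*} {S : Set α} {R : α → α → Prop}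
    (hS : ∀ x ∈ S, ∀ y, R x y → y ∈ S) (hR : ∀ x ∈ S, ∃! y, R x y) {x₀ : α} (hx₀ : x₀ ∈ S) :
    ∃! U : ℕ → α, U 0 = x₀ ∧ ∀ n, R (U n) (U (n + 1)) := by
  classical
  choose! F hF hF' using hR
  have hmem : ∀ U : ℕ → α, U 0 = x₀ → (∀ n, U n ∈ S → R (U n) (U (n + 1))) → ∀ n, U n ∈ S := by
    intro U h0 h n
    induction n with
    | zero => rwa [h0]
    | succ n ih => exact hS _ ih _ (h n ih)
  have h1 : ∀ n, F^[n] x₀ ∈ S → R (F^[n] x₀) (F^[n + 1] x₀) := fun n hn => by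
    rw [Function.iterate_succ_apply']
    exact hF _ hn
  refine ⟨fun n => F^[n] x₀, ⟨rfl, fun n => h1 n (hmem _ rfl h1 n)⟩, fun U hU => ?_⟩
  funext n
  induction n with
  | zero => exact hU.1
  | succ n ih =>
    have h2 := hmem U hU.1 (fun n _ => hU.2 n) n
    rw [hF' _ h2 _ (hU.2 n), ih, Function.iterate_succ_apply']

/-- The intermediate members are hidden by the quantifier, but each is determined by its
predecessor, so the end is unique. -/
theorem existsUnique_chain {α : Type*} {S : Set α} {m : ℕ} {R : Fin m → α → α → Prop}
    (hS : ∀ i, ∀ x ∈ S, ∀ y, R i x y → y ∈ S) (hR : ∀ i, ∀ x ∈ S, ∃! y, R i x y) {x₀ : α}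
    (hx₀ : x₀ ∈ S) :
    ∃! y, ∃ w : Fin (m + 1) → α, w 0 = x₀ ∧ (∀ i, R i (w i.castSucc) (w i.succ)) ∧
      w (Fin.last m) = y := by
  classical
  choose! F hF hF' using hR
  have hmem : ∀ w : Fin (m + 1) → α, w 0 = x₀ →
      (∀ i, w i.castSucc ∈ S → R i (w i.castSucc) (w i.succ)) → ∀ j, w j ∈ S := by
    intro w h0 h j
    induction j using Fin.induction with
    | zero => rwa [h0]
    | succ i ih => exact hS i _ ih _ (h i ih)
  set w₀ : Fin (m + 1) → α := fun j => Fin.induction (motive := fun _ => α) x₀ (fun i x => F i x) j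
    with hw₀
  have h1 : ∀ i, w₀ i.castSucc ∈ S → R i (w₀ i.castSucc) (w₀ i.succ) := fun i hi => hF i _ hi
  refine ⟨w₀ (Fin.last m), ⟨w₀, rfl, fun i => h1 i (hmem w₀ rfl h1 _), rfl⟩, ?_⟩
  rintro y ⟨w, h0, hw, rfl⟩
  have : ∀ j, w j = w₀ j := by
    intro j
    induction j using Fin.induction with
    | zero => exact h0
    | succ i ih =>
      rw [hF' i _ (hmem w h0 (fun i _ => hw i) _) _ (hw i), ih]
      rfl
  exact this _

theorem mem_of_chain {α : Type*} {S : Set α} {m : ℕ} {R : Fin m → α → α → Prop}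
    (hS : ∀ i, ∀ x ∈ S, ∀ y, R i x y → y ∈ S) {w : Fin (m + 1) → α} (h0 : w 0 ∈ S)
    (hw : ∀ i, R i (w i.castSucc) (w i.succ)) (j : Fin (m + 1)) : w j ∈ S := by
  induction j using Fin.induction with
  | zero => exact h0
  | succ i ih => exact hS i _ ih _ (hw i)

end Recursion

end SchwarzManifold
end

/-! ### Coercivity, local solutions and energy decay of a sweep -/

noncomputable section

namespace SchwarzManifold

set_option linter.unusedSectionVars false

section SchwarzMethod

variable {d : ℕ} {H : Type*} [TopologicalSpace H]
  {I : ModelWithCorners ℝ (EuclideanSpace ℝ (Fin d)) H}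
  {M : Type*} [TopologicalSpace M] [ChartedSpace H M] [IsManifold I ∞ M]
  [MeasurableSpace M] [BorelSpace M] [CompactSpace M] [T2Space M]

local notation "𝔼" => EuclideanSpace ℝ (Fin d)

/-- The energy form is coercive on `H¹₀(M)`. -/
theorem exists_energyForm_coercive [ConnectedSpace M] {g : Metric I M} (𝓕 : AdaptedFrame g) {b : ℝ}
    (hb : 0 ≤ b) (hb' : I.boundary M = ∅ → 0 < b) :
    ∃ c : ℝ, 0 < c ∧ ∀ z ∈ pairH10 𝓕 univ, c * ‖z‖ ^ 2 ≤ energyForm 𝓕 b z z := by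
  have hK := 𝓕.K_pos
  -- The energy controls the L² norm through the term with `b` if there is no boundary, and through
  -- the Poincaré inequality otherwise.
  obtain ⟨B, hB0, hB⟩ : ∃ B : ℝ, 0 ≤ B ∧ ∀ z ∈ pairH10 𝓕 univ,
      ‖z.fst‖ ^ 2 ≤ B * energyForm 𝓕 b z z := by
    rcases (I.boundary M).eq_empty_or_nonempty with h | h
    · have hb0 := hb' h
      refine ⟨1 / b, by positivity, fun z _ => ?_⟩
      rw [energyForm_apply, real_inner_self_eq_norm_sq, mul_add, ← mul_assoc,
        one_div_mul_cancel hb0.ne', one_mul]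
      have := dirichletForm_self_nonneg 𝓕 z
      have : 0 ≤ 1 / b * dirichletForm 𝓕 z z := by positivity
      linarith
    · obtain ⟨C, hC0, hC⟩ := exists_poincare 𝓕 h
      refine ⟨C, hC0, fun z hz => (hC z hz).trans (mul_le_mul_of_nonneg_left ?_ hC0)⟩
      rw [energyForm_apply, real_inner_self_eq_norm_sq]
      have : 0 ≤ b * ‖z.fst‖ ^ 2 := by positivity
      linarith
  -- `𝓕.K` times the energy bounds the components of the gradient, `B` times the energy bounds the
  -- function.
  refine ⟨1 / (𝓕.K + B), by positivity, fun z hz => ?_⟩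
  rw [one_div, inv_mul_le_iff₀ (by positivity), WithLp_norm_sq, add_mul, add_comm]
  refine add_le_add ((norm_snd_sq_le 𝓕 z).trans (mul_le_mul_of_nonneg_left ?_ hK.le)) (hB z hz)
  rw [energyForm_apply, real_inner_self_eq_norm_sq]
  have : 0 ≤ b * ‖z.fst‖ ^ 2 := by positivity
  linarith

theorem energyForm_self_nonneg {g : Metric I M} (𝓕 : AdaptedFrame g) {b : ℝ} (hb : 0 ≤ b)
    (z : PairSpace g) : 0 ≤ energyForm 𝓕 b z z := by
  rw [energyForm_apply, real_inner_self_eq_norm_sq]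
  have := dirichletForm_self_nonneg 𝓕 z
  positivity

/-- The load functional `∫ f v`. -/
def load {g : Metric I M} (f : Lp ℝ 2 (vol g)) : PairSpace g →L[ℝ] ℝ :=
  (innerSL ℝ f).comp (WithLp.fstL 2 ℝ (Lp ℝ 2 (vol g)) (Lp 𝔼 2 (vol g)))

theorem load_apply {g : Metric I M} (f : Lp ℝ 2 (vol g)) (z : PairSpace g) :
    load f z = ∫ p, f p * z.fst p ∂(vol g) := by
  rw [← inner_Lp_eq]
  rfl

theorem integral_gradInner_eq {g : Metric I M} {𝓕 : AdaptedFrame g} {z y : PairSpace g}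
    (hz : z ∈ weakGraph 𝓕) (hy : y ∈ weakGraph 𝓕) (b : ℝ) :
    ∫ p, (gradInner g z.fst y.fst p + b * z.fst p * y.fst p) ∂(vol g) = energyForm 𝓕 b z y := by
  rw [energyForm_eq_integral]
  refine integral_congr_ae ?_
  filter_upwards [gradInner_ae_eq hz hy Filter.EventuallyEq.rfl Filter.EventuallyEq.rfl] with p hp
  rw [hp]

theorem isWeakSolution_iff {g : Metric I M} {𝓕 : AdaptedFrame g} {b : ℝ} {f : Lp ℝ 2 (vol g)}
    {z : PairSpace g} (hz : z ∈ pairH10 𝓕 univ) :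
    IsWeakSolution g b f z.fst ↔ ∀ y ∈ pairH10 𝓕 univ, energyForm 𝓕 b z y = load f y := by
  have hzg := pairH10_le_weakGraph 𝓕 _ hz
  constructor
  · rintro ⟨-, h⟩ y hy
    have := h y.fst ((mem_H10_iff 𝓕).2 ⟨y, hy, rfl⟩)
    rwa [integral_gradInner_eq hzg (pairH10_le_weakGraph 𝓕 _ hy), ← load_apply] at this
  · intro h
    refine ⟨(mem_H10_iff 𝓕).2 ⟨z, hz, rfl⟩, fun v hv => ?_⟩
    obtain ⟨y, hy, rfl⟩ := (mem_H10_iff 𝓕).1 hv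
    rw [integral_gradInner_eq hzg (pairH10_le_weakGraph 𝓕 _ hy), ← load_apply]
    exact h y hy

/-- This makes a local step a projection. Elements of H¹₀(K) vanish with their gradients outside the
interior of `K`, so the integrals over `K` are integrals over `M`; the condition outside the
interior becomes membership of the difference in the local space, by `mem_pairH10_of_ae_eq_zero`. -/
theorem isLocalSolution_iff {g : Metric I M} {𝓕 : AdaptedFrame g} {b : ℝ} {f : Lp ℝ 2 (vol g)}
    {K : Set M} (hK : IsClosedLipschitzSubdomain I K) {z₀ z : PairSpace g}
    (hz₀ : z₀ ∈ pairH10 𝓕 univ) (hz : z ∈ pairH10 𝓕 univ) :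
    IsLocalSolution g b f K z₀.fst z.fst ↔
      (∀ y ∈ pairH10 𝓕 K, energyForm 𝓕 b z y = load f y) ∧ z - z₀ ∈ pairH10 𝓕 K := by
  have hzg := pairH10_le_weakGraph 𝓕 _ hz
  have hint : ∀ y ∈ pairH10 𝓕 K,
      ∫ p in K, (gradInner g z.fst y.fst p + b * z.fst p * y.fst p) ∂(vol g) = energyForm 𝓕 b z y ∧
      ∫ p in K, f p * y.fst p ∂(vol g) = load f y := by
    intro y hy
    have hyg := pairH10_le_weakGraph 𝓕 _ hy
    obtain ⟨h1, h2⟩ := ae_eq_zero_of_mem_pairH10 hy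
    rw [← integral_gradInner_eq hzg hyg, load_apply]
    constructor
    · refine setIntegral_eq_integral_of_ae_compl_eq_zero ?_
      filter_upwards [h1, h2, gradInner_ae_eq hzg hyg Filter.EventuallyEq.rfl
        Filter.EventuallyEq.rfl] with p h3 h4 h5 hp
      have hp' : p ∈ (interior K)ᶜ := fun h => hp (interior_subset h)
      rw [h5, pairInner, h3 hp', h4 hp', map_zero, mul_zero, add_zero]
    · refine setIntegral_eq_integral_of_ae_compl_eq_zero ?_
      filter_upwards [h1] with p h3 hp
      rw [h3 fun h => hp (interior_subset h), mul_zero]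
  have hsub : (∀ᵐ p ∂(vol g), p ∈ (interior K)ᶜ → z.fst p = z₀.fst p) ↔ z - z₀ ∈ pairH10 𝓕 K := by
    have hae := Lp.coeFn_sub z.fst z₀.fst
    constructor
    · intro h
      refine mem_pairH10_of_ae_eq_zero 𝓕 hK (sub_mem hz hz₀) ?_
      filter_upwards [h, hae] with p h1 h2 hp
      rw [WithLp.sub_fst, h2, Pi.sub_apply, h1 fun h => hp (interior_subset h), sub_self]
    · intro h
      filter_upwards [(ae_eq_zero_of_mem_pairH10 h).1, hae] with p h1 h2 hp
      have := h1 hp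
      rwa [WithLp.sub_fst, h2, Pi.sub_apply, sub_eq_zero] at this
  constructor
  · rintro ⟨-, h, h'⟩
    refine ⟨fun y hy => ?_, hsub.1 h'⟩
    have := h y.fst ((mem_H10_iff 𝓕).2 ⟨y, hy, rfl⟩)
    rwa [(hint y hy).1, (hint y hy).2] at this
  · rintro ⟨h, h'⟩
    refine ⟨(mem_H10_iff 𝓕).2 ⟨z, hz, rfl⟩, fun v hv => ?_, hsub.2 h'⟩
    obtain ⟨y, hy, rfl⟩ := (mem_H10_iff 𝓕).1 hv
    rw [(hint y hy).1, (hint y hy).2]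
    exact h y hy

theorem completeSpace_pairH10 {g : Metric I M} (𝓕 : AdaptedFrame g) (K : Set M) :
    CompleteSpace (pairH10 𝓕 K) := (isClosed_pairH10 𝓕 K).completeSpace_coe

theorem existsUnique_isWeakSolution {g : Metric I M} (𝓕 : AdaptedFrame g) {b c : ℝ} (hc : 0 < c)
    (hcoer : ∀ z ∈ pairH10 𝓕 univ, c * ‖z‖ ^ 2 ≤ energyForm 𝓕 b z z) (f : Lp ℝ 2 (vol g)) :
    ∃! u, IsWeakSolution g b f u := by
  have := completeSpace_pairH10 𝓕 (univ : Set M)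
  obtain ⟨z, hz, hzf⟩ := exists_mem_forall_form_eq (energyForm 𝓕 b) (pairH10 𝓕 univ) hc hcoer (load f)
  refine ⟨z.fst, (isWeakSolution_iff hz).2 hzf, fun u hu => ?_⟩
  obtain ⟨y, hy, rfl⟩ := (mem_H10_iff 𝓕).1 hu.1
  have hyf := (isWeakSolution_iff hy).1 hu
  rw [eq_of_forall_form_eq (energyForm 𝓕 b) (pairH10 𝓕 univ) hc hcoer (sub_mem hy hz)
    fun v hv => (hyf v hv).trans (hzf v hv).symm]

theorem existsUnique_isLocalSolution {g : Metric I M} (𝓕 : AdaptedFrame g) {b c : ℝ} (hc : 0 < c)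
    (hcoer : ∀ z ∈ pairH10 𝓕 univ, c * ‖z‖ ^ 2 ≤ energyForm 𝓕 b z z) (f : Lp ℝ 2 (vol g))
    {K : Set M} (hK : IsClosedLipschitzSubdomain I K) {w₀ : Lp ℝ 2 (vol g)}
    (hw₀ : w₀ ∈ H10 g univ) : ∃! w, IsLocalSolution g b f K w₀ w := by
  have := completeSpace_pairH10 𝓕 K
  obtain ⟨z₀, hz₀, rfl⟩ := (mem_H10_iff 𝓕).1 hw₀
  have hle : pairH10 𝓕 K ≤ pairH10 𝓕 univ := pairH10_mono 𝓕 (subset_univ K)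
  have hcoer' : ∀ z ∈ pairH10 𝓕 K, c * ‖z‖ ^ 2 ≤ energyForm 𝓕 b z z := fun z hz => hcoer z (hle hz)
  -- The unknown is the correction to `z₀`, so the load is the residual of `z₀`.
  obtain ⟨r, hr, hrf⟩ := exists_mem_forall_form_eq (energyForm 𝓕 b) (pairH10 𝓕 K) hc hcoer'
    (load f - energyForm 𝓕 b z₀)
  have hz : z₀ + r ∈ pairH10 𝓕 univ := add_mem hz₀ (hle hr)
  have hzf : ∀ y ∈ pairH10 𝓕 K, energyForm 𝓕 b (z₀ + r) y = load f y := fun y hy => by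
    rw [map_add, add_apply, hrf y hy, sub_apply]
    ring
  refine ⟨(z₀ + r).fst, (isLocalSolution_iff hK hz₀ hz).2 ⟨hzf, by rwa [add_sub_cancel_left]⟩,
    fun w hw => ?_⟩
  obtain ⟨y, hy, rfl⟩ := (mem_H10_iff 𝓕).1 hw.1
  obtain ⟨hyf, hyr⟩ := (isLocalSolution_iff hK hz₀ hy).1 hw
  rw [eq_of_forall_form_eq (energyForm 𝓕 b) (pairH10 𝓕 K) hc hcoer' (w := y) (w' := z₀ + r)
    (by rw [← sub_sub]; exact sub_mem hyr hr) fun v hv => (hyf v hv).trans (hzf v hv).symm]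

theorem IsLocalSolution.mem {g : Metric I M} {b : ℝ} {f w₀ w : Lp ℝ 2 (vol g)} {K : Set M}
    (h : IsLocalSolution g b f K w₀ w) : w ∈ H10 g univ := h.1

/-- Stable decomposition into elements of the local spaces. -/
theorem exists_stable_decomposition {g : Metric I M} (𝓕 : AdaptedFrame g) {b c : ℝ} (hc : 0 < c)
    (hcoer : ∀ z ∈ pairH10 𝓕 univ, c * ‖z‖ ^ 2 ≤ energyForm 𝓕 b z z) {m : ℕ} {K : Fin m → Set M}
    (hcover : ⋃ i, interior (K i) = univ) :
    ∃ C : ℝ, 0 ≤ C ∧ ∀ z ∈ pairH10 𝓕 univ, ∃ v : Fin m → PairSpace g,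
      (∀ i, v i ∈ pairH10 𝓕 (K i)) ∧ ∑ i, v i = z ∧
      ∀ i, energyForm 𝓕 b (v i) (v i) ≤ C * energyForm 𝓕 b z z := by
  classical
  obtain ⟨t, χ, hχ, hχs, hsum⟩ := exists_finite_smooth_partition (I := I)
    (fun i => interior (K i)) (fun i => isOpen_interior) hcover
  -- Subordination to the interiors sends each product into the local space with a bounded norm.
  choose C hC0 hC using fun i => exists_mul_mem_pairH10 𝓕 (hχ i) (hχs i)
  set A := ‖energyForm 𝓕 b‖ with hA
  -- For each piece: boundedness of the form, boundedness of multiplication by `χ i`, and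
  -- coercivity. The sum over `i` gives a common constant.
  refine ⟨∑ i, A * (C i ^ 2 / c), Finset.sum_nonneg fun i _ => by positivity, fun z hz => ?_⟩
  choose w hw hwz hwC using fun i => hC i z hz
  -- Only the members of `t` enter the partition of unity; the other pieces are zero.
  refine ⟨fun i => if i ∈ t then w i else 0, fun i => ?_, ?_, fun i => ?_⟩
  · simp only
    split_ifs
    · exact hw i
    · exact zero_mem _
  · rw [← Finset.sum_filter, Finset.filter_mem_eq_inter, Finset.univ_inter, eq_comm]
    refine eq_of_mem_weakGraph (pairH10_le_weakGraph 𝓕 _ hz)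
      (sum_mem fun i _ => pairH10_le_weakGraph 𝓕 _ (hw i)) ?_
    have h1 : (∑ i ∈ t, w i).fst = ∑ i ∈ t, (w i).fst :=
      map_sum (WithLp.fstL 2 ℝ (Lp ℝ 2 (vol g)) (Lp 𝔼 2 (vol g))) w t
    rw [h1]
    filter_upwards [Lp.coeFn_finsetSum t fun i => (w i).fst, (t.eventually_all).2 fun i _ => hwz i]
      with q hq hq'
    rw [hq, Finset.sum_apply, Finset.sum_congr rfl fun i hi => hq' i hi, ← Finset.sum_mul, hsum,
      one_mul]
  · have hz0 := (mul_nonneg hc.le (sq_nonneg ‖z‖)).trans (hcoer z hz)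
    have h1 : energyForm 𝓕 b (w i) (w i) ≤ A * (C i ^ 2 / c) * energyForm 𝓕 b z z := by
      have h2 : energyForm 𝓕 b (w i) (w i) ≤ A * ‖w i‖ * ‖w i‖ :=
        (le_abs_self _).trans ((energyForm 𝓕 b).le_opNorm₂ (w i) (w i))
      have h3 : ‖w i‖ ^ 2 ≤ C i ^ 2 * ‖z‖ ^ 2 := by
        rw [← mul_pow]
        exact pow_le_pow_left₀ (norm_nonneg _) (hwC i) 2
      have h4 : ‖z‖ ^ 2 ≤ energyForm 𝓕 b z z / c := by
        rw [le_div_iff₀' hc]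
        exact hcoer z hz
      calc _ ≤ A * ‖w i‖ ^ 2 := h2.trans_eq (by ring)
        _ ≤ A * (C i ^ 2 * (energyForm 𝓕 b z z / c)) := by
            refine mul_le_mul_of_nonneg_left (h3.trans ?_) (by positivity)
            gcongr
        _ = _ := by ring
    have h5 : A * (C i ^ 2 / c) ≤ ∑ i, A * (C i ^ 2 / c) :=
      Finset.single_le_sum (f := fun i => A * (C i ^ 2 / c)) (fun i _ => by positivity)
        (Finset.mem_univ i)
    have h6 := mul_le_mul_of_nonneg_right h5 hz0
    simp only
    split_ifs
    · exact h1.trans h6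
    · rw [map_zero]
      refine le_trans (le_of_eq (by simp)) (mul_nonneg ?_ hz0)
      exact Finset.sum_nonneg fun i _ => by positivity

/-- A sweep contracts the energy of the error. -/
theorem exists_energyForm_sweep_le {g : Metric I M} (𝓕 : AdaptedFrame g) {b c : ℝ} (hb : 0 ≤ b)
    (hc : 0 < c) (hcoer : ∀ z ∈ pairH10 𝓕 univ, c * ‖z‖ ^ 2 ≤ energyForm 𝓕 b z z)
    {f : Lp ℝ 2 (vol g)} {m : ℕ} {K : Fin m → Set M}
    (hK : ∀ i, IsClosedLipschitzSubdomain I (K i)) (hcover : ⋃ i, interior (K i) = univ) :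
    ∃ ρ : ℝ, 0 ≤ ρ ∧ ρ < 1 ∧ ∀ u ∈ pairH10 𝓕 univ, IsWeakSolution g b f u.fst →
      ∀ x ∈ pairH10 𝓕 univ, ∀ y ∈ pairH10 𝓕 univ, IsSweep g b f K x.fst y.fst →
      energyForm 𝓕 b (u - y) (u - y) ≤ ρ * energyForm 𝓕 b (u - x) (u - x) := by
  obtain ⟨C, hC0, hC⟩ := exists_stable_decomposition 𝓕 hc hcoer hcover
  have hD : (0 : ℝ) < m ^ 4 * C + 1 := by positivity
  refine ⟨m ^ 4 * C / (m ^ 4 * C + 1), by positivity, (div_lt_one hD).2 (by linarith),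
    fun u hu hus x hx y hy ⟨w, hw0, hw, hwl⟩ => ?_⟩
  have huf := (isWeakSolution_iff hu).1 hus
  have hwm : ∀ j, w j ∈ H10 g univ := mem_of_chain (S := H10 g univ)
    (R := fun i => IsLocalSolution g b f (K i)) (fun i _ _ _ h => h.mem)
    (by rw [hw0]; exact (mem_H10_iff 𝓕).2 ⟨x, hx, rfl⟩) hw
  choose Z hZ hZw using fun j => (mem_H10_iff 𝓕).1 (hwm j)
  have hZl : ∀ i : Fin m, (∀ y ∈ pairH10 𝓕 (K i), energyForm 𝓕 b (Z i.succ) y = load f y) ∧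
      Z i.succ - Z i.castSucc ∈ pairH10 𝓕 (K i) := fun i => by
    have := hw i
    rw [← hZw, ← hZw] at this
    exact (isLocalSolution_iff (hK i) (hZ _) (hZ _)).1 this
  -- The lifts of the intermediate functions were chosen arbitrarily; uniqueness identifies the
  -- first and the last with `x` and `y`.
  have hpair : ∀ z ∈ pairH10 𝓕 univ, ∀ z' ∈ pairH10 𝓕 univ, z.fst = z'.fst → z = z' :=
    fun z hz z' hz' h => eq_of_mem_weakGraph (pairH10_le_weakGraph 𝓕 _ hz)
      (pairH10_le_weakGraph 𝓕 _ hz') (by rw [h])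
  have hZ0 : Z 0 = x := hpair _ (hZ 0) _ hx (by rw [hZw, hw0])
  have hZm : Z (Fin.last m) = y := hpair _ (hZ _) _ hy (by rw [hZw, hwl])
  obtain ⟨v, hv, hsum, hvC⟩ := hC (u - Z 0) (sub_mem hu (hZ 0))
  have := form_last_le_of_decomposition (energyForm_comm 𝓕 b) (energyForm_self_nonneg 𝓕 hb)
    (W := fun i => pairH10 𝓕 (K i)) (e := fun j => u - Z j)
    (fun i => by
      rw [sub_sub_sub_cancel_left]
      exact (hZl i).2)
    (fun i y hy => by
      rw [map_sub, sub_apply, (hZl i).1 y hy, huf y (pairH10_mono 𝓕 (subset_univ _) hy), sub_self])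
    hv hsum hC0 hvC
  rw [hZ0, hZm] at this
  rw [div_mul_eq_mul_div, le_div_iff₀' hD]
  exact this

end SchwarzMethod

end SchwarzManifold
end

/-! ### Geometric convergence of the iteration -/

noncomputable section

namespace SchwarzManifold

set_option linter.unusedSectionVars false

section Convergence

variable {d : ℕ} {H : Type*} [TopologicalSpace H]
  {I : ModelWithCorners ℝ (EuclideanSpace ℝ (Fin d)) H}
  {M : Type*} [TopologicalSpace M] [ChartedSpace H M] [IsManifold I ∞ M]
  [MeasurableSpace M] [BorelSpace M] [CompactSpace M] [T2Space M]

theorem IsSweep.mem {g : Metric I M} {b : ℝ} {f : Lp ℝ 2 (vol g)} {m : ℕ} {K : Fin m → Set M}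
    {x y : Lp ℝ 2 (vol g)} (h : IsSweep g b f K x y) (hx : x ∈ H10 g univ) : y ∈ H10 g univ := by
  obtain ⟨w, h0, hw, rfl⟩ := h
  exact mem_of_chain (S := H10 g univ) (R := fun i => IsLocalSolution g b f (K i))
    (fun i _ _ _ h => h.mem) (by rwa [h0]) hw _

theorem IsSchwarzIteration.mem {g : Metric I M} {b : ℝ} {f : Lp ℝ 2 (vol g)} {m : ℕ}
    {K : Fin m → Set M} {u₀ : Lp ℝ 2 (vol g)} {U : ℕ → Lp ℝ 2 (vol g)}
    (h : IsSchwarzIteration g b f K u₀ U) (hu₀ : u₀ ∈ H10 g univ) (n : ℕ) : U n ∈ H10 g univ := by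
  induction n with
  | zero => rwa [h.1]
  | succ n ih => exact (h.2 n).mem ih

theorem existsUnique_isSchwarzIteration {g : Metric I M} (𝓕 : AdaptedFrame g) {b c : ℝ}
    (hc : 0 < c) (hcoer : ∀ z ∈ pairH10 𝓕 univ, c * ‖z‖ ^ 2 ≤ energyForm 𝓕 b z z)
    (f : Lp ℝ 2 (vol g)) {m : ℕ} {K : Fin m → Set M}
    (hK : ∀ i, IsClosedLipschitzSubdomain I (K i)) {u₀ : Lp ℝ 2 (vol g)}
    (hu₀ : u₀ ∈ H10 g univ) : ∃! U, IsSchwarzIteration g b f K u₀ U :=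
  existsUnique_iterate (R := IsSweep g b f K) (fun _ hx _ h => h.mem hx)
    (fun _ hx => existsUnique_chain (S := H10 g univ)
      (R := fun i => IsLocalSolution g b f (K i)) (fun _ _ _ _ h => h.mem)
      (fun i _ hx => existsUnique_isLocalSolution 𝓕 hc hcoer f (hK i) hx) hx) hu₀

/-- The energy of the error decays like ρⁿ, and on H¹₀(M) the energy norm is equivalent to the
Sobolev norm. Hence L = √ρ, and the constants of equivalence make up `C₀`. -/
theorem exists_h1Norm_sub_iterate_le {g : Metric I M} (𝓕 : AdaptedFrame g) {b c : ℝ} (hb : 0 ≤ b)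
    (hc : 0 < c) (hcoer : ∀ z ∈ pairH10 𝓕 univ, c * ‖z‖ ^ 2 ≤ energyForm 𝓕 b z z)
    (f : Lp ℝ 2 (vol g)) {m : ℕ} {K : Fin m → Set M}
    (hK : ∀ i, IsClosedLipschitzSubdomain I (K i)) (hcover : ⋃ i, interior (K i) = univ) :
    ∃ C₀ : ℝ, 0 < C₀ ∧ ∃ L : ℝ, 0 ≤ L ∧ L < 1 ∧ ∀ u, IsWeakSolution g b f u →
      ∀ u₀ ∈ H10 g univ, ∀ U, IsSchwarzIteration g b f K u₀ U → ∀ n : ℕ,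
        h1Norm g (u - U n) ≤ C₀ * L ^ n * h1Norm g (u - u₀) := by
  obtain ⟨ρ, hρ0, hρ1, hρ⟩ := exists_energyForm_sweep_le 𝓕 (f := f) hb hc hcoer hK hcover
  have hκ : 0 < 𝓕.K + 1 := by have := 𝓕.K_pos; positivity
  -- `A` and `c` bound the energy from above and below by the norm of pairs, which yields √(A / c);
  -- the factor `𝓕.K + 1` comes from two passages between this norm and `h1Norm`. The summand `1`
  -- makes `C₀` positive.
  set A := ‖energyForm 𝓕 b‖ + 1 with hA
  refine ⟨(𝓕.K + 1) * Real.sqrt (A / c), by positivity, Real.sqrt ρ, Real.sqrt_nonneg _,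
    (Real.sqrt_lt' one_pos).2 (by rwa [one_pow]), fun u hu u₀ hu₀ U hU n => ?_⟩
  obtain ⟨z, hz, rfl⟩ := (mem_H10_iff 𝓕).1 hu.1
  choose Z hZ hZU using fun n => (mem_H10_iff 𝓕).1 (hU.mem hu₀ n)
  have hpow : ∀ n, energyForm 𝓕 b (z - Z n) (z - Z n) ≤
      ρ ^ n * energyForm 𝓕 b (z - Z 0) (z - Z 0) := by
    intro n
    induction n with
    | zero => rw [pow_zero, one_mul]
    | succ n ih =>
      have h1 := hρ z hz hu (Z n) (hZ n) (Z (n + 1)) (hZ _) (by rw [hZU, hZU]; exact hU.2 n)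
      calc _ ≤ _ := h1
        _ ≤ ρ * (ρ ^ n * energyForm 𝓕 b (z - Z 0) (z - Z 0)) := mul_le_mul_of_nonneg_left ih hρ0
        _ = _ := by ring
  have hnorm : ‖z - Z n‖ ≤ Real.sqrt (A / c) * Real.sqrt ρ ^ n * ‖z - Z 0‖ := by
    have h1 : energyForm 𝓕 b (z - Z 0) (z - Z 0) ≤ A * ‖z - Z 0‖ ^ 2 := by
      have h2 := (le_abs_self _).trans ((energyForm 𝓕 b).le_opNorm₂ (z - Z 0) (z - Z 0))
      have h3 : 0 ≤ ‖z - Z 0‖ ^ 2 := sq_nonneg _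
      rw [hA, add_mul, pow_two, ← mul_assoc]
      exact h2.trans (le_add_of_nonneg_right (by positivity))
    refine le_of_sq_le_sq ?_ (by positivity)
    rw [mul_pow, mul_pow, ← pow_mul, mul_comm n 2, pow_mul, Real.sq_sqrt hρ0,
      Real.sq_sqrt (by positivity), div_mul_eq_mul_div, div_mul_eq_mul_div, le_div_iff₀' hc]
    calc _ ≤ _ := hcoer _ (sub_mem hz (hZ n))
      _ ≤ _ := hpow n
      _ ≤ ρ ^ n * (A * ‖z - Z 0‖ ^ 2) := mul_le_mul_of_nonneg_left h1 (by positivity)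
      _ = _ := by ring
  have hae : ∀ k, (↑↑z.fst - ↑↑(U k) : M → ℝ) =ᵐ[vol g] (z - Z k).fst := fun k => by
    rw [WithLp.sub_fst, hZU]
    exact (Lp.coeFn_sub _ _).symm
  have hg : ∀ k, z - Z k ∈ weakGraph 𝓕 := fun k =>
    pairH10_le_weakGraph 𝓕 _ (sub_mem hz (hZ k))
  rw [← hU.1]
  calc _ ≤ Real.sqrt (𝓕.K + 1) * ‖z - Z n‖ := h1Norm_le_norm (hg n) (hae n)
    _ ≤ Real.sqrt (𝓕.K + 1) * (Real.sqrt (A / c) * Real.sqrt ρ ^ n *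
        (Real.sqrt (𝓕.K + 1) * h1Norm g (z.fst - U 0))) := by
        gcongr
        exact hnorm.trans (mul_le_mul_of_nonneg_left (norm_le_h1Norm (hg 0) (hae 0))
          (by positivity))
    _ = (Real.sqrt (𝓕.K + 1) * Real.sqrt (𝓕.K + 1)) * Real.sqrt (A / c) * Real.sqrt ρ ^ n *
        h1Norm g (z.fst - U 0) := by ring
    _ = _ := by rw [Real.mul_self_sqrt hκ.le]

end Convergence

end SchwarzManifold
end

theorem theorem2p1 {d : ℕ} {H : Type*} [TopologicalSpace H]
    (I : ModelWithCorners ℝ (EuclideanSpace ℝ (Fin d)) H)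
    {M : Type*} [TopologicalSpace M] [ChartedSpace H M] [IsManifold I ∞ M]
    [CompactSpace M] [ConnectedSpace M] [T2Space M] [MeasurableSpace M] [BorelSpace M]
    (g : SchwarzManifold.Metric I M)
    (b : ℝ) (hb : 0 ≤ b) (hb' : I.boundary M = ∅ → 0 < b)
    (f : Lp ℝ 2 (SchwarzManifold.vol g))
    {m : ℕ} (K : Fin m → Set M)
    (hK : ∀ i, SchwarzManifold.IsClosedLipschitzSubdomain I (K i))
    (hcover : ⋃ i, interior (K i) = univ) :
    (∃! u, SchwarzManifold.IsWeakSolution g b f u) ∧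
    (∀ u₀ ∈ SchwarzManifold.H10 g univ, ∃! U, SchwarzManifold.IsSchwarzIteration g b f K u₀ U) ∧
    ∃ C₀ : ℝ, 0 < C₀ ∧ ∃ L : ℝ, 0 ≤ L ∧ L < 1 ∧
      ∀ u, SchwarzManifold.IsWeakSolution g b f u →
      ∀ u₀ ∈ SchwarzManifold.H10 g univ,
      ∀ U, SchwarzManifold.IsSchwarzIteration g b f K u₀ U →
      ∀ n : ℕ, 0 < n →
        SchwarzManifold.h1Norm g (u - U n) ≤ C₀ * L ^ n * SchwarzManifold.h1Norm g (u - u₀) := by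
  obtain ⟨𝓕⟩ := SchwarzManifold.exists_adaptedFrame g
  obtain ⟨c, hc, hcoer⟩ := SchwarzManifold.exists_energyForm_coercive 𝓕 hb hb'
  obtain ⟨C₀, hC₀, L, hL0, hL1, h⟩ :=
    SchwarzManifold.exists_h1Norm_sub_iterate_le 𝓕 hb hc hcoer f hK hcover
  exact ⟨SchwarzManifold.existsUnique_isWeakSolution 𝓕 hc hcoer f,
    fun u₀ hu₀ => SchwarzManifold.existsUnique_isSchwarzIteration 𝓕 hc hcoer f hK hu₀,
    C₀, hC₀, L, hL0, hL1, fun u hu u₀ hu₀ U hU n _ => h u hu u₀ hu₀ U hU n⟩
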